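/- **Theorem.** Fix $T>0$. For $a,b\in\mathbb R$ and $T'\ge 0$ let $\Lambda^+_{a,b}(T')$ be the set of continuous functions $g:[0,\infty)\times[0,T']\to[0,\infty)$ with $\sup_{0\le t\le T'}\int_0^\infty (z^{a}+z^{b})\,|g(z,t)|\,dz<\infty$. Assume: - $\Phi(z,z_1)=c\,(z^{\alpha}z_1^{\alpha'}+z^{\alpha'}z_1^{\alpha})$ on $[0,\infty)^2$ with $c\ge 0$ and $0<\alpha,\alpha'\le \tfrac12$; - $E:[0,\infty)^2\to[0,1]$ is continuous and symmetric, and $E_1=1-E$; - $P(z|z_1;z_2)=\dfrac{2}{z_1+z_2}$ for $0\le z\le z_1+z_2$, and $P(z|z_1;z_2)=0$ for $z>z_1+z_2$; - $\max\{1+\alpha,1+\alpha'\}\le\sigma_2\le 2$ and $\max\{1-\alpha,1-\alpha'\}\le\sigma_1<1$; - $g_0\in\Lambda^+_{-\sigma_1,\sigma_2}(0)$, that is, $g_0:[0,\infty)\to[0,\infty)$ is continuous and $\int_0^\infty (z^{-\sigma_1}+z^{\sigma_2})\,g_0(z)\,dz<\infty$. Consider, with $\mathcal G(z,z_1,t)=\Phi(z,z_1)g(z,t)g(z_1,t)$,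 the continuous coagulation equation with collisional breakage $$\frac{\partial g}{\partial t}(z,t)=\frac12\int_0^z E(z-z_1,z_1)\,\mathcal G(z-z_1,z_1,t)\,dz_1-\int_0^\infty \mathcal G(z,z_1,t)\,dz_1+\frac12\int_z^\infty\!\int_0^{z_1}P(z|z_1-z_2;z_2)\,E_1(z_1-z_2,z_2)\,\mathcal G(z_1-z_2,z_2,t)\,dz_2\,dz_1,$$ $$g(z,0)=g_0(z).$$ A classical solution on $[0,T]$ is a continuous function $g$ on $[0,\infty)\times[0,T]$ for which all these integrals converge, which has a continuous partial derivative $\partial g/\partial t$ on $[0,\infty)\times[0,T]$ (one-sided at $t=0$ and $t=T$), and which satisfies the equation and the initial condition at every point. Then there is a classical solution $g$ on $[0,T]$ in the class $$\Lambda^+_{-\sigma_1,\sigma_2}(T)\cap\bigl(\Lambda^+_{-1/2,-\sigma_1}(T)\cup\Lambda^+_{1,\sigma_2}(T)\bigr),$$ it is the only classical solution in this class, and it conserves mass: $\int_0^\infty z\,g(z,t)\,dz=\int_0^\infty z\,g_0(z)\,dz<\infty$ for all $t\in[0,T]$. -/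

import Mathlib

open MeasureTheory Set

namespace CollisionalBreakage

noncomputable section

/-- The collision kernel `Φ(z, z₁) = c (z^α z₁^α' + z^α' z₁^α)`. -/
def collisionKernel (c α α' : ℝ) (z z₁ : ℝ) : ℝ :=
  c * (z ^ α * z₁ ^ α' + z ^ α' * z₁ ^ α)

/-- The binary distribution function `P(z | z₁; z₂) = 2 / (z₁ + z₂)` for `z ≤ z₁ + z₂`;
no fragment is larger than `z₁ + z₂`. -/
def binaryDistribution (z z₁ z₂ : ℝ) : ℝ :=
  if z ≤ z₁ + z₂ then 2 / (z₁ + z₂) else 0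

/-- An efficiency of coalescence on `[0, ∞)²`: continuous, symmetric, with values in `[0, 1]`.
The efficiency of breakage is then `E₁ = 1 - E`. -/
structure IsEfficiency (E : ℝ → ℝ → ℝ) : Prop where
  continuousOn : ContinuousOn (Function.uncurry E) (Ici 0 ×ˢ Ici 0)
  symm : ∀ z z₁, 0 ≤ z → 0 ≤ z₁ → E z z₁ = E z₁ z
  nonneg : ∀ z z₁, 0 ≤ z → 0 ≤ z₁ → 0 ≤ E z z₁
  le_one : ∀ z z₁, 0 ≤ z → 0 ≤ z₁ → E z z₁ ≤ 1

/-- The collision rate `𝒢(z, z₁, t) = Φ(z, z₁) g(z, t) g(z₁, t)`. -/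
def collisionRate (Φ : ℝ → ℝ → ℝ) (g : ℝ → ℝ → ℝ) (z z₁ t : ℝ) : ℝ :=
  Φ z z₁ * g z t * g z₁ t

/-- The integrand of the coagulation gain term. -/
def coagIntegrand (Φ E : ℝ → ℝ → ℝ) (g : ℝ → ℝ → ℝ) (z t z₁ : ℝ) : ℝ :=
  E (z - z₁) z₁ * collisionRate Φ g (z - z₁) z₁ t

/-- The integrand of the breakage gain term. -/
def breakIntegrand (Φ E : ℝ → ℝ → ℝ) (P : ℝ → ℝ → ℝ → ℝ) (g : ℝ → ℝ → ℝ) (z t z₁ z₂ : ℝ) : ℝ :=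
  P z (z₁ - z₂) z₂ * (1 - E (z₁ - z₂) z₂) * collisionRate Φ g (z₁ - z₂) z₂ t

/-- `𝒞(g)(z, t)`: birth by coalescence. -/
def coagGain (Φ E : ℝ → ℝ → ℝ) (g : ℝ → ℝ → ℝ) (z t : ℝ) : ℝ :=
  (1 / 2) * ∫ z₁ in (0 : ℝ)..z, coagIntegrand Φ E g z t z₁

/-- `ℬ(g)(z, t)`: death by coalescence and breakage. -/
def collisionLoss (Φ : ℝ → ℝ → ℝ) (g : ℝ → ℝ → ℝ) (z t : ℝ) : ℝ :=
  ∫ z₁ in Ioi (0 : ℝ), collisionRate Φ g z z₁ t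

/-- `ℬ*(g)(z, t)`: birth by collisional breakage. -/
def breakGain (Φ E : ℝ → ℝ → ℝ) (P : ℝ → ℝ → ℝ → ℝ) (g : ℝ → ℝ → ℝ) (z t : ℝ) : ℝ :=
  (1 / 2) * ∫ z₁ in Ioi z, ∫ z₂ in (0 : ℝ)..z₁, breakIntegrand Φ E P g z t z₁ z₂

/-- The right-hand side `𝒞(g) - ℬ(g) + ℬ*(g)` of the equation. -/
def rhs (Φ E : ℝ → ℝ → ℝ) (P : ℝ → ℝ → ℝ → ℝ) (g : ℝ → ℝ → ℝ) (z t : ℝ) : ℝ :=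
  coagGain Φ E g z t - collisionLoss Φ g z t + breakGain Φ E P g z t

/-- The strip `[0, ∞) × [0, T]`. -/
def strip (T : ℝ) : Set (ℝ × ℝ) := Ici 0 ×ˢ Icc 0 T

/-- The positive cone `Λ⁺_{a, b}(T)`: continuous non-negative functions on the strip with
`sup_{0 ≤ t ≤ T} ∫₀^∞ (z^a + z^b) |g(z, t)| dz < ∞`.
The values of `g` off the strip are irrelevant. -/
def LambdaPos (a b T : ℝ) : Set (ℝ → ℝ → ℝ) :=
  {g | ContinuousOn (Function.uncurry g) (strip T) ∧
    (∀ z t, (z, t) ∈ strip T → 0 ≤ g z t) ∧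
    ∃ K : ℝ, ∀ t ∈ Icc 0 T,
      IntegrableOn (fun z => (z ^ a + z ^ b) * |g z t|) (Ioi 0) ∧
      ∫ z in Ioi (0 : ℝ), (z ^ a + z ^ b) * |g z t| ≤ K}

/-- `g` is a classical solution on the strip `[0, ∞) × [0, T]` with initial datum `g₀`: all
integrals in the equation converge, `g` has a continuous partial derivative in time (one-sided at
`t = 0` and `t = T`), and the equation and the initial condition hold at every point. -/
structure IsClassicalSolution (Φ E : ℝ → ℝ → ℝ) (P : ℝ → ℝ → ℝ → ℝ) (T : ℝ) (g₀ : ℝ → ℝ)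
    (g : ℝ → ℝ → ℝ) : Prop where
  continuousOn : ContinuousOn (Function.uncurry g) (strip T)
  coag_integrable : ∀ z t, (z, t) ∈ strip T →
    IntervalIntegrable (coagIntegrand Φ E g z t) volume 0 z
  loss_integrable : ∀ z t, (z, t) ∈ strip T →
    IntegrableOn (fun z₁ => collisionRate Φ g z z₁ t) (Ioi 0)
  break_integrable_inner : ∀ z t, (z, t) ∈ strip T → ∀ z₁, z < z₁ →
    IntervalIntegrable (breakIntegrand Φ E P g z t z₁) volume 0 z₁
  break_integrable : ∀ z t, (z, t) ∈ strip T →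
    IntegrableOn (fun z₁ => ∫ z₂ in (0 : ℝ)..z₁, breakIntegrand Φ E P g z t z₁ z₂) (Ioi z)
  deriv_continuousOn : ContinuousOn (Function.uncurry (rhs Φ E P g)) (strip T)
  hasDerivWithinAt : ∀ z t, (z, t) ∈ strip T →
    HasDerivWithinAt (fun s => g z s) (rhs Φ E P g z t) (Icc 0 T) t
  initial : ∀ z, 0 ≤ z → g z 0 = g₀ z

/-- The moment `ℳ_r(t) = ∫₀^∞ z^r g(z, t) dz`. -/
def moment (r : ℝ) (g : ℝ → ℝ → ℝ) (t : ℝ) : ℝ :=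
  ∫ z in Ioi (0 : ℝ), z ^ r * g z t

/-- The total mass `ℳ₁(t)` is finite and equal to `ℳ₁(0)` for all `t ∈ [0, T]`. -/
def IsMassConserving (T : ℝ) (g : ℝ → ℝ → ℝ) : Prop :=
  ∀ t ∈ Icc 0 T, IntegrableOn (fun z => z ^ (1 : ℝ) * g z t) (Ioi 0) ∧
    moment 1 g t = moment 1 g 0

/-- The solution class `Λ⁺_{-σ₁, σ₂}(T) ∩ (Λ⁺_{-1/2, -σ₁}(T) ∪ Λ⁺_{1, σ₂}(T))`. -/
def solutionClass (σ₁ σ₂ T : ℝ) : Set (ℝ → ℝ → ℝ) :=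
  LambdaPos (-σ₁) σ₂ T ∩ (LambdaPos (-(1 / 2)) (-σ₁) T ∪ LambdaPos 1 σ₂ T)

end

end CollisionalBreakage

namespace CollisionalBreakage

noncomputable section

open Filter Topology Function

section

/-! Tested against a function ψ, the right-hand side becomes an integral over colliding pairs `(x,
y)` with density `f = K g g`: each pair contributes ½ e ψ(x+y) + (1 - e) · (mean of ψ over [0, x+y])
- ψ(x) (`collision_weak`). For ψ = 1 this is -e/2, so the number of particles does not grow; for ψ =
z it is (y - x)/2, which is antisymmetric, so mass is conserved. For ψ = z^r with r = -σ₁ or 1 ≤ r ≤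
3, the symmetrized contribution times the kernel is bounded by terms that contain the r-th power of
only one of the two sizes and at most the first power of the other (`weakKernel_neg_le`,
`weakKernel_pos_le`). The r-th moment thus satisfies a linear inequality whose coefficients are
number and mass, and Gronwall bounds it on `[0, T]`.

Uniqueness comes from an L¹ estimate with weight 1 + z (`stability`). With u = g - h and ψ = (1 + z)
sgn u, the loss term yields exactly -(1 + x)|u(x)|, and this cancels the part of the gain in which
the large size would carry too high a weight. After exchanging the two variables, only (1 + y) K(x,
y) |u(x)| (g + h)(y) is left, and K(x, y)(1 + y) ≤ C (1 + x) ω(y), where ω = z^(-σ₁) + z^σ₂ is the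
weight of the class. Hence the distance obeys a linear Gronwall inequality with a constant depending
only on the ω-moments. The estimate also allows two different kernels, at the price of an error
term.

For existence, collisions of total size at least N are switched off and the initial datum is cut off
at size L. The densities in the collision rate are moreover clamped to [0, M], which gives a bounded
Lipschitz vector field on C([0, N]), so Picard-Lindelöf applies (`exists_clamped_solution`). Its
solution is non-negative and, by Gronwall for the supremum, stays below a suitably chosen M, so the
clamp is inactive (`exists_mild_of_truncated`).

The truncated solutions have uniform ω-moments. By the stability estimate they are Cauchy in the
weighted L¹ norm: the kernel error is of order N⁻¹ (third moment)², the third moment is of order L²,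
and N = L⁵ makes the error of order 1/L. L¹ convergence improves to locally uniform convergence
because, at a fixed size, every term of the difference of two collision operators is controlled by
the L¹ distance and the kernel error, except for a damping term of favourable sign
(`abs_collisionOp_sub_add_le`). The limit solves the time-integrated equation with a continuous
right-hand side, hence is classical. Conversely, a classical solution in the class solves the
integrated equation, so stability applies to it. -/

/-- Lebesgue measure on `(0, ∞)`. -/
abbrev posMeasure : Measure ℝ := volume.restrict (Ioi 0)

/-! ### A Gronwall inequality for families of bounded functions -/

/-- The least S with φ ≤ S e^{lt} is itself admissible, and the hypothesis makes a + S/2 admissible;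
so S ≤ a + S/2, that is S ≤ 2a. No regularity in time is used, only an a priori bound, and the index
set allows suprema over sizes. -/
theorem gronwall_family {ι : Type*} {φ : ι → ℝ → ℝ} {I : Set ℝ} {a l : ℝ}
    (ha : 0 ≤ a) (hl : 0 ≤ l) (hI : ∀ t ∈ I, 0 ≤ t)
    (hb : ∃ S : ℝ, ∀ i, ∀ t ∈ I, φ i t ≤ S)
    (h : ∀ S : ℝ, 0 ≤ S → (∀ i, ∀ t ∈ I, φ i t ≤ S * Real.exp (l * t)) →
      ∀ i, ∀ t ∈ I, φ i t ≤ a + S / 2 * Real.exp (l * t)) :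
    ∀ i, ∀ t ∈ I, φ i t ≤ 2 * a * Real.exp (l * t) := by
  set V : Set ℝ := {S | 0 ≤ S ∧ ∀ i, ∀ t ∈ I, φ i t ≤ S * Real.exp (l * t)} with hV
  have hone : ∀ t ∈ I, 1 ≤ Real.exp (l * t) := fun t ht =>
    Real.one_le_exp (mul_nonneg hl (hI t ht))
  have hne : V.Nonempty := by
    obtain ⟨S, hS⟩ := hb
    refine ⟨max S 0, le_max_right _ _, fun i t ht => (hS i t ht).trans ?_⟩
    exact (le_max_left _ _).trans (le_mul_of_one_le_right (le_max_right _ _) (hone t ht))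
  have hbdd : BddBelow V := ⟨0, fun S hS => hS.1⟩
  have hinf : sInf V ∈ V := by
    refine ⟨le_csInf hne fun S hS => hS.1, fun i t ht => ?_⟩
    have : φ i t / Real.exp (l * t) ≤ sInf V :=
      le_csInf hne fun S hS => (div_le_iff₀ (Real.exp_pos _)).2 (hS.2 i t ht)
    exact (div_le_iff₀ (Real.exp_pos _)).1 this
  have hmem : a + sInf V / 2 ∈ V := by
    refine ⟨by linarith [hinf.1], fun i t ht => (h _ hinf.1 hinf.2 i t ht).trans ?_⟩
    nlinarith [hone t ht]
  have hle : sInf V ≤ 2 * a := by linarith [csInf_le hbdd hmem]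
  exact fun i t ht => (hinf.2 i t ht).trans
    (mul_le_mul_of_nonneg_right hle (Real.exp_pos _).le)

/-- The exponent grows at twice the rate b, which produces the factor 1/2 that closes the argument
in `gronwall_family`. -/
theorem integral_exp_le (b t : ℝ) :
    ∫ s in (0 : ℝ)..t, b * Real.exp (2 * b * s) ≤ 1 / 2 * Real.exp (2 * b * t) := by
  have h : ∫ s in (0 : ℝ)..t, b * Real.exp (2 * b * s)
      = 1 / 2 * Real.exp (2 * b * t) - 1 / 2 * Real.exp (2 * b * 0) := by
    apply intervalIntegral.integral_eq_sub_of_hasDerivAt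
      (f := fun s => 1 / 2 * Real.exp (2 * b * s))
    · intro x _
      have := ((hasDerivAt_id x).const_mul (2 * b)).exp.const_mul (1 / 2)
      exact this.congr_deriv (by simp only [id_eq]; ring)
    · exact Continuous.intervalIntegrable (by fun_prop) _ _
  rw [h]
  have := Real.exp_pos (2 * b * 0)
  linarith

/-- The iteration step of the Gronwall inequality. -/
theorem integral_le_of_le_exp {f : ℝ → ℝ} {T a b S t : ℝ} (hS : 0 ≤ S) (ha : 0 ≤ a)
    (ht : t ∈ Icc 0 T) (hf : IntervalIntegrable f volume 0 t)
    (h : ∀ s ∈ Icc 0 T, f s ≤ a + b * (S * Real.exp (2 * b * s))) :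
    ∫ s in (0 : ℝ)..t, f s ≤ T * a + S / 2 * Real.exp (2 * b * t) := by
  have h1 : ∫ s in (0 : ℝ)..t, f s ≤ ∫ s in (0 : ℝ)..t, (a + S * (b * Real.exp (2 * b * s))) := by
    refine intervalIntegral.integral_mono_on ht.1 hf
      (Continuous.intervalIntegrable (by fun_prop) _ _) fun s hs => ?_
    have := h s ⟨hs.1, hs.2.trans ht.2⟩
    linarith
  rw [intervalIntegral.integral_add (Continuous.intervalIntegrable (by fun_prop) _ _)
    (Continuous.intervalIntegrable (by fun_prop) _ _), intervalIntegral.integral_const,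
    intervalIntegral.integral_const_mul] at h1
  have h2 := mul_le_mul_of_nonneg_left (integral_exp_le b t) hS
  have h3 : (t - 0) • a ≤ T * a := by
    simpa using mul_le_mul_of_nonneg_right ht.2 ha
  linarith

/-! ### The absolute value of a primitive -/

/-- A real-valued sign function. -/
def sgn (x : ℝ) : ℝ := if 0 < x then 1 else if x < 0 then -1 else 0

theorem measurable_sgn : Measurable sgn :=
  Measurable.ite measurableSet_Ioi measurable_const
    (Measurable.ite measurableSet_Iio measurable_const measurable_const)

theorem abs_sgn_le (x : ℝ) : |sgn x| ≤ 1 := by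
  unfold sgn; split_ifs <;> simp

theorem sgn_mul_self (x : ℝ) : sgn x * x = |x| := by
  unfold sgn
  split_ifs with h1 h2
  · simp [abs_of_pos h1]
  · simp [abs_of_neg h2]
  · have : x = 0 := by linarith
    simp [this]

theorem tendsto_div_sqrt_sgn (x : ℝ) :
    Tendsto (fun n : ℕ => x / √(x ^ 2 + (1 / ((n : ℝ) + 1)) ^ 2)) atTop (𝓝 (sgn x)) := by
  by_cases hx : x = 0
  · simp [hx, sgn]
  have h1 : Tendsto (fun n : ℕ => x ^ 2 + (1 / ((n : ℝ) + 1)) ^ 2) atTop (𝓝 (x ^ 2 + 0 ^ 2)) :=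
    tendsto_const_nhds.add (tendsto_one_div_add_atTop_nhds_zero_nat.pow 2)
  have h2 := tendsto_const_nhds (x := x) |>.div ((Real.continuous_sqrt.tendsto _).comp h1)
    (by simpa [Real.sqrt_sq_eq_abs] using hx)
  suffices h3 : sgn x = x / √(x ^ 2 + 0 ^ 2) by
    rw [h3]; exact h2
  simp only [sgn, ne_eq, OfNat.ofNat_ne_zero, not_false_eq_true, zero_pow, add_zero,
    Real.sqrt_sq_eq_abs]
  split_ifs with h3 h4
  · simp [abs_of_pos h3, hx]
  · rw [abs_of_neg h4, div_neg, div_self hx]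
  · exact absurd (le_antisymm (not_lt.1 h3) (not_lt.1 h4)) hx

/-- Chain rule for |u| at a fixed size: |u| is replaced by the smooth √(u² + ε²), whose derivative u
q / √(u² + ε²) is dominated by |q| and tends to sgn(u) q as ε → 0. The convention sgn 0 = 0 is the
one produced by this limit. -/
theorem abs_le_add_integral_sgn {u q : ℝ → ℝ} {T : ℝ} (hq : ContinuousOn q (Icc 0 T))
    (hu : ∀ t ∈ Icc 0 T, u t = u 0 + ∫ s in (0 : ℝ)..t, q s) {t : ℝ} (ht : t ∈ Icc 0 T) :
    |u t| ≤ |u 0| + ∫ s in (0 : ℝ)..t, sgn (u s) * q s := by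
  have hT : 0 ≤ T := ht.1.trans ht.2
  have hsub : uIcc 0 t ⊆ Icc 0 T := by
    rw [uIcc_of_le ht.1]; exact Icc_subset_Icc_right ht.2
  have hqi : IntervalIntegrable q volume 0 t := (hq.mono hsub).intervalIntegrable
  have hd : ∀ s ∈ Ioo 0 t, HasDerivAt u (q s) s := by
    intro s hs
    have hs' : s ∈ Ioo 0 T := ⟨hs.1, hs.2.trans_le ht.2⟩
    have h1 : HasDerivAt (fun t => u 0 + ∫ s in (0 : ℝ)..t, q s) (q s) s := by
      refine HasDerivAt.const_add _ (intervalIntegral.integral_hasDerivAt_right ?_ ?_ ?_)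
      · refine (hq.mono ?_).intervalIntegrable
        rw [uIcc_of_le hs.1.le]; exact Icc_subset_Icc_right hs'.2.le
      · exact ContinuousOn.stronglyMeasurableAtFilter isOpen_Ioo
          (hq.mono Ioo_subset_Icc_self) _ hs'
      · exact hq.continuousAt (Icc_mem_nhds hs'.1 hs'.2)
    refine h1.congr_of_eventuallyEq ?_
    filter_upwards [Icc_mem_nhds hs'.1 hs'.2] with r hr using hu r hr
  have huc : ContinuousOn u (Icc 0 t) := by
    have h1 : ContinuousOn (fun t => u 0 + ∫ s in (0 : ℝ)..t, q s) (Icc 0 t) := by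
      refine continuousOn_const.add ?_
      have := intervalIntegral.continuousOn_primitive_interval (μ := volume) (f := q) (a := 0)
        (b := t) ((intervalIntegrable_iff' (by simp)).1 hqi)
      rwa [uIcc_of_le ht.1] at this
    exact h1.congr fun r hr => hu r ⟨hr.1, hr.2.trans ht.2⟩
  have hε : ∀ n : ℕ, 0 < 1 / ((n : ℝ) + 1) := fun n => by positivity
  have hpos : ∀ (n : ℕ) (x : ℝ), 0 < x ^ 2 + (1 / ((n : ℝ) + 1)) ^ 2 := fun n x => by
    have := hε n; positivity
  have hc : ∀ n : ℕ, ContinuousOn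
      (fun s => u s / √(u s ^ 2 + (1 / ((n : ℝ) + 1)) ^ 2) * q s) (Icc 0 t) := fun n =>
    (huc.div ((Real.continuous_sqrt.comp_continuousOn ((huc.pow 2).add continuousOn_const)))
      fun s _ => (Real.sqrt_pos.2 (hpos n _)).ne').mul (hq.mono (Icc_subset_Icc_right ht.2))
  have key : ∀ n : ℕ, |u t| ≤ √(u 0 ^ 2 + (1 / ((n : ℝ) + 1)) ^ 2)
      + ∫ s in (0 : ℝ)..t, u s / √(u s ^ 2 + (1 / ((n : ℝ) + 1)) ^ 2) * q s := by
    intro n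
    have h1 : ∫ s in (0 : ℝ)..t, u s / √(u s ^ 2 + (1 / ((n : ℝ) + 1)) ^ 2) * q s
        = √(u t ^ 2 + (1 / ((n : ℝ) + 1)) ^ 2) - √(u 0 ^ 2 + (1 / ((n : ℝ) + 1)) ^ 2) := by
      refine intervalIntegral.integral_eq_sub_of_hasDerivAt_of_le (f := fun s =>
        √(u s ^ 2 + (1 / ((n : ℝ) + 1)) ^ 2)) ht.1 ?_ ?_ ?_
      · exact Real.continuous_sqrt.comp_continuousOn ((huc.pow 2).add continuousOn_const)
      · intro s hs
        have := (((hd s hs).pow 2).add_const ((1 / ((n : ℝ) + 1)) ^ 2)).sqrt (hpos n _).ne'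
        refine this.congr_deriv ?_
        have := (Real.sqrt_pos.2 (hpos n (u s))).ne'
        simp only [Pi.pow_apply, Nat.cast_ofNat, Nat.add_one_sub_one, pow_one]
        rw [div_mul_eq_mul_div, div_eq_div_iff (by positivity) this]
        ring
      · exact ContinuousOn.intervalIntegrable (by rw [uIcc_of_le ht.1]; exact hc n)
    rw [h1]
    have : |u t| ≤ √(u t ^ 2 + (1 / ((n : ℝ) + 1)) ^ 2) :=
      Real.abs_le_sqrt (by have := sq_nonneg (1 / ((n : ℝ) + 1)); linarith)
    linarith
  have hl1 : Tendsto (fun n : ℕ => √(u 0 ^ 2 + (1 / ((n : ℝ) + 1)) ^ 2)) atTop (𝓝 |u 0|) := by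
    have h1 : Tendsto (fun n : ℕ => u 0 ^ 2 + (1 / ((n : ℝ) + 1)) ^ 2) atTop
        (𝓝 (u 0 ^ 2 + 0 ^ 2)) :=
      tendsto_const_nhds.add (tendsto_one_div_add_atTop_nhds_zero_nat.pow 2)
    have := (Real.continuous_sqrt.tendsto _).comp h1
    rw [zero_pow two_ne_zero, add_zero, Real.sqrt_sq_eq_abs] at this
    exact this
  have hl2 : Tendsto (fun n : ℕ => ∫ s in (0 : ℝ)..t,
      u s / √(u s ^ 2 + (1 / ((n : ℝ) + 1)) ^ 2) * q s) atTop
      (𝓝 (∫ s in (0 : ℝ)..t, sgn (u s) * q s)) := by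
    refine intervalIntegral.tendsto_integral_filter_of_dominated_convergence (fun s => |q s|)
      (Eventually.of_forall fun n => ?_) (Eventually.of_forall fun n => ?_) hqi.abs ?_
    · rw [uIoc_of_le ht.1]
      exact ((hc n).mono Ioc_subset_Icc_self).aestronglyMeasurable measurableSet_Ioc
    · refine ae_of_all _ fun s _ => ?_
      rw [norm_mul, Real.norm_eq_abs, Real.norm_eq_abs, abs_div,
        abs_of_pos (Real.sqrt_pos.2 (hpos n (u s)))]
      refine mul_le_of_le_one_left (abs_nonneg _) ((div_le_one (Real.sqrt_pos.2 (hpos n _))).2 ?_)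
      exact Real.abs_le_sqrt (by have := sq_nonneg (1 / ((n : ℝ) + 1)); linarith)
    · exact ae_of_all _ fun s _ => (tendsto_div_sqrt_sgn (u s)).mul_const _
  exact ge_of_tendsto' (hl1.add hl2) key

end

/-! ### Measure-theoretic tools: pairs of sizes, tails, and exchange of time and size -/

section

/-! ### Integrals over the quadrant -/

/-- Lebesgue measure on `(0, ∞)²`. -/
abbrev quadMeasure : Measure (ℝ × ℝ) := posMeasure.prod posMeasure

theorem quadMeasure_eq : quadMeasure = (volume.prod volume).restrict (Ioi 0 ×ˢ Ioi 0) :=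
  Measure.prod_restrict _ _

theorem ae_quadMeasure {p : ℝ × ℝ → Prop} (h : ∀ x y, 0 < x → 0 < y → p (x, y)) :
    ∀ᵐ z ∂quadMeasure, p z := by
  rw [quadMeasure_eq]
  exact ae_restrict_of_forall_mem (measurableSet_Ioi.prod measurableSet_Ioi)
    fun z hz => h z.1 z.2 hz.1 hz.2

theorem ae_posMeasure {p : ℝ → Prop} (h : ∀ x, 0 < x → p x) : ∀ᵐ z ∂posMeasure, p z :=
  ae_restrict_of_forall_mem measurableSet_Ioi h

theorem integrable_swap_quad {F : ℝ → ℝ → ℝ} :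
    Integrable (fun p : ℝ × ℝ => F p.2 p.1) quadMeasure ↔
      Integrable (fun p : ℝ × ℝ => F p.1 p.2) quadMeasure :=
  integrable_swap_iff (f := fun p : ℝ × ℝ => F p.1 p.2)

theorem integral_swap_quad (F : ℝ → ℝ → ℝ) :
    ∫ p, F p.2 p.1 ∂quadMeasure = ∫ p, F p.1 p.2 ∂quadMeasure :=
  integral_prod_swap (fun p : ℝ × ℝ => F p.1 p.2)

/-- The shear (z, y) ↦ (z - y, y) preserves Lebesgue measure and maps the triangle 0 < y < z onto
the quadrant. This turns integrals over the total size into integrals over pairs. -/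
theorem integrable_and_integral_triangle {F : ℝ → ℝ → ℝ}
    (hF : Integrable (fun p : ℝ × ℝ => F p.1 p.2) quadMeasure) :
    Integrable (fun z => ∫ y in (0 : ℝ)..z, F (z - y) y) posMeasure ∧
      ∫ z, (∫ y in (0 : ℝ)..z, F (z - y) y) ∂posMeasure = ∫ p, F p.1 p.2 ∂quadMeasure := by
  set G : ℝ × ℝ → ℝ := (Ioi (0 : ℝ) ×ˢ Ioi (0 : ℝ)).indicator fun p => F p.1 p.2 with hG
  have hms : MeasurableSet (Ioi (0 : ℝ) ×ˢ Ioi (0 : ℝ)) := measurableSet_Ioi.prod measurableSet_Ioi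
  have hGi : Integrable G (volume.prod volume) := by
    rw [hG, integrable_indicator_iff hms, IntegrableOn, ← quadMeasure_eq]; exact hF
  have hGe : ∫ p, G p ∂(volume.prod volume) = ∫ p, F p.1 p.2 ∂quadMeasure := by
    rw [hG, integral_indicator hms, ← quadMeasure_eq]
  have hmp := measurePreserving_sub_prod (volume : Measure ℝ) (volume : Measure ℝ)
  have hci : Integrable (fun p : ℝ × ℝ => G (p.1 - p.2, p.2)) (volume.prod volume) :=
    hmp.integrable_comp_of_integrable hGi
  have hce : ∫ p : ℝ × ℝ, G (p.1 - p.2, p.2) ∂(volume.prod volume)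
      = ∫ p, G p ∂(volume.prod volume) := by
    have h1 := integral_map (μ := (volume : Measure ℝ).prod (volume : Measure ℝ))
      hmp.measurable.aemeasurable (f := G) (by rw [hmp.map_eq]; exact hGi.aestronglyMeasurable)
    rw [hmp.map_eq] at h1
    exact h1.symm
  have hin : ∀ z, ∫ y, G (z - y, y) = (Ioi (0 : ℝ)).indicator
      (fun z => ∫ y in (0 : ℝ)..z, F (z - y) y) z := by
    intro z
    have h1 : (fun y => G (z - y, y)) = (Ioo 0 z).indicator (fun y => F (z - y) y) := by
      ext y
      by_cases hy : y ∈ Ioo 0 z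
      · rw [indicator_of_mem hy, hG, indicator_of_mem]
        exact ⟨sub_pos.2 hy.2, hy.1⟩
      · rw [indicator_of_notMem hy, hG, indicator_of_notMem]
        exact fun h => hy ⟨h.2, sub_pos.1 h.1⟩
    rw [h1, integral_indicator measurableSet_Ioo]
    by_cases hz : z ∈ Ioi (0 : ℝ)
    · rw [indicator_of_mem hz, intervalIntegral.integral_of_le (le_of_lt hz),
        integral_Ioc_eq_integral_Ioo]
    · rw [indicator_of_notMem hz, Ioo_eq_empty (fun h => hz h), setIntegral_empty]
  constructor
  · have h1 := hci.integral_prod_left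
    simp only [hin] at h1
    rwa [integrable_indicator_iff measurableSet_Ioi] at h1
  · rw [← hGe, ← hce, integral_prod _ hci]
    simp only [hin]
    rw [integral_indicator measurableSet_Ioi]

/-- Fubini on {z < r}. It moves the test function from the fragment size z to its primitive at the
total size r, which is how the averages of ψ enter the breakage term. -/
theorem integrable_and_integral_mul_tail {ψ h : ℝ → ℝ} (hψ : Measurable ψ)
    (hψi : ∀ r, 0 < r → IntervalIntegrable ψ volume 0 r)
    (hm : AEStronglyMeasurable h posMeasure)
    (hi : Integrable (fun r => (∫ z in (0 : ℝ)..r, |ψ z|) * |h r|) posMeasure) :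
    Integrable (fun z => ψ z * ∫ r in Ioi z, h r) posMeasure ∧
      ∫ z, ψ z * (∫ r in Ioi z, h r) ∂posMeasure
        = ∫ r, (∫ z in (0 : ℝ)..r, ψ z) * h r ∂posMeasure ∧
      ∫ z, |ψ z * ∫ r in Ioi z, h r| ∂posMeasure
        ≤ ∫ r, (∫ z in (0 : ℝ)..r, |ψ z|) * |h r| ∂posMeasure := by
  set S : Set (ℝ × ℝ) := {p | p.1 < p.2} with hS
  have hSm : MeasurableSet S := measurableSet_lt measurable_fst measurable_snd
  set H : ℝ × ℝ → ℝ := S.indicator (fun p => ψ p.1 * h p.2) with hH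
  have hHm : AEStronglyMeasurable H quadMeasure :=
    ((hψ.comp measurable_fst).aestronglyMeasurable.mul hm.comp_snd).indicator hSm
  have hsec : ∀ (f : ℝ → ℝ) (c : ℝ) (r : ℝ), 0 < r →
      (fun z => S.indicator (fun p => f p.1 * c) (z, r)) = (Iio r).indicator (fun z => f z * c) :=
    fun f c r _ => rfl
  have hleft : ∀ (f : ℝ → ℝ) (r : ℝ), 0 < r →
      ∫ z, (Iio r).indicator f z ∂posMeasure = ∫ z in (0 : ℝ)..r, f z := by
    intro f r hr
    rw [integral_indicator measurableSet_Iio, Measure.restrict_restrict measurableSet_Iio,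
      intervalIntegral.integral_of_le hr.le, integral_Ioc_eq_integral_Ioo, inter_comm, Ioi_inter_Iio]
  have hnorm : ∀ r, 0 < r → ∫ z, ‖H (z, r)‖ ∂posMeasure = (∫ z in (0 : ℝ)..r, |ψ z|) * |h r| := by
    intro r hr
    have : (fun z => ‖H (z, r)‖) = (Iio r).indicator (fun z => |ψ z| * |h r|) := by
      ext z
      rw [hH, norm_indicator_eq_indicator_norm]
      simp only [norm_mul, Real.norm_eq_abs]
      rfl
    simp only [this]
    rw [hleft _ _ hr, intervalIntegral.integral_mul_const]
  have hHi : Integrable H quadMeasure := by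
    rw [integrable_prod_iff' hHm]
    constructor
    · refine ae_posMeasure fun r hr => ?_
      have : (fun z => H (z, r)) = (Iio r).indicator (fun z => ψ z * h r) := rfl
      rw [this, integrable_indicator_iff measurableSet_Iio, IntegrableOn,
        Measure.restrict_restrict measurableSet_Iio, inter_comm, Ioi_inter_Iio]
      have h1 := (hψi r hr).1.mono_set (Ioo_subset_Ioc_self)
      exact h1.mul_const _
    · exact hi.congr (ae_posMeasure fun r hr => (hnorm r hr).symm)
  have hright : ∀ z, 0 < z → ∫ r, H (z, r) ∂posMeasure = ψ z * ∫ r in Ioi z, h r := by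
    intro z hz
    have : (fun r => H (z, r)) = (Ioi z).indicator (fun r => ψ z * h r) := rfl
    rw [this, integral_indicator measurableSet_Ioi, Measure.restrict_restrict measurableSet_Ioi,
      inter_eq_left.2 (Ioi_subset_Ioi hz.le), integral_const_mul]
  refine ⟨?_, ?_, ?_⟩
  · exact hHi.integral_prod_left.congr (ae_posMeasure hright)
  · rw [← integral_congr_ae (ae_posMeasure hright), ← integral_prod _ hHi,
      integral_prod_symm _ hHi]
    refine integral_congr_ae (ae_posMeasure fun r hr => ?_)
    have : (fun z => H (z, r)) = (Iio r).indicator (fun z => ψ z * h r) := rfl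
    simp only [this]
    rw [hleft _ _ hr, intervalIntegral.integral_mul_const]
  · rw [← integral_congr_ae (ae_posMeasure hnorm), ← integral_prod_symm _ hHi.norm,
      integral_prod _ hHi.norm]
    refine integral_mono_ae ?_ hHi.norm.integral_prod_left ?_
    · exact (hHi.integral_prod_left.congr (ae_posMeasure hright)).abs
    · refine ae_posMeasure fun z hz => ?_
      simp only
      rw [← hright z hz]
      exact norm_integral_le_integral_norm fun r => H (z, r)

/-! ### Fubini in time, Fatou -/

/-- A bound on the size integrals that is uniform in time makes the integrand integrable on the
product, so Fubini applies. It also supplies the integrability in time that the Gronwall step needs.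
-/
theorem integral_time_swap {ρ : ℝ → ℝ → ℝ} {T B : ℝ}
    (hm : AEStronglyMeasurable (uncurry ρ) (posMeasure.prod (volume.restrict (Icc 0 T))))
    (hi : ∀ s ∈ Icc 0 T, Integrable (fun z => ρ z s) posMeasure)
    (hB : ∀ s ∈ Icc 0 T, ∫ z, |ρ z s| ∂posMeasure ≤ B) {t : ℝ} (ht : t ∈ Icc 0 T) :
    Integrable (fun z => ∫ s in (0 : ℝ)..t, ρ z s) posMeasure ∧
      IntervalIntegrable (fun s => ∫ z, ρ z s ∂posMeasure) volume 0 t ∧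
      ∫ z, (∫ s in (0 : ℝ)..t, ρ z s) ∂posMeasure = ∫ s in (0 : ℝ)..t, ∫ z, ρ z s ∂posMeasure := by
  set τ : Measure ℝ := volume.restrict (Ioc 0 t)
  have hle : τ ≤ volume.restrict (Icc 0 T) :=
    Measure.restrict_mono (Ioc_subset_Icc_self.trans (Icc_subset_Icc_right ht.2)) le_rfl
  have hm' : AEStronglyMeasurable (uncurry ρ) (posMeasure.prod τ) :=
    hm.mono_measure (Measure.prod_mono le_rfl hle)
  have hint : Integrable (uncurry ρ) (posMeasure.prod τ) := by
    rw [integrable_prod_iff' hm']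
    constructor
    · refine ae_restrict_of_forall_mem measurableSet_Ioc fun s hs => ?_
      exact hi s ⟨hs.1.le, hs.2.trans ht.2⟩
    · refine Integrable.mono' (g := fun _ => B) (integrable_const _)
        hm'.norm.prod_swap.integral_prod_right' ?_
      refine ae_restrict_of_forall_mem measurableSet_Ioc fun s hs => ?_
      rw [Real.norm_of_nonneg (integral_nonneg fun _ => norm_nonneg _)]
      exact hB s ⟨hs.1.le, hs.2.trans ht.2⟩
  refine ⟨?_, ?_, ?_⟩
  · have := hint.integral_prod_left
    simpa only [intervalIntegral.integral_of_le ht.1] using! this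
  · rw [intervalIntegrable_iff_integrableOn_Ioc_of_le ht.1]
    exact hint.integral_prod_right
  · simp only [intervalIntegral.integral_of_le ht.1]
    exact integral_integral_swap hint

/-- Fatou's lemma, restated for real-valued integrals. -/
theorem integrable_and_integral_le_of_tendsto {F : ℕ → ℝ → ℝ} {G : ℝ → ℝ} {A : ℝ}
    (hF : ∀ n, Integrable (F n) posMeasure) (hF0 : ∀ n x, 0 < x → 0 ≤ F n x)
    (hA : ∀ n, ∫ x, F n x ∂posMeasure ≤ A)
    (hlim : ∀ x, 0 < x → Tendsto (fun n => F n x) atTop (𝓝 (G x))) :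
    Integrable G posMeasure ∧ ∫ x, G x ∂posMeasure ≤ A := by
  have hGm : AEStronglyMeasurable G posMeasure :=
    aestronglyMeasurable_of_tendsto_ae atTop (fun n => (hF n).aestronglyMeasurable)
      (ae_posMeasure hlim)
  have hA0 : 0 ≤ A := (integral_nonneg_of_ae (ae_posMeasure (hF0 0))).trans (hA 0)
  have hG0 : 0 ≤ᵐ[posMeasure] G := ae_posMeasure fun x hx =>
    ge_of_tendsto' (hlim x hx) fun n => hF0 n x hx
  have hle : ∫⁻ x, ENNReal.ofReal (G x) ∂posMeasure ≤ ENNReal.ofReal A := by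
    calc ∫⁻ x, ENNReal.ofReal (G x) ∂posMeasure
        = ∫⁻ x, liminf (fun n => ENNReal.ofReal (F n x)) atTop ∂posMeasure := by
          refine lintegral_congr_ae (ae_posMeasure fun x hx => ?_)
          exact ((ENNReal.continuous_ofReal.tendsto _).comp (hlim x hx)).liminf_eq.symm
      _ ≤ liminf (fun n => ∫⁻ x, ENNReal.ofReal (F n x) ∂posMeasure) atTop :=
          lintegral_liminf_le' fun n => (hF n).aestronglyMeasurable.aemeasurable.ennreal_ofReal
      _ ≤ ENNReal.ofReal A := by
          refine liminf_le_of_le (by isBoundedDefault) fun b hb => ?_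
          obtain ⟨n, hn⟩ := hb.exists
          refine hn.trans ?_
          rw [← ofReal_integral_eq_lintegral_ofReal (hF n) (ae_posMeasure (hF0 n))]
          exact ENNReal.ofReal_le_ofReal (hA n)
  have hGi : Integrable G posMeasure :=
    (lintegral_ofReal_ne_top_iff_integrable hGm hG0).1 (hle.trans_lt ENNReal.ofReal_lt_top).ne
  refine ⟨hGi, ?_⟩
  rw [← ofReal_integral_eq_lintegral_ofReal hGi hG0] at hle
  exact (ENNReal.ofReal_le_ofReal_iff hA0).1 hle

end

section

/-! ### The collision operator and its weak form -/

/-- Birth by coalescence for the pair density `f`. -/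
def coagOp (e f : ℝ → ℝ → ℝ) (z : ℝ) : ℝ :=
  (1 / 2) * ∫ y in (0 : ℝ)..z, e (z - y) y * f (z - y) y

/-- Death by collision for the pair density `f`. -/
def lossOp (f : ℝ → ℝ → ℝ) (z : ℝ) : ℝ := ∫ y, f z y ∂posMeasure

/-- Birth by binary breakage for the pair density `f`. -/
def breakOp (e f : ℝ → ℝ → ℝ) (z : ℝ) : ℝ :=
  ∫ r in Ioi z, r⁻¹ * ∫ y in (0 : ℝ)..r, (1 - e (r - y) y) * f (r - y) y

/-- The collision operator for the pair density `f`. -/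
def collisionOp (e f : ℝ → ℝ → ℝ) (z : ℝ) : ℝ := coagOp e f z - lossOp f z + breakOp e f z

/-- A measurable efficiency with values in `[0, 1]`. -/
structure IsProb (e : ℝ → ℝ → ℝ) : Prop where
  measurable : Measurable (uncurry e)
  nonneg : ∀ x y, 0 ≤ e x y
  le_one : ∀ x y, e x y ≤ 1

/-- `W` controls the test function `ψ` and its running averages. -/
structure IsWeight (ψ W : ℝ → ℝ) : Prop where
  measurable : Measurable ψ
  measurable_weight : Measurable W
  pos : ∀ x, 0 < x → 0 < W x
  le : ∀ x, 0 < x → |ψ x| ≤ W x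
  intervalIntegrable : ∀ r, 0 < r → IntervalIntegrable ψ volume 0 r
  average_le : ∀ r, 0 < r → ∫ z in (0 : ℝ)..r, |ψ z| ≤ r * W r

variable {e f : ℝ → ℝ → ℝ} {ψ W : ℝ → ℝ}

theorem integral_add₃ {α : Type*} [MeasurableSpace α] {μ : Measure α} {a b c : α → ℝ}
    (ha : Integrable a μ) (hb : Integrable b μ) (hc : Integrable c μ) :
    ∫ x, (a x + b x + c x) ∂μ = ∫ x, a x ∂μ + ∫ x, b x ∂μ + ∫ x, c x ∂μ := by
  rw [← integral_add ha hb]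
  exact integral_add (ha.add hb) hc

theorem integral_sub_add {α : Type*} [MeasurableSpace α] {μ : Measure α} {a b c : α → ℝ}
    (ha : Integrable a μ) (hb : Integrable b μ) (hc : Integrable c μ) :
    ∫ x, (a x - b x + c x) ∂μ = ∫ x, a x ∂μ - ∫ x, b x ∂μ + ∫ x, c x ∂μ := by
  rw [← integral_sub ha hb]
  exact integral_add (ha.sub hb) hc

theorem IsProb.abs_le (he : IsProb e) (x y : ℝ) : |e x y| ≤ 1 := by
  rw [abs_of_nonneg (he.nonneg x y)]; exact he.le_one x y

theorem IsProb.abs_one_sub_le (he : IsProb e) (x y : ℝ) : |1 - e x y| ≤ 1 := by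
  rw [abs_of_nonneg (by linarith [he.le_one x y])]; linarith [he.nonneg x y]

theorem integrable_bdd_mul {g G : ℝ × ℝ → ℝ} (hg : Integrable G quadMeasure)
    (hm : AEStronglyMeasurable g quadMeasure) (hb : ∀ x y, 0 < x → 0 < y → |g (x, y)| ≤ |G (x, y)|) :
    Integrable g quadMeasure :=
  hg.mono hm (ae_quadMeasure fun x y hx hy => hb x y hx hy)

theorem coag_weak (he : IsProb e) (hf : Measurable (uncurry f)) (hw : IsWeight ψ W)
    (hi : Integrable (fun p : ℝ × ℝ => W (p.1 + p.2) * f p.1 p.2) quadMeasure) :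
    Integrable (fun p : ℝ × ℝ => 1 / 2 * e p.1 p.2 * ψ (p.1 + p.2) * f p.1 p.2) quadMeasure ∧
      Integrable (fun z => ψ z * coagOp e f z) posMeasure ∧
      ∫ z, ψ z * coagOp e f z ∂posMeasure
        = ∫ p, 1 / 2 * e p.1 p.2 * ψ (p.1 + p.2) * f p.1 p.2 ∂quadMeasure ∧
      ∫ z, |ψ z * coagOp e f z| ∂posMeasure
        ≤ ∫ p, W (p.1 + p.2) * |f p.1 p.2| ∂quadMeasure := by
  have hm : Measurable fun p : ℝ × ℝ => 1 / 2 * e p.1 p.2 * ψ (p.1 + p.2) * f p.1 p.2 :=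
    ((measurable_const.mul he.measurable).mul
      (hw.measurable.comp (measurable_fst.add measurable_snd))).mul hf
  have hi1 := integrable_bdd_mul hi hm.aestronglyMeasurable (by
    intro x y hx hy
    have h1 := hw.le (x + y) (add_pos hx hy)
    have h2 := he.abs_le x y
    simp only [abs_mul]
    refine mul_le_mul_of_nonneg_right ?_ (abs_nonneg _)
    calc |(1 / 2 : ℝ)| * |e x y| * |ψ (x + y)| ≤ 1 * 1 * |W (x + y)| :=
          mul_le_mul (mul_le_mul (by norm_num [abs_of_pos]) h2 (abs_nonneg _) zero_le_one)
            (h1.trans (le_abs_self _)) (abs_nonneg _) (by norm_num)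
      _ = _ := by ring)
  have hi2 : Integrable (fun p : ℝ × ℝ => W (p.1 + p.2) * |f p.1 p.2|) quadMeasure := by
    refine integrable_bdd_mul hi ?_ (fun x y _ _ => by simp [abs_mul])
    exact ((hw.measurable_weight.comp (measurable_fst.add measurable_snd)).mul
      hf.norm).aestronglyMeasurable
  obtain ⟨h1, h2⟩ := integrable_and_integral_triangle
    (F := fun x y => 1 / 2 * e x y * ψ (x + y) * f x y) hi1
  have heq : ∀ z, ∫ y in (0 : ℝ)..z, 1 / 2 * e (z - y) y * ψ (z - y + y) * f (z - y) y
      = ψ z * coagOp e f z := by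
    intro z
    simp only [sub_add_cancel, coagOp]
    rw [← intervalIntegral.integral_const_mul, ← intervalIntegral.integral_const_mul]
    exact intervalIntegral.integral_congr fun y _ => by ring
  simp only [heq] at h1 h2
  refine ⟨hi1, h1, h2, ?_⟩
  obtain ⟨h3, h4⟩ := integrable_and_integral_triangle (F := fun x y => W (x + y) * |f x y|) hi2
  obtain ⟨h5, h6⟩ := integrable_and_integral_triangle
    (F := fun x y => |1 / 2 * e x y * ψ (x + y) * f x y|) hi1.abs
  refine le_trans (integral_mono_ae h1.abs h5 (ae_posMeasure fun z hz => ?_)) (h6.trans_le ?_)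
  · simp only [← heq]
    exact intervalIntegral.abs_integral_le_integral_abs hz.le
  · refine integral_mono_ae hi1.abs hi2 (ae_quadMeasure fun x y hx hy => ?_)
    have h1 := hw.le (x + y) (add_pos hx hy)
    have h2 := he.abs_le x y
    simp only [abs_mul]
    refine mul_le_mul_of_nonneg_right ?_ (abs_nonneg _)
    calc |(1 / 2 : ℝ)| * |e x y| * |ψ (x + y)| ≤ 1 * 1 * W (x + y) :=
          mul_le_mul (mul_le_mul (by norm_num [abs_of_pos]) h2 (abs_nonneg _) zero_le_one)
            h1 (abs_nonneg _) (by norm_num)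
      _ = _ := by ring

theorem loss_weak (hf : Measurable (uncurry f)) (hw : IsWeight ψ W)
    (hi : Integrable (fun p : ℝ × ℝ => W p.1 * f p.1 p.2) quadMeasure) :
    Integrable (fun p : ℝ × ℝ => ψ p.1 * f p.1 p.2) quadMeasure ∧
      Integrable (fun z => ψ z * lossOp f z) posMeasure ∧
      ∫ z, ψ z * lossOp f z ∂posMeasure = ∫ p, ψ p.1 * f p.1 p.2 ∂quadMeasure ∧
      ∫ z, |ψ z * lossOp f z| ∂posMeasure ≤ ∫ p, W p.1 * |f p.1 p.2| ∂quadMeasure := by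
  have hi1 : Integrable (fun p : ℝ × ℝ => ψ p.1 * f p.1 p.2) quadMeasure := by
    refine integrable_bdd_mul hi ((hw.measurable.comp measurable_fst).mul hf).aestronglyMeasurable
      fun x y hx _ => ?_
    simp only [abs_mul]
    exact mul_le_mul_of_nonneg_right ((hw.le x hx).trans (le_abs_self _)) (abs_nonneg _)
  have hi2 : Integrable (fun p : ℝ × ℝ => W p.1 * |f p.1 p.2|) quadMeasure := by
    refine integrable_bdd_mul hi ?_ (fun x y _ _ => by simp [abs_mul])
    exact ((hw.measurable_weight.comp measurable_fst).mul hf.norm).aestronglyMeasurable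
  have heq : ∀ z, ∫ y, ψ z * f z y ∂posMeasure = ψ z * lossOp f z := fun z =>
    integral_const_mul _ _
  have h1 := hi1.integral_prod_left
  simp only [heq] at h1
  refine ⟨hi1, h1, ?_, ?_⟩
  · rw [integral_prod _ hi1]
    simp only [heq]
  · calc ∫ z, |ψ z * lossOp f z| ∂posMeasure
        ≤ ∫ z, ∫ y, |ψ z * f z y| ∂posMeasure ∂posMeasure := by
          refine integral_mono h1.abs hi1.abs.integral_prod_left fun z => ?_
          simp only [← heq]
          exact norm_integral_le_integral_norm fun y => ψ z * f z y
      _ = ∫ p, |ψ p.1 * f p.1 p.2| ∂quadMeasure := (integral_prod _ hi1.abs).symm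
      _ ≤ _ := by
          refine integral_mono_ae hi1.abs hi2 (ae_quadMeasure fun x y hx _ => ?_)
          simp only [abs_mul]
          exact mul_le_mul_of_nonneg_right (hw.le x hx) (abs_nonneg _)

theorem measurable_primitive (hψ : ∀ r, 0 < r → IntervalIntegrable ψ volume 0 r) :
    AEStronglyMeasurable (fun r => ∫ z in (0 : ℝ)..r, ψ z) posMeasure := by
  refine ContinuousOn.aestronglyMeasurable (fun r hr => ?_) measurableSet_Ioi
  have hr' : (0 : ℝ) < r + 1 := by have : (0 : ℝ) < r := hr; linarith
  have h1 := intervalIntegral.continuousOn_primitive_interval (μ := volume) (f := ψ) (a := 0)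
    (b := r + 1) ((intervalIntegrable_iff' (by simp)).1 (hψ _ hr'))
  rw [uIcc_of_le hr'.le] at h1
  exact (h1.continuousAt (Icc_mem_nhds hr (by linarith))).continuousWithinAt

/-- By `integrable_and_integral_mul_tail` the tail integral pairs the primitive of ψ with the
averaged collision density, and the shear then returns to pairs. The weight `W` has to dominate
running averages of |ψ| because fragments are uniformly distributed. -/
theorem break_weak (he : IsProb e) (hf : Measurable (uncurry f)) (hw : IsWeight ψ W)
    (hi : Integrable (fun p : ℝ × ℝ => W (p.1 + p.2) * f p.1 p.2) quadMeasure) :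
    Integrable (fun p : ℝ × ℝ => (1 - e p.1 p.2) *
        ((p.1 + p.2)⁻¹ * ∫ z in (0 : ℝ)..(p.1 + p.2), ψ z) * f p.1 p.2) quadMeasure ∧
      Integrable (fun z => ψ z * breakOp e f z) posMeasure ∧
      ∫ z, ψ z * breakOp e f z ∂posMeasure
        = ∫ p, (1 - e p.1 p.2) * ((p.1 + p.2)⁻¹ * ∫ z in (0 : ℝ)..(p.1 + p.2), ψ z) * f p.1 p.2
          ∂quadMeasure ∧
      ∫ z, |ψ z * breakOp e f z| ∂posMeasure
        ≤ ∫ p, W (p.1 + p.2) * |f p.1 p.2| ∂quadMeasure := by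
  set h : ℝ → ℝ := fun r => r⁻¹ * ∫ y in (0 : ℝ)..r, (1 - e (r - y) y) * f (r - y) y with hh
  set w : ℝ → ℝ := fun r => r⁻¹ * ∫ z in (0 : ℝ)..r, ψ z with hwdef
  have hw_le : ∀ r, 0 < r → |w r| ≤ W r := by
    intro r hr
    rw [hwdef]
    simp only [abs_mul, abs_inv, abs_of_pos hr]
    rw [inv_mul_le_iff₀ hr]
    exact (intervalIntegral.abs_integral_le_integral_abs hr.le).trans (hw.average_le r hr)
  have hi2 : Integrable (fun p : ℝ × ℝ => W (p.1 + p.2) * |f p.1 p.2|) quadMeasure := by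
    refine integrable_bdd_mul hi ?_ (fun x y _ _ => by simp [abs_mul])
    exact ((hw.measurable_weight.comp (measurable_fst.add measurable_snd)).mul
      hf.norm).aestronglyMeasurable
  have hi3 : Integrable (fun p : ℝ × ℝ => W (p.1 + p.2) * ((1 - e p.1 p.2) * f p.1 p.2))
      quadMeasure := by
    refine integrable_bdd_mul hi ?_ fun x y _ _ => ?_
    · exact ((hw.measurable_weight.comp (measurable_fst.add measurable_snd)).mul
        ((measurable_const.sub he.measurable).mul hf)).aestronglyMeasurable
    · simp only [abs_mul]
      gcongr
      exact mul_le_of_le_one_left (abs_nonneg _) (he.abs_one_sub_le x y)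
  obtain ⟨t1, -⟩ := integrable_and_integral_triangle
    (F := fun x y => W (x + y) * ((1 - e x y) * f x y)) hi3
  obtain ⟨t3, t4⟩ := integrable_and_integral_triangle
    (F := fun x y => W (x + y) * |f x y|) hi2
  obtain ⟨t5, t6⟩ := integrable_and_integral_triangle
    (F := fun x y => |W (x + y) * ((1 - e x y) * f x y)|) hi3.abs
  have hWh : ∀ r, 0 < r →
      ∫ y in (0 : ℝ)..r, W (r - y + y) * ((1 - e (r - y) y) * f (r - y) y) = W r * (r * h r) := by
    intro r hr
    simp only [sub_add_cancel, hh]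
    rw [intervalIntegral.integral_const_mul, mul_inv_cancel_left₀ hr.ne']
  -- Integrability is only available with the weight `W`; measurability of `h` is recovered by
  -- dividing the integrable weighted integral by W(r) r > 0.
  have hhm : AEStronglyMeasurable h posMeasure := by
    have h1 : AEStronglyMeasurable (fun r => (W r * r)⁻¹ *
        ∫ y in (0 : ℝ)..r, W (r - y + y) * ((1 - e (r - y) y) * f (r - y) y)) posMeasure :=
      ((hw.measurable_weight.mul measurable_id).inv.aestronglyMeasurable).mul
        t1.aestronglyMeasurable
    refine h1.congr (ae_posMeasure fun r hr => ?_)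
    simp only
    rw [hWh r hr]
    have := (hw.pos r hr).ne'
    have := hr.ne'
    field_simp
  have hrW : ∀ r, 0 < r → (∫ z in (0 : ℝ)..r, |ψ z|) * |h r|
      ≤ ∫ y in (0 : ℝ)..r, |W (r - y + y) * ((1 - e (r - y) y) * f (r - y) y)| := by
    intro r hr
    refine le_trans ?_ (intervalIntegral.abs_integral_le_integral_abs hr.le)
    rw [hWh r hr]
    simp only [abs_mul, abs_of_pos hr, abs_of_pos (hw.pos r hr)]
    rw [← mul_assoc, mul_comm (W r)]
    exact mul_le_mul_of_nonneg_right (hw.average_le r hr) (abs_nonneg _)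
  have habs0 : ∀ r, 0 < r → 0 ≤ ∫ z in (0 : ℝ)..r, |ψ z| := fun r hr =>
    intervalIntegral.integral_nonneg hr.le fun _ _ => abs_nonneg _
  have hint : Integrable (fun r => (∫ z in (0 : ℝ)..r, |ψ z|) * |h r|) posMeasure := by
    refine t5.mono' ((measurable_primitive fun r hr => (hw.intervalIntegrable r hr).abs).mul
      hhm.norm) (ae_posMeasure fun r hr => ?_)
    rw [Real.norm_of_nonneg (mul_nonneg (habs0 r hr) (abs_nonneg _))]
    exact hrW r hr
  obtain ⟨m1, m2, m3⟩ := integrable_and_integral_mul_tail hw.measurable hw.intervalIntegrable hhm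
    hint
  have hwm : AEStronglyMeasurable (fun p : ℝ × ℝ => w (p.1 + p.2) * ((1 - e p.1 p.2) * f p.1 p.2))
      quadMeasure := by
    have h1 : AEStronglyMeasurable w posMeasure :=
      measurable_inv.aestronglyMeasurable.mul (measurable_primitive hw.intervalIntegrable)
    -- Since `w` is only known to be a.e. strongly measurable, addition must pull null sets back to
    -- null sets; it does, being a shear followed by a projection.
    have h2 : AEStronglyMeasurable (fun p : ℝ × ℝ => w (p.1 + p.2)) quadMeasure := by
      refine h1.comp_quasiMeasurePreserving ⟨by fun_prop, ?_⟩
      have hq : Measure.QuasiMeasurePreserving (fun p : ℝ × ℝ => p.1 + p.2)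
          (volume.prod volume) volume :=
        Measure.quasiMeasurePreserving_fst.comp
          (measurePreserving_add_prod (volume : Measure ℝ) volume).quasiMeasurePreserving
      refine Measure.AbsolutelyContinuous.mk fun s hs hs0 => ?_
      rw [Measure.restrict_apply hs] at hs0
      rw [Measure.map_apply (by fun_prop) hs, quadMeasure_eq,
        Measure.restrict_apply (hs.preimage (by fun_prop))]
      refine measure_mono_null ?_ (hq.preimage_null hs0)
      rintro ⟨x, y⟩ ⟨hxy, hx, hy⟩
      exact ⟨hxy, add_pos (show (0 : ℝ) < x from hx) hy⟩
    exact h2.mul ((measurable_const.sub he.measurable).mul hf).aestronglyMeasurable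
  have hi4 := integrable_bdd_mul hi3 hwm fun x y hx hy => by
    rw [abs_mul, abs_mul (W _)]
    exact mul_le_mul_of_nonneg_right ((hw_le _ (add_pos hx hy)).trans (le_abs_self _)) (abs_nonneg _)
  have hperm : (fun p : ℝ × ℝ => (1 - e p.1 p.2) *
      ((p.1 + p.2)⁻¹ * ∫ z in (0 : ℝ)..(p.1 + p.2), ψ z) * f p.1 p.2)
      = fun p => w (p.1 + p.2) * ((1 - e p.1 p.2) * f p.1 p.2) := by
    ext p
    simp only [hwdef]
    ring
  refine ⟨by rw [hperm]; exact hi4, m1, ?_, ?_⟩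
  · refine m2.trans ?_
    obtain ⟨-, s2⟩ := integrable_and_integral_triangle
      (F := fun x y => w (x + y) * ((1 - e x y) * f x y)) hi4
    rw [hperm]
    refine Eq.trans ?_ s2
    refine integral_congr_ae (ae_posMeasure fun r hr => ?_)
    simp only [sub_add_cancel]
    rw [intervalIntegral.integral_const_mul, hwdef, hh]
    ring
  · refine m3.trans (le_trans (integral_mono_ae hint t5 (ae_posMeasure hrW)) (t6.trans_le ?_))
    refine integral_mono_ae hi3.abs hi2 (ae_quadMeasure fun x y hx hy => ?_)
    simp only [abs_mul, abs_of_pos (hw.pos _ (add_pos hx hy))]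
    have := (hw.pos _ (add_pos hx hy)).le
    gcongr
    exact mul_le_of_le_one_left (abs_nonneg _) (he.abs_one_sub_le x y)

/-- The kernel of the weak form of the collision operator. -/
def weakKernel (e : ℝ → ℝ → ℝ) (ψ : ℝ → ℝ) (x y : ℝ) : ℝ :=
  1 / 2 * e x y * ψ (x + y) + (1 - e x y) * ((x + y)⁻¹ * ∫ z in (0 : ℝ)..(x + y), ψ z) - ψ x

/-- The weak form of the equation. The bound on the absolute integral counts `W` once for loss and
twice for the two gains; it is what allows the exchange with the time integral. -/
theorem collision_weak (he : IsProb e) (hf : Measurable (uncurry f)) (hw : IsWeight ψ W)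
    (hi : Integrable (fun p : ℝ × ℝ => W p.1 * f p.1 p.2) quadMeasure)
    (hi' : Integrable (fun p : ℝ × ℝ => W (p.1 + p.2) * f p.1 p.2) quadMeasure) :
    Integrable (fun z => ψ z * collisionOp e f z) posMeasure ∧
      Integrable (fun p : ℝ × ℝ => weakKernel e ψ p.1 p.2 * f p.1 p.2) quadMeasure ∧
      ∫ z, ψ z * collisionOp e f z ∂posMeasure
        = ∫ p, weakKernel e ψ p.1 p.2 * f p.1 p.2 ∂quadMeasure ∧
      ∫ z, |ψ z * collisionOp e f z| ∂posMeasure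
        ≤ ∫ p, W p.1 * |f p.1 p.2| ∂quadMeasure
          + 2 * ∫ p, W (p.1 + p.2) * |f p.1 p.2| ∂quadMeasure := by
  obtain ⟨a0, a1, a2, a3⟩ := coag_weak he hf hw hi'
  obtain ⟨b0, b1, b2, b3⟩ := loss_weak hf hw hi
  obtain ⟨c0, c1, c2, c3⟩ := break_weak he hf hw hi'
  have h1 : (fun z => ψ z * collisionOp e f z)
      = fun z => ψ z * coagOp e f z - ψ z * lossOp f z + ψ z * breakOp e f z := by
    ext z; rw [collisionOp]; ring
  have h2 : (fun p : ℝ × ℝ => weakKernel e ψ p.1 p.2 * f p.1 p.2)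
      = fun p => 1 / 2 * e p.1 p.2 * ψ (p.1 + p.2) * f p.1 p.2 - ψ p.1 * f p.1 p.2
        + (1 - e p.1 p.2) * ((p.1 + p.2)⁻¹ * ∫ z in (0 : ℝ)..(p.1 + p.2), ψ z) * f p.1 p.2 := by
    ext p; rw [weakKernel]; ring
  refine ⟨by rw [h1]; exact (a1.sub b1).add c1, by rw [h2]; exact (a0.sub b0).add c0, ?_, ?_⟩
  · rw [h1, h2, integral_sub_add a1 b1 c1, integral_sub_add a0 b0 c0, a2, b2, c2]
  · have h3 : ∫ z, |ψ z * collisionOp e f z| ∂posMeasure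
        ≤ ∫ z, (|ψ z * coagOp e f z| + |ψ z * lossOp f z| + |ψ z * breakOp e f z|) ∂posMeasure := by
      have hsum : Integrable (fun z => ψ z * collisionOp e f z) posMeasure := by
        rw [h1]; exact (a1.sub b1).add c1
      refine integral_mono hsum.abs ((a1.abs.add b1.abs).add c1.abs) fun z => ?_
      have : ψ z * collisionOp e f z
        = ψ z * coagOp e f z - ψ z * lossOp f z + ψ z * breakOp e f z := congrFun h1 z
      simp only [this]
      exact (abs_add_le _ _).trans (add_le_add_left (abs_sub _ _) _)
    rw [integral_add₃ a1.abs b1.abs c1.abs] at h3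
    linarith

end

section

/-! ### The collision operator on a bounded interval of sizes -/

/-- The collision operator for a pair density that vanishes for `x + y ≥ N`, written with integrals
over compact intervals. -/
def truncOp (e f : ℝ → ℝ → ℝ) (N z : ℝ) : ℝ :=
  (1 / 2) * (∫ y in (0 : ℝ)..z, e (z - y) y * f (z - y) y) - (∫ y in (0 : ℝ)..N, f z y)
    - ∫ r in N..z, ∫ s in (0 : ℝ)..1, (1 - e (r - r * s) (r * s)) * f (r - r * s) (r * s)

variable {e f g : ℝ → ℝ → ℝ}

/-- With the substitution y = rs the average over [0, r] becomes an integral over [0, 1], continuous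
also at r = 0. All integrals then run over compact intervals, so joint continuity is automatic. -/
theorem continuous_truncOp (he : Continuous (uncurry e)) {X : Type*} [TopologicalSpace X]
    [FirstCountableTopology X] [LocallyCompactSpace X]
    {f : X → ℝ → ℝ → ℝ} (hf : Continuous fun p : X × ℝ × ℝ => f p.1 p.2.1 p.2.2) (N : ℝ) :
    Continuous fun p : X × ℝ => truncOp e (f p.1) N p.2 := by
  have he' : Continuous fun p : ℝ × ℝ => e p.1 p.2 := he
  unfold truncOp
  refine ((continuous_const.mul ?_).sub ?_).sub ?_
  · refine intervalIntegral.continuous_parametric_intervalIntegral_of_continuous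
      (f := fun (p : X × ℝ) y => e (p.2 - y) y * f p.1 (p.2 - y) y) ?_ continuous_snd
    refine Continuous.mul ?_ ?_
    · exact he'.comp (f := fun q : (X × ℝ) × ℝ => (q.1.2 - q.2, q.2)) (by fun_prop)
    · exact hf.comp (f := fun q : (X × ℝ) × ℝ => (q.1.1, q.1.2 - q.2, q.2)) (by fun_prop)
  · refine intervalIntegral.continuous_parametric_intervalIntegral_of_continuous'
      (f := fun (p : X × ℝ) y => f p.1 p.2 y) ?_ 0 N
    exact hf.comp (f := fun q : (X × ℝ) × ℝ => (q.1.1, q.1.2, q.2)) (by fun_prop)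
  · refine intervalIntegral.continuous_parametric_intervalIntegral_of_continuous
      (f := fun (p : X × ℝ) r => ∫ s in (0 : ℝ)..1,
        (1 - e (r - r * s) (r * s)) * f p.1 (r - r * s) (r * s)) ?_ continuous_snd
    refine intervalIntegral.continuous_parametric_intervalIntegral_of_continuous'
      (f := fun (q : (X × ℝ) × ℝ) s =>
        (1 - e (q.2 - q.2 * s) (q.2 * s)) * f q.1.1 (q.2 - q.2 * s) (q.2 * s)) ?_ 0 1
    refine Continuous.mul (continuous_const.sub ?_) ?_
    · exact he'.comp (f := fun q : ((X × ℝ) × ℝ) × ℝ =>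
        (q.1.2 - q.1.2 * q.2, q.1.2 * q.2)) (by fun_prop)
    · exact hf.comp (f := fun q : ((X × ℝ) × ℝ) × ℝ =>
        (q.1.1.1, q.1.2 - q.1.2 * q.2, q.1.2 * q.2)) (by fun_prop)

theorem truncOp_sub (he : Continuous (uncurry e)) (hf : Continuous (uncurry f))
    (hg : Continuous (uncurry g)) (N z : ℝ) :
    truncOp e f N z - truncOp e g N z = truncOp e (fun x y => f x y - g x y) N z := by
  have he' : Continuous fun p : ℝ × ℝ => e p.1 p.2 := he
  have c1 : ∀ h : ℝ → ℝ → ℝ, Continuous (uncurry h) →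
      Continuous fun y => e (z - y) y * h (z - y) y := fun h hh =>
    (he'.comp (f := fun y : ℝ => (z - y, y)) (by fun_prop)).mul
      (hh.comp (f := fun y : ℝ => (z - y, y)) (by fun_prop))
  have c2 : ∀ h : ℝ → ℝ → ℝ, Continuous (uncurry h) → Continuous fun y => h z y := fun h hh =>
    hh.comp (f := fun y : ℝ => (z, y)) (by fun_prop)
  have c3 : ∀ h : ℝ → ℝ → ℝ, Continuous (uncurry h) → Continuous fun p : ℝ × ℝ =>
      (1 - e (p.1 - p.1 * p.2) (p.1 * p.2)) * h (p.1 - p.1 * p.2) (p.1 * p.2) := fun h hh =>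
    (continuous_const.sub (he'.comp (f := fun p : ℝ × ℝ => (p.1 - p.1 * p.2, p.1 * p.2))
      (by fun_prop))).mul
      (hh.comp (f := fun p : ℝ × ℝ => (p.1 - p.1 * p.2, p.1 * p.2)) (by fun_prop))
  have c4 : ∀ h : ℝ → ℝ → ℝ, Continuous (uncurry h) → Continuous fun r => ∫ s in (0 : ℝ)..1,
      (1 - e (r - r * s) (r * s)) * h (r - r * s) (r * s) := fun h hh =>
    intervalIntegral.continuous_parametric_intervalIntegral_of_continuous' (c3 h hh) 0 1
  have c5 : ∀ h : ℝ → ℝ → ℝ, Continuous (uncurry h) → ∀ r, Continuous fun s =>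
      (1 - e (r - r * s) (r * s)) * h (r - r * s) (r * s) := fun h hh r =>
    (c3 h hh).comp (f := fun s : ℝ => (r, s)) (by fun_prop)
  unfold truncOp
  simp only [mul_sub]
  rw [intervalIntegral.integral_sub ((c1 f hf).intervalIntegrable _ _)
      ((c1 g hg).intervalIntegrable _ _),
    intervalIntegral.integral_sub ((c2 f hf).intervalIntegrable _ _)
      ((c2 g hg).intervalIntegrable _ _)]
  have : ∀ r, ∫ s in (0 : ℝ)..1, ((1 - e (r - r * s) (r * s)) * f (r - r * s) (r * s)
      - (1 - e (r - r * s) (r * s)) * g (r - r * s) (r * s))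
      = (∫ s in (0 : ℝ)..1, (1 - e (r - r * s) (r * s)) * f (r - r * s) (r * s))
        - ∫ s in (0 : ℝ)..1, (1 - e (r - r * s) (r * s)) * g (r - r * s) (r * s) := fun r =>
    intervalIntegral.integral_sub ((c5 f hf r).intervalIntegrable _ _)
      ((c5 g hg r).intervalIntegrable _ _)
  simp only [this]
  rw [intervalIntegral.integral_sub ((c4 f hf).intervalIntegrable _ _)
      ((c4 g hg).intervalIntegrable _ _)]
  ring

theorem abs_intervalIntegral_le {h : ℝ → ℝ} {a b C : ℝ} (hC : ∀ x ∈ uIoc a b, |h x| ≤ C) :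
    |∫ x in a..b, h x| ≤ C * |b - a| := by
  rw [← Real.norm_eq_abs]
  exact intervalIntegral.norm_integral_le_of_norm_le_const (f := h) hC

/-- Each of the three terms integrates over a length at most N. Together with `truncOp_sub` this
gives both the bound and the Lipschitz constant for Picard-Lindelöf. -/
theorem abs_truncOp_le (he : IsProb e) {N B z : ℝ} (hz : z ∈ Icc 0 N)
    (hB : ∀ x ∈ Icc 0 N, ∀ y ∈ Icc 0 N, |f x y| ≤ B) : |truncOp e f N z| ≤ 3 * N * B := by
  have hB0 : 0 ≤ B := (abs_nonneg _).trans (hB z hz z hz)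
  have hN : 0 ≤ N := hz.1.trans hz.2
  have h1 : |∫ y in (0 : ℝ)..z, e (z - y) y * f (z - y) y| ≤ B * |z - 0| := by
    refine abs_intervalIntegral_le fun y hy => ?_
    rw [uIoc_of_le hz.1] at hy
    rw [abs_mul]
    exact (mul_le_of_le_one_left (abs_nonneg _) (he.abs_le _ _)).trans
      (hB _ ⟨by linarith [hy.2], by linarith [hy.1, hz.2]⟩ _ ⟨hy.1.le, hy.2.trans hz.2⟩)
  have h2 : |∫ y in (0 : ℝ)..N, f z y| ≤ B * |N - 0| := by
    refine abs_intervalIntegral_le fun y hy => ?_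
    rw [uIoc_of_le hN] at hy
    exact hB _ hz _ ⟨hy.1.le, hy.2⟩
  have h3 : |∫ r in N..z, ∫ s in (0 : ℝ)..1, (1 - e (r - r * s) (r * s)) * f (r - r * s) (r * s)|
      ≤ B * |z - N| := by
    refine abs_intervalIntegral_le fun r hr => ?_
    rw [uIoc_of_ge hz.2] at hr
    have hr0 : 0 ≤ r := hz.1.trans hr.1.le
    have : |∫ s in (0 : ℝ)..1, (1 - e (r - r * s) (r * s)) * f (r - r * s) (r * s)|
        ≤ B * |(1 : ℝ) - 0| := by
      refine abs_intervalIntegral_le fun s hs => ?_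
      rw [uIoc_of_le zero_le_one] at hs
      rw [abs_mul]
      refine (mul_le_of_le_one_left (abs_nonneg _) (he.abs_one_sub_le _ _)).trans (hB _ ?_ _ ?_)
      · constructor <;> nlinarith [hs.1, hs.2, hr.2]
      · constructor <;> nlinarith [hs.1, hs.2, hr.2]
    simpa using this
  rw [sub_zero, abs_of_nonneg hz.1] at h1
  rw [sub_zero, abs_of_nonneg hN] at h2
  rw [abs_of_nonpos (sub_nonpos.2 hz.2)] at h3
  have h4 := mul_le_mul_of_nonneg_left hz.2 hB0
  have h5 := mul_nonneg hB0 hz.1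
  unfold truncOp
  rw [abs_le] at *
  constructor <;> nlinarith

theorem integral_unit_eq {r : ℝ} (hr : r ≠ 0) :
    ∫ s in (0 : ℝ)..1, (1 - e (r - r * s) (r * s)) * f (r - r * s) (r * s)
      = r⁻¹ * ∫ y in (0 : ℝ)..r, (1 - e (r - y) y) * f (r - y) y := by
  have := intervalIntegral.integral_comp_mul_left (a := 0) (b := 1)
    (fun y => (1 - e (r - y) y) * f (r - y) y) hr
  simpa using this

theorem truncOp_eq_collisionOp {N z : ℝ} (hz : 0 ≤ z) (hN : 0 ≤ N)
    (hs : ∀ x y, 0 ≤ x → 0 ≤ y → N ≤ x + y → f x y = 0) :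
    truncOp e f N z = collisionOp e f z := by
  have hr0 : ∀ r, N ≤ r → r⁻¹ * ∫ y in (0 : ℝ)..r, (1 - e (r - y) y) * f (r - y) y = 0 := by
    intro r hr
    have : ∫ y in (0 : ℝ)..r, (1 - e (r - y) y) * f (r - y) y = ∫ y in (0 : ℝ)..r, (0 : ℝ) := by
      refine intervalIntegral.integral_congr fun y hy => ?_
      rw [uIcc_of_le (hN.trans hr)] at hy
      rw [hs _ _ (sub_nonneg.2 hy.2) hy.1 (by linarith), mul_zero]
    rw [this]; simp
  have hloss : ∫ y in (0 : ℝ)..N, f z y = lossOp f z := by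
    rw [intervalIntegral.integral_of_le hN, lossOp]
    refine (setIntegral_eq_of_subset_of_forall_sdiff_eq_zero measurableSet_Ioi
      Ioc_subset_Ioi_self fun y hy => ?_).symm
    have hy0 : 0 < y := hy.1
    have : ¬ y ≤ N := fun h => hy.2 ⟨hy0, h⟩
    exact hs _ _ hz hy0.le (by linarith)
  have hbreak : -∫ r in N..z, ∫ s in (0 : ℝ)..1, (1 - e (r - r * s) (r * s)) *
      f (r - r * s) (r * s) = breakOp e f z := by
    rw [breakOp, ← intervalIntegral.integral_symm]
    have h1 : ∫ r in z..N, ∫ s in (0 : ℝ)..1, (1 - e (r - r * s) (r * s)) *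
        f (r - r * s) (r * s)
        = ∫ r in z..N, r⁻¹ * ∫ y in (0 : ℝ)..r, (1 - e (r - y) y) * f (r - y) y := by
      -- The two integrands may differ only at r = 0, where the rescaling is not available.
      refine intervalIntegral.integral_congr_ae
        (ae_iff.2 (measure_mono_null ?_ (measure_singleton (0 : ℝ))))
      intro r hr
      by_contra h0
      exact hr fun _ => integral_unit_eq h0
    rw [h1]
    rcases le_total z N with h | h
    · rw [intervalIntegral.integral_of_le h]
      refine (setIntegral_eq_of_subset_of_forall_sdiff_eq_zero measurableSet_Ioi
        Ioc_subset_Ioi_self fun r hr => ?_).symm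
      have : ¬ r ≤ N := fun h => hr.2 ⟨hr.1, h⟩
      exact hr0 r (by linarith)
    · have h2 : ∫ r in z..N, r⁻¹ * ∫ y in (0 : ℝ)..r, (1 - e (r - y) y) * f (r - y) y
          = ∫ r in z..N, (0 : ℝ) := by
        refine intervalIntegral.integral_congr fun r hr => ?_
        rw [uIcc_of_ge h] at hr
        exact hr0 r hr.1
      rw [h2, setIntegral_congr_fun (g := fun _ => (0 : ℝ)) measurableSet_Ioi
        fun r hr => hr0 r (h.trans (le_of_lt hr))]
      simp
  rw [truncOp, collisionOp, coagOp, hloss, ← hbreak]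
  ring

theorem collisionOp_eq_zero {N z : ℝ} (hN : 0 ≤ N) (hz : N ≤ z)
    (hs : ∀ x y, 0 ≤ x → 0 ≤ y → N ≤ x + y → f x y = 0) :
    collisionOp e f z = 0 := by
  rw [← truncOp_eq_collisionOp (hN.trans hz) hN hs, truncOp]
  have h1 : ∫ y in (0 : ℝ)..z, e (z - y) y * f (z - y) y = ∫ y in (0 : ℝ)..z, (0 : ℝ) := by
    refine intervalIntegral.integral_congr fun y hy => ?_
    rw [uIcc_of_le (hN.trans hz)] at hy
    rw [hs _ _ (sub_nonneg.2 hy.2) hy.1 (by linarith), mul_zero]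
  have h2 : ∫ y in (0 : ℝ)..N, f z y = ∫ y in (0 : ℝ)..N, (0 : ℝ) := by
    refine intervalIntegral.integral_congr fun y hy => ?_
    rw [uIcc_of_le hN] at hy
    exact hs _ _ (hN.trans hz) hy.1 (by linarith [hy.1])
  have h3 : ∫ r in N..z, ∫ s in (0 : ℝ)..1, (1 - e (r - r * s) (r * s)) *
      f (r - r * s) (r * s) = ∫ r in N..z, (0 : ℝ) := by
    refine intervalIntegral.integral_congr fun r hr => ?_
    rw [uIcc_of_le hz] at hr
    have hr0 : 0 ≤ r := hN.trans hr.1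
    have : ∫ s in (0 : ℝ)..1, (1 - e (r - r * s) (r * s)) * f (r - r * s) (r * s)
        = ∫ s in (0 : ℝ)..1, (0 : ℝ) := by
      refine intervalIntegral.integral_congr fun s hs' => ?_
      rw [uIcc_of_le zero_le_one] at hs'
      rw [hs _ _ (by nlinarith [hs'.1, hs'.2]) (mul_nonneg hr0 hs'.1) (by linarith [hr.1]),
        mul_zero]
    simp only [this]
    simp
  rw [h1, h2, h3]
  simp

end

/-! ### The integrated equation, and Picard-Lindelöf for the clamped problem -/

section

variable {e K : ℝ → ℝ → ℝ} {ψ W : ℝ → ℝ}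

/-! ### The moment equation -/

/-- The integrated equation is multiplied by ψ and integrated over sizes; time and size integrals
are exchanged and the weak form is inserted. All moment bounds and mass conservation rest on this
identity. -/
theorem moment_equation {v : ℝ → ℝ → ℝ} {f : ℝ → ℝ → ℝ → ℝ} {T B : ℝ} (he : IsProb e)
    (hw : IsWeight ψ W)
    (hv : ∀ z, 0 < z → ∀ t ∈ Icc 0 T, v z t = v z 0 + ∫ s in (0 : ℝ)..t, collisionOp e (f s) z)
    (hm : ContinuousOn (uncurry fun z s => collisionOp e (f s) z) (strip T))
    (hf : ∀ s ∈ Icc 0 T, Measurable (uncurry (f s)))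
    (hi : ∀ s ∈ Icc 0 T, Integrable (fun p : ℝ × ℝ => W p.1 * f s p.1 p.2) quadMeasure)
    (hi' : ∀ s ∈ Icc 0 T, Integrable (fun p : ℝ × ℝ => W (p.1 + p.2) * f s p.1 p.2) quadMeasure)
    (hB : ∀ s ∈ Icc 0 T, ∫ p, W p.1 * |f s p.1 p.2| ∂quadMeasure
      + 2 * ∫ p, W (p.1 + p.2) * |f s p.1 p.2| ∂quadMeasure ≤ B)
    (h0 : Integrable (fun z => ψ z * v z 0) posMeasure) {t : ℝ} (ht : t ∈ Icc 0 T) :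
    Integrable (fun z => ψ z * v z t) posMeasure ∧
      IntervalIntegrable (fun s => ∫ p, weakKernel e ψ p.1 p.2 * f s p.1 p.2 ∂quadMeasure)
        volume 0 t ∧
      ∫ z, ψ z * v z t ∂posMeasure = ∫ z, ψ z * v z 0 ∂posMeasure
        + ∫ s in (0 : ℝ)..t, ∫ p, weakKernel e ψ p.1 p.2 * f s p.1 p.2 ∂quadMeasure := by
  have hm' : AEStronglyMeasurable (uncurry fun z s => ψ z * collisionOp e (f s) z)
      (posMeasure.prod (volume.restrict (Icc 0 T))) := by
    refine (hw.measurable.comp measurable_fst).aestronglyMeasurable.mul ?_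
    rw [Measure.prod_restrict]
    exact (hm.mono (prod_mono Ioi_subset_Ici_self subset_rfl)).aestronglyMeasurable
      (measurableSet_Ioi.prod measurableSet_Icc)
  have hcw := fun s hs => collision_weak he (hf s hs) hw (hi s hs) (hi' s hs)
  obtain ⟨a1, a2, a3⟩ := integral_time_swap hm' (fun s hs => (hcw s hs).1)
    (fun s hs => (hcw s hs).2.2.2.trans (hB s hs)) ht
  have hsub : ∀ s ∈ uIcc 0 t, s ∈ Icc 0 T := fun s hs => by
    rw [uIcc_of_le ht.1] at hs
    exact ⟨hs.1, hs.2.trans ht.2⟩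
  have hsub' : ∀ s ∈ uIoc 0 t, s ∈ Icc 0 T := fun s hs => hsub s (uIoc_subset_uIcc hs)
  have hveq : ∀ z, 0 < z → ψ z * v z 0 + ∫ s in (0 : ℝ)..t, ψ z * collisionOp e (f s) z
      = ψ z * v z t := fun z hz => by
    rw [hv z hz t ht, mul_add, intervalIntegral.integral_const_mul]
  refine ⟨(h0.add a1).congr (ae_posMeasure hveq), ?_, ?_⟩
  · exact a2.congr fun s hs => (hcw s (hsub' s hs)).2.2.1
  · rw [← integral_congr_ae (ae_posMeasure hveq), integral_add h0 a1, a3]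
    congr 1
    exact intervalIntegral.integral_congr fun s hs => (hcw s (hsub s hs)).2.2.1

/-- A density bounded by B and carried by the square [0, N]² is dominated by W(x) B there. The
constant depends on f only through B and N, which makes it uniform in time. -/
theorem exists_uniform_bound_of_support {N B c : ℝ} (hWm : Measurable W)
    (hW0 : ∀ x, 0 < x → 0 ≤ W x) (hWi : IntegrableOn W (Ioc 0 N))
    (hc : ∀ x y, 0 < x → 0 < y → W (x + y) ≤ c * (W x + W y)) (hc0 : 0 ≤ c) (hB0 : 0 ≤ B) :
    ∃ D : ℝ, ∀ f : ℝ → ℝ → ℝ, Measurable (uncurry f) →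
      (∀ x y, 0 < x → 0 < y → |f x y| ≤ B) → (∀ x y, 0 < x → 0 < y → N ≤ x + y → f x y = 0) →
      Integrable (fun p : ℝ × ℝ => W p.1 * f p.1 p.2) quadMeasure ∧
      Integrable (fun p : ℝ × ℝ => W (p.1 + p.2) * f p.1 p.2) quadMeasure ∧
      ∫ p, W p.1 * |f p.1 p.2| ∂quadMeasure
        + 2 * ∫ p, W (p.1 + p.2) * |f p.1 p.2| ∂quadMeasure ≤ D := by
  set G : ℝ → ℝ → ℝ := fun x y => (Ioc 0 N).indicator W x * (Ioc 0 N).indicator (fun _ => B) y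
    with hG
  have hGi : Integrable (fun p : ℝ × ℝ => G p.1 p.2) quadMeasure := by
    refine Integrable.mul_prod (f := (Ioc 0 N).indicator W)
      (g := (Ioc 0 N).indicator (fun _ => B)) ?_ ?_
    · exact ((integrable_indicator_iff measurableSet_Ioc).2 hWi).restrict
    · refine ((integrable_indicator_iff measurableSet_Ioc).2 ?_).restrict
      exact integrableOn_const (by simp)
  have hGi' : Integrable (fun p : ℝ × ℝ => G p.2 p.1) quadMeasure := integrable_swap_quad.2 hGi
  have hG0 : ∀ x y, 0 ≤ G x y := fun x y => by
    refine mul_nonneg (indicator_nonneg (fun x hx => hW0 x hx.1) _)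
      (indicator_nonneg (fun _ _ => hB0) _)
  have hGi2 : Integrable (fun p : ℝ × ℝ => c * (G p.1 p.2 + G p.2 p.1)) quadMeasure :=
    (hGi.add hGi').const_mul c
  refine ⟨∫ p, G p.1 p.2 ∂quadMeasure + 2 * ∫ p, c * (G p.1 p.2 + G p.2 p.1) ∂quadMeasure,
    fun f hf hfB hfN => ?_⟩
  have hin : ∀ x y, 0 < x → 0 < y → f x y ≠ 0 → x ∈ Ioc 0 N ∧ y ∈ Ioc 0 N := by
    intro x y hx hy h
    have : x + y < N := not_le.1 fun h' => h (hfN x y hx hy h')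
    exact ⟨⟨hx, by linarith⟩, ⟨hy, by linarith⟩⟩
  have hle1 : ∀ x y, 0 < x → 0 < y → W x * |f x y| ≤ G x y := by
    intro x y hx hy
    by_cases h : f x y = 0
    · rw [h, abs_zero, mul_zero]; exact hG0 x y
    · obtain ⟨h1, h2⟩ := hin x y hx hy h
      rw [hG]
      simp only [indicator_of_mem h1, indicator_of_mem h2]
      exact mul_le_mul_of_nonneg_left (hfB x y hx hy) (hW0 x hx)
  have hle1' : ∀ x y, 0 < x → 0 < y → W y * |f x y| ≤ G y x := by
    intro x y hx hy
    by_cases h : f x y = 0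
    · rw [h, abs_zero, mul_zero]; exact hG0 y x
    · obtain ⟨h1, h2⟩ := hin x y hx hy h
      rw [hG]
      simp only [indicator_of_mem h1, indicator_of_mem h2]
      exact mul_le_mul_of_nonneg_left (hfB x y hx hy) (hW0 y hy)
  have hle2 : ∀ x y, 0 < x → 0 < y → W (x + y) * |f x y| ≤ c * (G x y + G y x) := by
    intro x y hx hy
    have h1 := mul_le_mul_of_nonneg_right (hc x y hx hy) (abs_nonneg (f x y))
    have h2 := mul_le_mul_of_nonneg_left (add_le_add (hle1 x y hx hy) (hle1' x y hx hy)) hc0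
    refine h1.trans (le_trans (le_of_eq ?_) h2)
    ring
  have m1 : Measurable fun p : ℝ × ℝ => W p.1 * f p.1 p.2 := (hWm.comp measurable_fst).mul hf
  have m2 : Measurable fun p : ℝ × ℝ => W (p.1 + p.2) * f p.1 p.2 :=
    (hWm.comp (measurable_fst.add measurable_snd)).mul hf
  have i1 : Integrable (fun p : ℝ × ℝ => W p.1 * f p.1 p.2) quadMeasure := by
    refine hGi.mono' m1.aestronglyMeasurable (ae_quadMeasure fun x y hx hy => ?_)
    rw [Real.norm_eq_abs, abs_mul, abs_of_nonneg (hW0 x hx)]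
    exact hle1 x y hx hy
  have i2 : Integrable (fun p : ℝ × ℝ => W (p.1 + p.2) * f p.1 p.2) quadMeasure := by
    refine hGi2.mono' m2.aestronglyMeasurable (ae_quadMeasure fun x y hx hy => ?_)
    rw [Real.norm_eq_abs, abs_mul, abs_of_nonneg (hW0 _ (add_pos hx hy))]
    exact hle2 x y hx hy
  refine ⟨i1, i2, add_le_add ?_ (mul_le_mul_of_nonneg_left ?_ zero_le_two)⟩
  · exact integral_mono_of_nonneg (ae_quadMeasure fun x y hx hy =>
      mul_nonneg (hW0 x hx) (abs_nonneg _)) hGi (ae_quadMeasure hle1)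
  · exact integral_mono_of_nonneg (ae_quadMeasure fun x y hx hy =>
      mul_nonneg (hW0 _ (add_pos hx hy)) (abs_nonneg _)) hGi2 (ae_quadMeasure hle2)

theorem isWeight_one : IsWeight (fun _ => 1) (fun _ => 1) where
  measurable := measurable_const
  measurable_weight := measurable_const
  pos := fun _ _ => one_pos
  le := fun _ _ => by simp
  intervalIntegrable := fun _ _ => intervalIntegrable_const
  average_le := fun _ _ => by simp

/-! ### Mild solutions -/

/-- A non-negative continuous solution of the integrated equation with collision kernel `K`. -/
structure IsMild (e K : ℝ → ℝ → ℝ) (T : ℝ) (g : ℝ → ℝ → ℝ) : Prop where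
  continuous : Continuous (uncurry g)
  nonneg : ∀ z t, 0 ≤ g z t
  continuousOn_op :
    ContinuousOn (uncurry fun z t => collisionOp e (fun x y => collisionRate K g x y t) z) (strip T)
  eq_add_integral : ∀ z, 0 ≤ z → ∀ t ∈ Icc 0 T, g z t = g z 0
    + ∫ s in (0 : ℝ)..t, collisionOp e (fun x y => collisionRate K g x y s) z

/-- Truncation of a real number to `[0, M]`. -/
def clamp (M x : ℝ) : ℝ := max 0 (min x M)

theorem continuous_clamp (M : ℝ) : Continuous (clamp M) := by unfold clamp; fun_prop

theorem clamp_nonneg (M x : ℝ) : 0 ≤ clamp M x := le_max_left _ _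

theorem clamp_le {M : ℝ} (hM : 0 ≤ M) (x : ℝ) : clamp M x ≤ M :=
  max_le hM (min_le_right _ _)

theorem clamp_le_self {M x : ℝ} (hx : 0 ≤ x) : clamp M x ≤ x :=
  max_le hx (min_le_left _ _)

theorem clamp_of_nonpos {M x : ℝ} (hx : x ≤ 0) : clamp M x = 0 :=
  max_eq_left ((min_le_left _ _).trans hx)

theorem clamp_of_mem {M x : ℝ} (hx : 0 ≤ x) (hM : x ≤ M) : clamp M x = x := by
  rw [clamp, min_eq_left hM, max_eq_right hx]

theorem abs_clamp_sub_le (M x y : ℝ) : |clamp M x - clamp M y| ≤ |x - y| := by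
  unfold clamp
  calc |max 0 (min x M) - max 0 (min y M)| ≤ max |0 - 0| |min x M - min y M| :=
        abs_max_sub_max_le_max _ _ _ _
    _ ≤ max |0 - 0| (max |x - y| |M - M|) := max_le_max le_rfl (abs_min_sub_min_le_max _ _ _ _)
    _ = |x - y| := by simp

/-- The truncated pair density. -/
def clampRate (K : ℝ → ℝ → ℝ) (M : ℝ) (v : ℝ → ℝ) (x y : ℝ) : ℝ :=
  K x y * clamp M (v x) * clamp M (v y)

/-- Clamping makes the quadratic vector field globally bounded and Lipschitz on C([0, N]), so a
single Picard-Lindelöf step covers all of `[0, T]`. Outside [0, N] and `[0, T]` the solution is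
extended by projection, which gives continuity on the plane. -/
theorem exists_clamped_solution {g₀ : ℝ → ℝ} {N T M : ℝ} (hN : 0 < N) (hT : 0 ≤ T) (hM : 0 ≤ M)
    (he : Continuous (uncurry e)) (hp : IsProb e) (hK : Continuous (uncurry K))
    (hKN : ∀ x y, 0 ≤ x → 0 ≤ y → N ≤ x + y → K x y = 0)
    (hg : Continuous g₀) (hgN : ∀ x, N ≤ x → g₀ x = 0) :
    ∃ v : ℝ → ℝ → ℝ, Continuous (uncurry v) ∧ (∀ z, 0 ≤ z → v z 0 = g₀ z) ∧
      (∀ z, N ≤ z → ∀ t, v z t = 0) ∧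
      Continuous (uncurry fun z t => truncOp e (clampRate K M fun x => v x t) N z) ∧
      ∀ z, 0 ≤ z → ∀ t ∈ Icc 0 T, v z t = v z 0
        + ∫ s in (0 : ℝ)..t, collisionOp e (clampRate K M fun x => v x s) z := by
  have hK' : Continuous fun p : ℝ × ℝ => K p.1 p.2 := hK
  set π : ℝ → Icc 0 N := projIcc 0 N hN.le with hπ
  have hπc : Continuous π := continuous_projIcc
  have hrate : ∀ v : ℝ → ℝ, Continuous v → Continuous (uncurry (clampRate K M v)) := by
    intro v hv
    have : Continuous fun p : ℝ × ℝ => K p.1 p.2 * clamp M (v p.1) * clamp M (v p.2) :=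
      (hK'.mul ((continuous_clamp M).comp (hv.comp continuous_fst))).mul
        ((continuous_clamp M).comp (hv.comp continuous_snd))
    exact this
  set V : C(Icc 0 N, ℝ) → C(Icc 0 N, ℝ) := fun u =>
    ⟨fun z => truncOp e (clampRate K M fun x => u (π x)) N z, by
      have := continuous_truncOp he (X := Unit) (f := fun _ => clampRate K M fun x => u (π x))
        ((hrate _ (u.continuous.comp hπc)).comp continuous_snd) N
      exact this.comp (f := fun z : Icc 0 N => ((), (z : ℝ))) (by fun_prop)⟩ with hV
  obtain ⟨k, hk⟩ : ∃ k : ℝ, ∀ x ∈ Icc 0 N, ∀ y ∈ Icc 0 N, |K x y| ≤ k := by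
    obtain ⟨k, hk⟩ := (isCompact_Icc.prod isCompact_Icc :
      IsCompact (Icc (0 : ℝ) N ×ˢ Icc (0 : ℝ) N)).exists_bound_of_continuousOn hK.continuousOn
    exact ⟨k, fun x hx y hy => hk (x, y) ⟨hx, hy⟩⟩
  have hk0 : 0 ≤ k := (abs_nonneg _).trans (hk 0 ⟨le_rfl, hN.le⟩ 0 ⟨le_rfl, hN.le⟩)
  have hcl : ∀ x, |clamp M x| ≤ M := fun x => by
    rw [abs_of_nonneg (clamp_nonneg M x)]; exact clamp_le hM x
  have hbound : ∀ u, ‖V u‖ ≤ 3 * N * (k * M * M) := by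
    intro u
    rw [ContinuousMap.norm_le _ (by positivity)]
    intro z
    refine abs_truncOp_le hp z.2 fun x hx y hy => ?_
    rw [clampRate, abs_mul, abs_mul]
    have := hk x hx y hy
    have := hcl (u (π x))
    have := hcl (u (π y))
    gcongr
  have hlip : ∀ u w, ‖V u - V w‖ ≤ 3 * N * (2 * k * M) * ‖u - w‖ := by
    intro u w
    rw [ContinuousMap.norm_le _ (by positivity), mul_assoc (3 * N)]
    intro z
    rw [ContinuousMap.sub_apply, hV]
    simp only [ContinuousMap.coe_mk]
    rw [truncOp_sub he (hrate (fun x => u (π x)) (u.continuous.comp hπc))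
      (hrate (fun x => w (π x)) (w.continuous.comp hπc)),
      Real.norm_eq_abs]
    refine abs_truncOp_le hp z.2 fun x hx y hy => ?_
    have h1 : ∀ x, |clamp M (u (π x)) - clamp M (w (π x))| ≤ ‖u - w‖ := fun x =>
      (abs_clamp_sub_le _ _ _).trans ((u - w).norm_coe_le_norm (π x))
    have h2 : clampRate K M (fun x => u (π x)) x y - clampRate K M (fun x => w (π x)) x y
        = K x y * ((clamp M (u (π x)) - clamp M (w (π x))) * clamp M (u (π y))
          + clamp M (w (π x)) * (clamp M (u (π y)) - clamp M (w (π y)))) := by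
      unfold clampRate; ring
    rw [h2, abs_mul]
    calc |K x y| * |(clamp M (u (π x)) - clamp M (w (π x))) * clamp M (u (π y))
          + clamp M (w (π x)) * (clamp M (u (π y)) - clamp M (w (π y)))|
        ≤ k * (‖u - w‖ * M + M * ‖u - w‖) := by
          refine mul_le_mul (hk x hx y hy) ((abs_add_le _ _).trans ?_) (abs_nonneg _) hk0
          rw [abs_mul, abs_mul]
          exact add_le_add (mul_le_mul (h1 x) (hcl _) (abs_nonneg _) (norm_nonneg _))
            (mul_le_mul (hcl _) (h1 y) (abs_nonneg _) hM)
      _ = 2 * k * M * ‖u - w‖ := by ring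
  set u₀ : C(Icc 0 N, ℝ) := ⟨fun z => g₀ z, hg.comp continuous_subtype_val⟩ with hu₀
  -- The radius is speed times T, so the solution cannot leave the ball before time T.
  have hPL : IsPicardLindelof (fun _ => V) (⟨0, le_rfl, hT⟩ : Icc 0 T) u₀
      (3 * N * (k * M * M) * T).toNNReal 0 (3 * N * (k * M * M)).toNNReal
      (3 * N * (2 * k * M)).toNNReal := by
    refine IsPicardLindelof.of_time_independent (fun u _ => ?_) ?_ ?_
    · exact (hbound u).trans (Real.le_coe_toNNReal _)
    · refine LipschitzWith.lipschitzOnWith (LipschitzWith.of_dist_le_mul fun u w => ?_)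
      rw [dist_eq_norm, dist_eq_norm, Real.coe_toNNReal _ (by positivity)]
      exact hlip u w
    · rw [Real.coe_toNNReal _ (by positivity), Real.coe_toNNReal _ (by positivity)]
      simp [hT]
  obtain ⟨a, ha0, ha⟩ := hPL.exists_eq_forall_mem_Icc_hasDerivWithinAt₀
  have hac : ContinuousOn a (Icc 0 T) := fun t ht => (ha t ht).continuousWithinAt
  set τ : ℝ → Icc 0 T := projIcc 0 T hT with hτ
  have hτc : Continuous τ := continuous_projIcc
  have hτm : ∀ t ∈ Icc 0 T, (τ t : ℝ) = t := fun t ht => by rw [hτ, projIcc_of_mem hT ht]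
  have hπm : ∀ z ∈ Icc 0 N, (π z : ℝ) = z := fun z hz => by rw [hπ, projIcc_of_mem hN.le hz]
  set v : ℝ → ℝ → ℝ := fun z t => a (τ t) (π z) with hv
  have hac' : Continuous fun t : ℝ => a (τ t) :=
    (continuousOn_iff_continuous_domRestrict.1 hac).comp hτc
  have hvc : Continuous (uncurry v) := by
    have : Continuous fun p : ℝ × ℝ => a (τ p.2) (π p.1) :=
      (hac'.comp continuous_snd).eval (hπc.comp continuous_fst)
    exact this
  have hvc' : Continuous fun p : ℝ × ℝ => v p.1 p.2 := hvc
  have hop : Continuous (uncurry fun z t => truncOp e (clampRate K M fun x => v x t) N z) := by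
    have h1 : Continuous fun p : ℝ × ℝ × ℝ => clampRate K M (fun x => v x p.1) p.2.1 p.2.2 := by
      refine Continuous.mul (Continuous.mul ?_ ((continuous_clamp M).comp ?_))
        ((continuous_clamp M).comp ?_)
      · exact hK'.comp continuous_snd
      · exact hvc'.comp (f := fun p : ℝ × ℝ × ℝ => (p.2.1, p.1)) (by fun_prop)
      · exact hvc'.comp (f := fun p : ℝ × ℝ × ℝ => (p.2.2, p.1)) (by fun_prop)
    exact (continuous_truncOp he (f := fun t => clampRate K M fun x => v x t) h1 N).comp (f := fun p : ℝ × ℝ => (p.2, p.1)) (by fun_prop)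
  have hv0 : ∀ z, 0 ≤ z → v z 0 = g₀ z := by
    intro z hz
    rw [hv]
    simp only
    rw [hτm 0 ⟨le_rfl, hT⟩]
    have : a 0 = u₀ := ha0
    rw [this, hu₀]
    simp only [ContinuousMap.coe_mk]
    rcases le_total z N with h | h
    · rw [hπm z ⟨hz, h⟩]
    · rw [hπ, projIcc_of_right_le hN.le h, hgN N le_rfl, hgN z h]
  have hsupp : ∀ s x y, 0 ≤ x → 0 ≤ y → N ≤ x + y → clampRate K M (fun x => v x s) x y = 0 := by
    intro s x y hx hy hxy
    rw [clampRate, hKN x y hx hy hxy, zero_mul, zero_mul]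
  have heq : ∀ z ∈ Icc 0 N, ∀ t ∈ Icc 0 T, v z t = v z 0
      + ∫ s in (0 : ℝ)..t, collisionOp e (clampRate K M fun x => v x s) z := by
    intro z hz t ht
    have hd : ∀ s ∈ Icc 0 T, HasDerivWithinAt (fun s => a s (π z))
        (truncOp e (clampRate K M fun x => v x s) N z) (Icc 0 T) s := by
      intro s hs
      have h1 := ((ContinuousMap.evalCLM ℝ (π z)).hasFDerivAt.comp_hasDerivWithinAt s (ha s hs))
      have h2 : ContinuousMap.evalCLM ℝ (π z) (V (a s))
          = truncOp e (clampRate K M fun x => v x s) N z := by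
        simp only [hV, hv, ContinuousMap.evalCLM_apply, ContinuousMap.coe_mk]
        rw [hτm s hs, hπm z hz]
      rw [h2] at h1
      exact h1
    have h3 : ∫ s in (0 : ℝ)..t, truncOp e (clampRate K M fun x => v x s) N z
        = a t (π z) - a 0 (π z) := by
      refine intervalIntegral.integral_eq_sub_of_hasDerivAt_of_le (f := fun s => a s (π z)) ht.1
        (fun s hs => ?_) (fun s hs => ?_) ?_
      · exact ((hd s ⟨hs.1, hs.2.trans ht.2⟩).mono (Icc_subset_Icc_right ht.2)).continuousWithinAt
      · exact (hd s ⟨hs.1.le, hs.2.le.trans ht.2⟩).hasDerivAt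
          (Icc_mem_nhds hs.1 (hs.2.trans_le ht.2))
      · exact (hop.comp (f := fun s : ℝ => (z, s)) (by fun_prop)).intervalIntegrable _ _
    have h4 : ∀ s, truncOp e (clampRate K M fun x => v x s) N z
        = collisionOp e (clampRate K M fun x => v x s) z := fun s =>
      truncOp_eq_collisionOp hz.1 hN.le (hsupp s)
    simp only [h4] at h3
    rw [h3, hv]
    simp only
    rw [hτm t ht, hτm 0 ⟨le_rfl, hT⟩]
    ring
  -- The extension is constant in size beyond N, and at N both the initial value and the operator
  -- vanish.
  have hvN : ∀ z, N ≤ z → ∀ t, v z t = 0 := by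
    intro z hz t
    have h1 : v z t = v N (τ t) := by
      simp only [hv]
      rw [hτm _ (τ t).2, hπ, projIcc_of_right_le hN.le hz, projIcc_of_right_le hN.le le_rfl]
    rw [h1, heq N ⟨hN.le, le_rfl⟩ _ (τ t).2, hv0 N hN.le, hgN N le_rfl]
    simp only [collisionOp_eq_zero hN.le le_rfl (hsupp _)]
    simp
  refine ⟨v, hvc, hv0, hvN, hop, fun z hz t ht => ?_⟩
  rcases le_total z N with h | h
  · exact heq z ⟨hz, h⟩ t ht
  · simp only [collisionOp_eq_zero hN.le h (hsupp _), hvN z h]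
    simp

end

/-! ### Removing the clamp: positivity and the supremum bound -/

section

variable {e K : ℝ → ℝ → ℝ}

/-! ### Elementary properties of the collision operator -/

theorem collisionOp_congr {e e' f f' : ℝ → ℝ → ℝ} {z : ℝ} (hz : 0 ≤ z)
    (he : ∀ x y, 0 ≤ x → 0 ≤ y → e x y = e' x y) (hf : ∀ x y, 0 ≤ x → 0 ≤ y → f x y = f' x y) :
    collisionOp e f z = collisionOp e' f' z := by
  have h1 : coagOp e f z = coagOp e' f' z := by
    unfold coagOp
    congr 1
    refine intervalIntegral.integral_congr fun y hy => ?_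
    rw [uIcc_of_le hz] at hy
    rw [he _ _ (sub_nonneg.2 hy.2) hy.1, hf _ _ (sub_nonneg.2 hy.2) hy.1]
  have h2 : lossOp f z = lossOp f' z :=
    setIntegral_congr_fun measurableSet_Ioi fun y hy => hf z y hz (le_of_lt hy)
  have h3 : breakOp e f z = breakOp e' f' z := by
    unfold breakOp
    refine setIntegral_congr_fun measurableSet_Ioi fun r hr => ?_
    congr 1
    refine intervalIntegral.integral_congr fun y hy => ?_
    rw [uIcc_of_le (hz.trans (le_of_lt hr))] at hy
    rw [he _ _ (sub_nonneg.2 hy.2) hy.1, hf _ _ (sub_nonneg.2 hy.2) hy.1]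
  rw [collisionOp, collisionOp, h1, h2, h3]

theorem coagOp_nonneg {f : ℝ → ℝ → ℝ} (he : IsProb e)
    (hf : ∀ x y, 0 ≤ x → 0 ≤ y → 0 ≤ f x y) {z : ℝ} (hz : 0 ≤ z) : 0 ≤ coagOp e f z :=
  mul_nonneg (by norm_num) (intervalIntegral.integral_nonneg hz fun y hy =>
    mul_nonneg (he.nonneg _ _) (hf _ _ (sub_nonneg.2 hy.2) hy.1))

theorem inner_break_nonneg {f : ℝ → ℝ → ℝ} (he : IsProb e)
    (hf : ∀ x y, 0 ≤ x → 0 ≤ y → 0 ≤ f x y) {r : ℝ} (hr : 0 ≤ r) :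
    0 ≤ r⁻¹ * ∫ y in (0 : ℝ)..r, (1 - e (r - y) y) * f (r - y) y :=
  mul_nonneg (inv_nonneg.2 hr) (intervalIntegral.integral_nonneg hr fun _ hy =>
    mul_nonneg (sub_nonneg.2 (he.le_one _ _)) (hf _ _ (sub_nonneg.2 hy.2) hy.1))

theorem breakOp_nonneg {f : ℝ → ℝ → ℝ} (he : IsProb e)
    (hf : ∀ x y, 0 ≤ x → 0 ≤ y → 0 ≤ f x y) {z : ℝ} (hz : 0 ≤ z) : 0 ≤ breakOp e f z :=
  setIntegral_nonneg measurableSet_Ioi fun _ hr =>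
    inner_break_nonneg he hf (hz.trans (le_of_lt hr))

theorem integral_triangle_le {h : ℝ → ℝ → ℝ} {φ : ℝ → ℝ} {D r : ℝ} (hr : 0 ≤ r) (hD : 0 ≤ D)
    (hφ : Integrable φ posMeasure) (hφ0 : ∀ y, 0 < y → 0 ≤ φ y)
    (h0 : ∀ y, 0 < y → y ≤ r → 0 ≤ h (r - y) y)
    (hh : ∀ y, 0 < y → y ≤ r → h (r - y) y ≤ D * φ y) :
    ∫ y in (0 : ℝ)..r, h (r - y) y ≤ D * ∫ y, φ y ∂posMeasure := by
  rw [intervalIntegral.integral_of_le hr]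
  have hle : IntegrableOn φ (Ioc 0 r) := IntegrableOn.mono_set hφ Ioc_subset_Ioi_self
  calc ∫ y in Ioc 0 r, h (r - y) y ≤ ∫ y in Ioc 0 r, D * φ y :=
        integral_mono_of_nonneg
          (ae_restrict_of_forall_mem measurableSet_Ioc fun y hy => h0 y hy.1 hy.2)
          (hle.const_mul D)
          (ae_restrict_of_forall_mem measurableSet_Ioc fun y hy => hh y hy.1 hy.2)
    _ = D * ∫ y in Ioc 0 r, φ y := integral_const_mul _ _
    _ ≤ D * ∫ y, φ y ∂posMeasure := by
        refine mul_le_mul_of_nonneg_left (setIntegral_mono_set hφ (ae_posMeasure hφ0)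
          Ioc_subset_Ioi_self.eventuallyLE) hD

theorem weakKernel_one {x y : ℝ} (hx : 0 < x) (hy : 0 < y) :
    weakKernel e (fun _ => 1) x y = -(e x y) / 2 := by
  have : x + y ≠ 0 := (add_pos hx hy).ne'
  rw [weakKernel]
  simp only [intervalIntegral.integral_const, sub_zero, smul_eq_mul, mul_one]
  rw [inv_mul_cancel₀ this]
  ring

/-- One factor of the pair density is bounded by its supremum S and the other is integrated. The
breakage term leaves ∫ r^(γ-1) dr over (0, N), finite because γ > 0; this is the origin of 1/γ,
while 1/2 comes from coalescence. The bound is linear in S, as Gronwall requires. -/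
theorem gain_le_of_kernel_le {f : ℝ → ℝ → ℝ} {φ : ℝ → ℝ} {N C γ S z : ℝ} (hp : IsProb e)
    (hN : 0 < N) (hz : z ∈ Icc 0 N) (hC : 0 ≤ C) (hγ : 0 < γ) (hS : 0 ≤ S)
    (hφ : Integrable φ posMeasure) (hφ0 : ∀ y, 0 < y → 0 ≤ φ y)
    (hf0 : ∀ x y, 0 ≤ x → 0 ≤ y → 0 ≤ f x y)
    (hfN : ∀ x y, 0 ≤ x → 0 ≤ y → N ≤ x + y → f x y = 0)
    (hf : ∀ x y, 0 ≤ x → 0 < y → f x y ≤ C * (x + y) ^ γ * S * φ y) :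
    coagOp e f z + breakOp e f z
      ≤ C * N ^ γ * (∫ y, φ y ∂posMeasure) * (1 / 2 + 1 / γ) * S := by
  set m := ∫ y, φ y ∂posMeasure with hm
  have hm0 : 0 ≤ m := integral_nonneg_of_ae (ae_posMeasure hφ0)
  have key : ∀ (c : ℝ → ℝ → ℝ), (∀ x y, 0 ≤ c x y) → (∀ x y, c x y ≤ 1) → ∀ r, 0 ≤ r →
      ∫ y in (0 : ℝ)..r, c (r - y) y * f (r - y) y ≤ C * r ^ γ * S * m := by
    intro c hc0 hc1 r hr
    refine integral_triangle_le (h := fun x y => c x y * f x y) hr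
      (mul_nonneg (mul_nonneg hC (Real.rpow_nonneg hr _)) hS) hφ hφ0 (fun y hy hyr => ?_)
      (fun y hy hyr => ?_)
    · exact mul_nonneg (hc0 _ _) (hf0 _ _ (sub_nonneg.2 hyr) hy.le)
    · have h1 := hf (r - y) y (sub_nonneg.2 hyr) hy
      rw [sub_add_cancel] at h1
      exact (mul_le_of_le_one_left (hf0 _ _ (sub_nonneg.2 hyr) hy.le) (hc1 _ _)).trans h1
  have h1 : coagOp e f z ≤ 1 / 2 * (C * N ^ γ * S * m) := by
    refine mul_le_mul_of_nonneg_left ((key e hp.nonneg hp.le_one z hz.1).trans ?_) (by norm_num)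
    have := Real.rpow_le_rpow hz.1 hz.2 hγ.le
    gcongr
  set h : ℝ → ℝ := fun r => (Ioc 0 N).indicator (fun r => C * S * m * r ^ (γ - 1)) r with hh
  have hrp : IntegrableOn (fun r : ℝ => C * S * m * r ^ (γ - 1)) (Ioc 0 N) := by
    refine Integrable.const_mul ?_ _
    rw [← IntegrableOn, ← intervalIntegrable_iff_integrableOn_Ioc_of_le hN.le]
    exact intervalIntegral.intervalIntegrable_rpow' (by linarith)
  have hhi : Integrable h posMeasure :=
    ((integrable_indicator_iff measurableSet_Ioc).2 hrp).restrict
  have hh0 : ∀ r, 0 ≤ h r := fun r => indicator_nonneg (fun r hr => by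
    have := Real.rpow_nonneg hr.1.le (γ - 1)
    positivity) r
  have h2 : breakOp e f z ≤ C * S * m * (N ^ γ / γ) := by
    calc breakOp e f z ≤ ∫ r in Ioi z, h r := by
          refine integral_mono_of_nonneg
            (ae_restrict_of_forall_mem measurableSet_Ioi fun r hr =>
              inner_break_nonneg hp hf0 (hz.1.trans (le_of_lt hr)))
            (IntegrableOn.mono_set hhi (Ioi_subset_Ioi hz.1))
            (ae_restrict_of_forall_mem measurableSet_Ioi fun r hr => ?_)
          have hr0 : 0 < r := hz.1.trans_lt hr
          simp only
          rcases le_or_gt r N with hrN | hrN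
          · rw [hh]
            simp only
            rw [indicator_of_mem (show r ∈ Ioc 0 N from ⟨hr0, hrN⟩)]
            have h3 := key (fun x y => 1 - e x y) (fun x y => sub_nonneg.2 (hp.le_one x y))
              (fun x y => by linarith [hp.nonneg x y]) r hr0.le
            refine (mul_le_mul_of_nonneg_left h3 (inv_nonneg.2 hr0.le)).trans (le_of_eq ?_)
            rw [Real.rpow_sub_one hr0.ne']
            field_simp
          · have : ∫ y in (0 : ℝ)..r, (1 - e (r - y) y) * f (r - y) y = ∫ y in (0 : ℝ)..r, (0 : ℝ) := by
              refine intervalIntegral.integral_congr fun y hy => ?_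
              rw [uIcc_of_le hr0.le] at hy
              rw [hfN _ _ (sub_nonneg.2 hy.2) hy.1 (by linarith), mul_zero]
            rw [this]
            simpa using hh0 r
      _ ≤ ∫ r, h r ∂posMeasure :=
          setIntegral_mono_set hhi (ae_of_all _ hh0) (Ioi_subset_Ioi hz.1).eventuallyLE
      _ = C * S * m * (N ^ γ / γ) := by
          rw [hh, integral_indicator measurableSet_Ioc, Measure.restrict_restrict measurableSet_Ioc,
            inter_eq_left.2 Ioc_subset_Ioi_self, integral_const_mul,
            ← intervalIntegral.integral_of_le hN.le, integral_rpow (Or.inl (by linarith))]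
          rw [sub_add_cancel, Real.zero_rpow hγ.ne', sub_zero]
  calc coagOp e f z + breakOp e f z ≤ _ := add_le_add h1 h2
    _ = _ := by ring

/-! ### Solutions for truncated kernels -/

/-- The a priori bounds for the clamped solution do not depend on the clamp level M: the number of
particles does not increase, and the supremum grows at most exponentially at a rate fixed by that
number. So M can be chosen beforehand as the resulting bound. -/
theorem exists_mild_of_truncated {g₀ : ℝ → ℝ} {N T C γ : ℝ} (hN : 0 < N) (hT : 0 ≤ T)
    (he : Continuous (uncurry e)) (hp : IsProb e) (hK : Continuous (uncurry K))
    (hK0 : ∀ x y, 0 ≤ x → 0 ≤ y → 0 ≤ K x y)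
    (hKN : ∀ x y, 0 ≤ x → 0 ≤ y → N ≤ x + y → K x y = 0)
    (hC : 0 ≤ C) (hγ : 0 < γ) (hKC : ∀ x y, 0 ≤ x → 0 ≤ y → K x y ≤ C * (x + y) ^ γ)
    (hg : Continuous g₀) (hg0 : ∀ x, 0 ≤ g₀ x) (hgN : ∀ x, N ≤ x → g₀ x = 0) :
    ∃ g : ℝ → ℝ → ℝ, IsMild e K T g ∧ (∀ z, 0 ≤ z → g z 0 = g₀ z) ∧
      ∀ z, N ≤ z → ∀ t, g z t = 0 := by
  obtain ⟨G, hG⟩ := isCompact_Icc.exists_bound_of_continuousOn (s := Icc 0 N) hg.continuousOn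
  have hG' : ∀ z ∈ Icc 0 N, g₀ z ≤ G := fun z hz => (le_abs_self _).trans (hG z hz)
  have hG0 : 0 ≤ G := (hg0 0).trans (hG' 0 ⟨le_rfl, hN.le⟩)
  set m := ∫ z, g₀ z ∂posMeasure with hm
  have hm0 : 0 ≤ m := integral_nonneg hg0
  set b := C * N ^ γ * m * (1 / 2 + 1 / γ) with hb
  have hb0 : 0 ≤ b := by have := Real.rpow_nonneg hN.le γ; positivity
  set M := 2 * G * Real.exp (2 * b * T) with hM
  have hM0 : 0 ≤ M := by positivity
  obtain ⟨v, hvc, hv0, hvN, hop, hveq⟩ :=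
    exists_clamped_solution hN hT hM0 he hp hK hKN hg hgN
  set f : ℝ → ℝ → ℝ → ℝ := fun s => clampRate K M fun x => v x s with hf
  have hvc' : Continuous fun p : ℝ × ℝ => v p.1 p.2 := hvc
  have hsupp : ∀ s x y, 0 ≤ x → 0 ≤ y → N ≤ x + y → f s x y = 0 := by
    intro s x y hx hy hxy
    simp only [hf, clampRate]
    rw [hKN x y hx hy hxy, zero_mul, zero_mul]
  have hf0 : ∀ s x y, 0 ≤ x → 0 ≤ y → 0 ≤ f s x y := fun s x y hx hy =>
    mul_nonneg (mul_nonneg (hK0 x y hx hy) (clamp_nonneg _ _)) (clamp_nonneg _ _)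
  have htc : ∀ s z, 0 ≤ z → truncOp e (f s) N z = collisionOp e (f s) z := fun s z hz =>
    truncOp_eq_collisionOp hz hN.le (hsupp s)
  have hopc : ContinuousOn (uncurry fun z s => collisionOp e (f s) z) (strip T) :=
    hop.continuousOn.congr fun p hp => (htc p.2 p.1 hp.1).symm
  have hopt : ∀ z, 0 ≤ z → Continuous fun s => collisionOp e (f s) z := by
    intro z hz
    have := hop.comp (f := fun s : ℝ => (z, s)) (by fun_prop)
    refine this.congr fun s => htc s z hz
  -- Where v ≤ 0 the clamped loss vanishes, so the operator is non-negative there and sgn(v) Q ≤ Q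
  -- at all times. Hence |v(t)| ≤ v(0) + ∫ Q = v(t).
  have hvnn : ∀ z, 0 ≤ z → ∀ t ∈ Icc 0 T, 0 ≤ v z t := by
    intro z hz t ht
    have h1 := abs_le_add_integral_sgn (u := fun t => v z t) (hopt z hz).continuousOn
      (hveq z hz) ht
    have h2 := hveq z hz t ht
    have h00 : |v z 0| = v z 0 := abs_of_nonneg (by rw [hv0 z hz]; exact hg0 z)
    have h3 : ∫ s in (0 : ℝ)..t, sgn (v z s) * collisionOp e (f s) z
        ≤ ∫ s in (0 : ℝ)..t, collisionOp e (f s) z := by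
      have hi := (hopt z hz).intervalIntegrable (μ := volume) 0 t
      refine intervalIntegral.integral_mono_on ht.1 ?_ hi fun s _ => ?_
      · have hs : Measurable fun s => sgn (v z s) :=
          measurable_sgn.comp (hvc'.comp (f := fun s : ℝ => (z, s)) (by fun_prop)).measurable
        refine hi.mono_fun (hs.mul (hopt z hz).measurable).aestronglyMeasurable
          (ae_of_all _ fun s => ?_)
        simp only [norm_mul]
        exact mul_le_of_le_one_left (norm_nonneg _) (abs_sgn_le _)
      · rcases lt_or_ge 0 (v z s) with h | h
        · rw [sgn, if_pos h, one_mul]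
        · have hl : lossOp (f s) z = 0 := by
            unfold lossOp
            simp only [hf, clampRate, clamp_of_nonpos h, mul_zero, zero_mul, integral_zero]
          have hq : 0 ≤ collisionOp e (f s) z := by
            rw [collisionOp, hl, sub_zero]
            exact add_nonneg (coagOp_nonneg hp (hf0 s) hz) (breakOp_nonneg hp (hf0 s) hz)
          exact mul_le_of_le_one_left hq ((le_abs_self _).trans (abs_sgn_le _))
    by_contra hneg
    push Not at hneg
    rw [abs_of_neg hneg, h00] at h1
    linarith
  have hKc' : Continuous fun p : ℝ × ℝ => K p.1 p.2 := hK
  have hfm : ∀ s, Measurable (uncurry (f s)) := by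
    intro s
    have hvs : Continuous fun x => v x s := hvc'.comp (f := fun x : ℝ => (x, s)) (by fun_prop)
    exact ((hKc'.mul ((continuous_clamp M).comp (hvs.comp continuous_fst))).mul
      ((continuous_clamp M).comp (hvs.comp continuous_snd))).measurable
  have hg_int : Integrable g₀ posMeasure := by
    have h1 : IntegrableOn g₀ (Icc 0 N) := hg.continuousOn.integrableOn_Icc
    have h2 : IntegrableOn ((Icc 0 N).indicator g₀) (Ioi 0) :=
      ((integrable_indicator_iff measurableSet_Icc).2 h1).integrableOn
    refine h2.congr (ae_posMeasure fun x hx => ?_)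
    by_cases h : x ≤ N
    · rw [indicator_of_mem (show x ∈ Icc 0 N from ⟨hx.le, h⟩)]
    · rw [indicator_of_notMem (fun h' => h h'.2), hgN x (not_le.1 h).le]
  have hnum : ∀ t ∈ Icc 0 T, Integrable (fun z => v z t) posMeasure ∧
      ∫ z, v z t ∂posMeasure ≤ m := by
    intro t ht
    have hfb : ∀ s x y, 0 < x → 0 < y → |f s x y| ≤ C * N ^ γ * M * M := by
      intro s x y hx hy
      have hCN := Real.rpow_nonneg hN.le γ
      rcases le_total N (x + y) with h | h
      · rw [hsupp s x y hx.le hy.le h, abs_zero]; positivity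
      · rw [abs_of_nonneg (hf0 s x y hx.le hy.le)]
        have h1 := hKC x y hx.le hy.le
        have h2 := Real.rpow_le_rpow (add_pos hx hy).le h hγ.le
        have h3 := clamp_le hM0 (v x s)
        have h4 := clamp_le hM0 (v y s)
        have h5 := clamp_nonneg M (v x s)
        have h6 := clamp_nonneg M (v y s)
        have h7 : K x y ≤ C * N ^ γ := h1.trans (mul_le_mul_of_nonneg_left h2 hC)
        exact mul_le_mul (mul_le_mul h7 h3 h5 (by positivity)) h4 h6 (by positivity)
    obtain ⟨D, hD⟩ := exists_uniform_bound_of_support (W := fun _ => 1) (N := N)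
      (B := C * N ^ γ * M * M) (c := 1)
      measurable_const (fun _ _ => zero_le_one) (integrableOn_const (by simp))
      (fun _ _ _ _ => by norm_num) zero_le_one
      (by have := Real.rpow_nonneg hN.le γ; positivity)
    have hDs := fun s => hD (f s) (hfm s) (hfb s) fun x y hx hy => hsupp s x y hx.le hy.le
    have h0 : Integrable (fun z => 1 * v z 0) posMeasure :=
      hg_int.congr (ae_posMeasure fun z hz => by simp only [one_mul, hv0 z hz.le])
    obtain ⟨a1, a2, a3⟩ := moment_equation hp isWeight_one (fun z hz => hveq z hz.le) hopc
      (fun s _ => hfm s) (fun s _ => (hDs s).1) (fun s _ => (hDs s).2.1) (fun s _ => (hDs s).2.2)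
      h0 ht
    simp only [one_mul] at a1 a3
    refine ⟨a1, ?_⟩
    rw [a3, integral_congr_ae (ae_posMeasure fun z hz => hv0 z hz.le)]
    have : ∫ s in (0 : ℝ)..t, ∫ p, weakKernel e (fun _ => 1) p.1 p.2 * f s p.1 p.2 ∂quadMeasure
        ≤ 0 := by
      rw [intervalIntegral.integral_of_le ht.1]
      refine integral_nonpos fun s => ?_
      refine integral_nonpos_of_ae (ae_quadMeasure fun x y hx hy => ?_)
      simp only [weakKernel_one hx hy]
      have := mul_nonneg (hp.nonneg x y) (hf0 s x y hx.le hy.le)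
      simp only [Pi.zero_apply]
      linarith
    linarith
  -- Gronwall for the family indexed by the size z: the loss is dropped, and the gain at each z is
  -- bounded by b times the supremum over all sizes.
  have hsup : ∀ (z : Icc 0 N), ∀ t ∈ Icc 0 T, v z t ≤ 2 * G * Real.exp (2 * b * t) := by
    refine gronwall_family (φ := fun (z : Icc 0 N) t => v z t) hG0 (by positivity)
      (fun t ht => ht.1) ?_ fun S hS hvS z t ht => ?_
    · obtain ⟨B, hB⟩ := (isCompact_Icc.prod isCompact_Icc :
        IsCompact (Icc (0 : ℝ) N ×ˢ Icc (0 : ℝ) T)).exists_bound_of_continuousOn hvc.continuousOn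
      exact ⟨B, fun z t ht => (le_abs_self _).trans (hB (z, t) ⟨z.2, ht⟩)⟩
    · have hgain : ∀ s ∈ Icc 0 T,
          collisionOp e (f s) z ≤ 0 + b * (S * Real.exp (2 * b * s)) := by
        intro s hs
        have hloss : 0 ≤ lossOp (f s) z := by
          refine setIntegral_nonneg measurableSet_Ioi fun y hy => hf0 s z y z.2.1 (le_of_lt hy)
        have hSe : 0 ≤ S * Real.exp (2 * b * s) := by positivity
        have hvx : ∀ x, 0 ≤ x → v x s ≤ S * Real.exp (2 * b * s) := by
          intro x hx
          rcases le_total x N with h | h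
          · exact hvS ⟨x, hx, h⟩ s hs
          · rw [hvN x h]; exact hSe
        have h1 := gain_le_of_kernel_le (f := f s) (φ := fun y => v y s) hp hN z.2 hC hγ hSe
          (hnum s hs).1 (fun y hy => hvnn y hy.le s hs) (hf0 s) (hsupp s) (by
            intro x y hx hy
            have h1 := hKC x y hx hy.le
            have h2 := (clamp_le_self (M := M) (hvnn x hx s hs)).trans (hvx x hx)
            have h3 := clamp_le_self (M := M) (hvnn y hy.le s hs)
            have h4 := hK0 x y hx hy.le
            exact mul_le_mul (mul_le_mul h1 h2 (clamp_nonneg _ _) (h4.trans h1)) h3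
              (clamp_nonneg _ _) (mul_nonneg (h4.trans h1) hSe))
        have h2 : C * N ^ γ * (∫ y, v y s ∂posMeasure) * (1 / 2 + 1 / γ)
            * (S * Real.exp (2 * b * s)) ≤ b * (S * Real.exp (2 * b * s)) := by
          refine mul_le_mul_of_nonneg_right ?_ hSe
          have := (hnum s hs).2
          have := Real.rpow_nonneg hN.le γ
          rw [hb]
          gcongr
        rw [collisionOp]
        linarith
      have h3 := integral_le_of_le_exp (T := T) (a := 0) hS le_rfl ht
        ((hopt z z.2.1).intervalIntegrable _ _) hgain
      rw [hveq z z.2.1 t ht, hv0 z z.2.1]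
      have := hG' z z.2
      linarith
  have hvM : ∀ z, 0 ≤ z → ∀ t ∈ Icc 0 T, v z t ≤ M := by
    intro z hz t ht
    rcases le_total z N with h | h
    · refine (hsup ⟨z, hz, h⟩ t ht).trans ?_
      rw [hM]
      have := ht.2
      gcongr
    · rw [hvN z h]; exact hM0
  set τ : ℝ → ℝ := fun t => max 0 (min t T) with hτ
  have hτm : ∀ t, τ t ∈ Icc 0 T := fun t => ⟨le_max_left _ _, max_le hT (min_le_right _ _)⟩
  have hτe : ∀ t ∈ Icc 0 T, τ t = t := fun t ht => by
    rw [hτ]; simp only; rw [min_eq_left ht.2, max_eq_right ht.1]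
  set g : ℝ → ℝ → ℝ := fun z t => v (max z 0) (τ t) with hg
  have hgv : ∀ z, 0 ≤ z → ∀ t ∈ Icc 0 T, g z t = v z t := fun z hz t ht => by
    rw [hg]; simp only; rw [max_eq_left hz, hτe t ht]
  -- Since 0 ≤ v ≤ M, the clamp acts as the identity.
  have hrate : ∀ s ∈ Icc 0 T, ∀ x y, 0 ≤ x → 0 ≤ y → f s x y = collisionRate K g x y s := by
    intro s hs x y hx hy
    simp only [hf, clampRate, collisionRate]
    rw [clamp_of_mem (hvnn x hx s hs) (hvM x hx s hs), clamp_of_mem (hvnn y hy s hs) (hvM y hy s hs),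
      hgv x hx s hs, hgv y hy s hs]
  have hcop : ∀ s ∈ Icc 0 T, ∀ z, 0 ≤ z →
      collisionOp e (f s) z = collisionOp e (fun x y => collisionRate K g x y s) z :=
    fun s hs z hz => collisionOp_congr hz (fun _ _ _ _ => rfl) (hrate s hs)
  refine ⟨g, ⟨?_, ?_, ?_, ?_⟩, ?_, ?_⟩
  · exact hvc'.comp (f := fun p : ℝ × ℝ => (max p.1 0, τ p.2)) (by fun_prop)
  · exact fun z t => hvnn _ (le_max_right _ _) _ (hτm t)
  · exact hopc.congr fun p hp => (hcop p.2 hp.2 p.1 hp.1).symm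
  · intro z hz t ht
    rw [hgv z hz t ht, hgv z hz 0 ⟨le_rfl, hT⟩, hveq z hz t ht]
    congr 1
    refine intervalIntegral.integral_congr fun s hs => ?_
    rw [uIcc_of_le ht.1] at hs
    exact hcop s ⟨hs.1, hs.2.trans ht.2⟩ z hz
  · intro z hz
    rw [hgv z hz 0 ⟨le_rfl, hT⟩, hv0 z hz]
  · intro z hz t
    rw [hg]
    simp only
    rw [max_eq_left (hN.le.trans hz), hvN z hz]

end

/-! ### A priori moment bounds for compactly supported solutions -/

section

variable {e K : ℝ → ℝ → ℝ} {ψ W : ℝ → ℝ}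

/-! ### Power weights -/

theorem rpow_le_rpow_add_rpow {y a r b : ℝ} (hy : 0 < y) (ha : a ≤ r) (hb : r ≤ b) :
    y ^ r ≤ y ^ a + y ^ b := by
  have h1 := Real.rpow_nonneg hy.le a
  have h2 := Real.rpow_nonneg hy.le b
  rcases le_total y 1 with h | h
  · have := Real.rpow_le_rpow_of_exponent_ge hy h ha
    linarith
  · have := Real.rpow_le_rpow_of_exponent_le h hb
    linarith

/-- The larger size is at least half of the sum, and 8 = 2³; for negative exponents the power is
decreasing. -/
theorem add_rpow_le_eight {x y r : ℝ} (hx : 0 < x) (hy : 0 < y) (hr : r ≤ 3) :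
    (x + y) ^ r ≤ 8 * (x ^ r + y ^ r) := by
  have h1 := Real.rpow_nonneg hx.le r
  have h2 := Real.rpow_nonneg hy.le r
  rcases le_total r 0 with h0 | h0
  · have := Real.rpow_le_rpow_of_nonpos hx (by linarith : x ≤ x + y) h0
    linarith
  · have h8 : (2 : ℝ) ^ r ≤ 8 := by
      calc (2 : ℝ) ^ r ≤ 2 ^ (3 : ℝ) := Real.rpow_le_rpow_of_exponent_le (by norm_num) hr
        _ = 8 := by norm_num
    have key : ∀ a b : ℝ, 0 < a → 0 < b → a ≤ b → (a + b) ^ r ≤ 8 * b ^ r := by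
      intro a b ha hb hab
      calc (a + b) ^ r ≤ (2 * b) ^ r := Real.rpow_le_rpow (by linarith) (by linarith) h0
        _ = 2 ^ r * b ^ r := Real.mul_rpow (by norm_num) hb.le
        _ ≤ 8 * b ^ r := mul_le_mul_of_nonneg_right h8 (Real.rpow_nonneg hb.le r)
    rcases le_total x y with h | h
    · have := key x y hx hy h
      linarith
    · have := key y x hy hx h
      rw [add_comm] at this
      linarith

theorem integral_rpow_zero {r R : ℝ} (hr : -1 < r) :
    ∫ z in (0 : ℝ)..R, z ^ r = R ^ (r + 1) / (r + 1) := by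
  rw [integral_rpow (Or.inl hr), Real.zero_rpow (by linarith), sub_zero]

theorem isWeight_rpow {r : ℝ} (hr : -1 < r) :
    IsWeight (fun z => z ^ r) (fun z => (1 + 1 / (r + 1)) * z ^ r) where
  measurable := by fun_prop
  measurable_weight := by fun_prop
  pos := fun x hx => by
    have := Real.rpow_pos_of_pos hx r
    have : 0 < 1 / (r + 1) := one_div_pos.2 (by linarith)
    positivity
  le := fun x hx => by
    have h1 := Real.rpow_pos_of_pos hx r
    have : 0 < 1 / (r + 1) := one_div_pos.2 (by linarith)
    rw [abs_of_pos h1]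
    nlinarith
  intervalIntegrable := fun _ _ => intervalIntegral.intervalIntegrable_rpow' hr
  average_le := fun R hR => by
    have h1 : ∫ z in (0 : ℝ)..R, |z ^ r| = ∫ z in (0 : ℝ)..R, z ^ r := by
      refine intervalIntegral.integral_congr fun z hz => ?_
      rw [uIcc_of_le hR.le] at hz
      exact abs_of_nonneg (Real.rpow_nonneg hz.1 r)
    rw [h1, integral_rpow_zero hr, Real.rpow_add_one hR.ne']
    have h2 := Real.rpow_pos_of_pos hR r
    have : R ^ r * R / (r + 1) = R * (1 / (r + 1) * R ^ r) := by ring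
    rw [this]
    refine mul_le_mul_of_nonneg_left ?_ hR.le
    linarith

theorem weakKernel_rpow {r x y : ℝ} (hr : -1 < r) (hx : 0 < x) (hy : 0 < y) :
    weakKernel e (fun z => z ^ r) x y
      = (1 / 2 * e x y + (1 - e x y) / (r + 1)) * (x + y) ^ r - x ^ r := by
  have h := (add_pos hx hy).ne'
  rw [weakKernel, integral_rpow_zero hr, Real.rpow_add_one h]
  field_simp

/-! ### Moments of compactly supported solutions -/

/-- A mild solution with sizes in `[0, N]` and a symmetric kernel dominated by `Φ`. -/
structure IsCompactMild (e K Φ : ℝ → ℝ → ℝ) (N T : ℝ) (g : ℝ → ℝ → ℝ) : Prop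
    extends IsMild e K T g where
  continuous_kernel : Continuous (uncurry K)
  kernel_nonneg : ∀ x y, 0 ≤ x → 0 ≤ y → 0 ≤ K x y
  kernel_le : ∀ x y, 0 ≤ x → 0 ≤ y → K x y ≤ Φ x y
  kernel_symm : ∀ x y, 0 ≤ x → 0 ≤ y → K x y = K y x
  eq_zero : ∀ z, N ≤ z → ∀ t, g z t = 0

variable {Φ : ℝ → ℝ → ℝ} {N T : ℝ} {g : ℝ → ℝ → ℝ}

theorem IsMild.continuous_section (hg : IsMild e K T g) (t : ℝ) : Continuous fun z => g z t :=
  hg.continuous.comp (f := fun z : ℝ => (z, t)) (by fun_prop)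

theorem IsMild.continuous_rate (hg : IsMild e K T g) (hK : Continuous (uncurry K)) (t : ℝ) :
    Continuous (uncurry fun x y => collisionRate K g x y t) := by
  have hK' : Continuous fun p : ℝ × ℝ => K p.1 p.2 := hK
  exact (hK'.mul ((hg.continuous_section t).comp continuous_fst)).mul
    ((hg.continuous_section t).comp continuous_snd)

theorem IsCompactMild.exists_bound (hg : IsCompactMild e K Φ N T g) :
    ∃ B, 0 ≤ B ∧ ∀ z, 0 < z → ∀ t ∈ Icc 0 T, g z t ≤ (Ioc 0 N).indicator (fun _ => B) z := by
  obtain ⟨B, hB⟩ := (isCompact_Icc.prod isCompact_Icc :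
    IsCompact (Icc (0 : ℝ) N ×ˢ Icc (0 : ℝ) T)).exists_bound_of_continuousOn
      hg.continuous.continuousOn
  refine ⟨max B 0, le_max_right _ _, fun z hz t ht => ?_⟩
  by_cases h : z ≤ N
  · rw [indicator_of_mem (show z ∈ Ioc 0 N from ⟨hz, h⟩)]
    exact ((le_abs_self _).trans (hB (z, t) ⟨⟨hz.le, h⟩, ht⟩)).trans (le_max_left _ _)
  · rw [hg.eq_zero z (not_le.1 h).le, indicator_of_notMem (fun h' => h h'.2)]

theorem IsCompactMild.exists_moment_bound (hg : IsCompactMild e K Φ N T g) (hψ : Measurable ψ)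
    (hψ0 : ∀ x, 0 < x → 0 ≤ ψ x) (hψi : IntegrableOn ψ (Ioc 0 N)) :
    ∃ D, ∀ t ∈ Icc 0 T, Integrable (fun z => ψ z * g z t) posMeasure ∧
      ∫ z, ψ z * g z t ∂posMeasure ≤ D := by
  obtain ⟨B, hB0, hB⟩ := hg.exists_bound
  have hGi : Integrable ((Ioc 0 N).indicator fun z => ψ z * B) posMeasure :=
    ((integrable_indicator_iff measurableSet_Ioc).2 (hψi.mul_const B)).restrict
  have hle : ∀ t ∈ Icc 0 T, ∀ z, 0 < z → ψ z * g z t ≤ (Ioc 0 N).indicator (fun z => ψ z * B) z := by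
    intro t ht z hz
    refine (mul_le_mul_of_nonneg_left (hB z hz t ht) (hψ0 z hz)).trans (le_of_eq ?_)
    by_cases h : z ∈ Ioc 0 N
    · rw [indicator_of_mem h, indicator_of_mem h]
    · rw [indicator_of_notMem h, indicator_of_notMem h, mul_zero]
  refine ⟨∫ z, (Ioc 0 N).indicator (fun z => ψ z * B) z ∂posMeasure, fun t ht => ?_⟩
  have hnn : ∀ z, 0 < z → 0 ≤ ψ z * g z t := fun z hz => mul_nonneg (hψ0 z hz) (hg.nonneg z t)
  constructor
  · refine hGi.mono' (hψ.mul (hg.continuous_section t).measurable).aestronglyMeasurable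
      (ae_posMeasure fun z hz => ?_)
    rw [Real.norm_of_nonneg (hnn z hz)]
    exact hle t ht z hz
  · exact integral_mono_of_nonneg (ae_posMeasure hnn) hGi (ae_posMeasure (hle t ht))

/-- Both sizes of a colliding pair are at most N, so the pair density vanishes once x + y ≥ 2N and
is bounded uniformly in time; `exists_uniform_bound_of_support` then supplies what `moment_equation`
needs. -/
theorem IsCompactMild.moment_eq (hg : IsCompactMild e K Φ N T g) (he : IsProb e) (hT : 0 ≤ T)
    (hw : IsWeight ψ W) (hψ0 : ∀ x, 0 < x → 0 ≤ ψ x) {c : ℝ} (hc0 : 0 ≤ c)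
    (hc : ∀ x y, 0 < x → 0 < y → W (x + y) ≤ c * (W x + W y))
    (hWi : ∀ R, IntegrableOn W (Ioc 0 R)) {t : ℝ} (ht : t ∈ Icc 0 T) :
    IntervalIntegrable (fun s => ∫ p, weakKernel e ψ p.1 p.2 * collisionRate K g p.1 p.2 s
        ∂quadMeasure) volume 0 t ∧
      (∀ s ∈ Icc 0 T, Integrable (fun p : ℝ × ℝ => weakKernel e ψ p.1 p.2 *
        collisionRate K g p.1 p.2 s) quadMeasure) ∧
      (∀ s ∈ Icc 0 T, Integrable (fun p : ℝ × ℝ => W (p.1 + p.2) *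
        collisionRate K g p.1 p.2 s) quadMeasure) ∧
      (∀ s ∈ Icc 0 T, Integrable (fun p : ℝ × ℝ => W p.1 *
        collisionRate K g p.1 p.2 s) quadMeasure) ∧
      ∫ z, ψ z * g z t ∂posMeasure = ∫ z, ψ z * g z 0 ∂posMeasure
        + ∫ s in (0 : ℝ)..t, ∫ p, weakKernel e ψ p.1 p.2 * collisionRate K g p.1 p.2 s
          ∂quadMeasure := by
  obtain ⟨B, hB0, hB⟩ := hg.exists_bound
  obtain ⟨k, hk⟩ := (isCompact_Icc.prod isCompact_Icc :
    IsCompact (Icc (0 : ℝ) N ×ˢ Icc (0 : ℝ) N)).exists_bound_of_continuousOn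
      hg.continuous_kernel.continuousOn
  have hfm : ∀ s, Measurable (uncurry fun x y => collisionRate K g x y s) := fun s =>
    (hg.continuous_rate hg.continuous_kernel s).measurable
  have hfN : ∀ s x y, 0 < x → 0 < y → N + N ≤ x + y → collisionRate K g x y s = 0 := by
    intro s x y _ _ hxy
    rcases le_total N x with h | h
    · rw [collisionRate, hg.eq_zero x h, mul_zero, zero_mul]
    · rw [collisionRate, hg.eq_zero y (by linarith), mul_zero]
  have hfB : ∀ s ∈ Icc 0 T, ∀ x y, 0 < x → 0 < y → |collisionRate K g x y s| ≤ |k| * B * B := by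
    intro s hs x y hx hy
    have hx' := hB x hx s hs
    have hy' := hB y hy s hs
    rw [collisionRate]
    by_cases h : x ∈ Ioc 0 N ∧ y ∈ Ioc 0 N
    · rw [indicator_of_mem h.1] at hx'
      rw [indicator_of_mem h.2] at hy'
      rw [abs_mul, abs_mul, abs_of_nonneg (hg.nonneg x s), abs_of_nonneg (hg.nonneg y s)]
      have h1 : |K x y| ≤ |k| :=
        (hk (x, y) ⟨⟨hx.le, h.1.2⟩, ⟨hy.le, h.2.2⟩⟩).trans (le_abs_self k)
      exact mul_le_mul (mul_le_mul h1 hx' (hg.nonneg _ _) (abs_nonneg _)) hy' (hg.nonneg _ _)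
        (by positivity)
    · have h0 : g x s = 0 ∨ g y s = 0 := by
        by_contra hne
        rw [not_or] at hne
        exact h ⟨⟨hx, le_of_not_ge fun h' => hne.1 (hg.eq_zero x h' s)⟩,
          ⟨hy, le_of_not_ge fun h' => hne.2 (hg.eq_zero y h' s)⟩⟩
      have : K x y * g x s * g y s = 0 := by rcases h0 with h0 | h0 <;> simp [h0]
      rw [this, abs_zero]
      positivity
  obtain ⟨D, hD⟩ := exists_uniform_bound_of_support (B := |k| * B * B) (N := N + N)
    hw.measurable_weight
    (fun x hx => (hw.pos x hx).le) (hWi _) hc hc0 (by positivity)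
  have hDs := fun s hs => hD _ (hfm s) (hfB s hs) (hfN s)
  have hψi : IntegrableOn ψ (Ioc 0 N) := by
    refine Integrable.mono' (hWi N) hw.measurable.aestronglyMeasurable
      (ae_restrict_of_forall_mem measurableSet_Ioc fun x hx => hw.le x hx.1)
  obtain ⟨D', hD'⟩ := hg.exists_moment_bound hw.measurable hψ0 hψi
  obtain ⟨a1, a2, a3⟩ := moment_equation he hw (fun z hz => hg.eq_add_integral z hz.le)
    hg.continuousOn_op (fun s _ => hfm s) (fun s hs => (hDs s hs).1) (fun s hs => (hDs s hs).2.1)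
    (fun s hs => (hDs s hs).2.2) (hD' 0 ⟨le_rfl, hT⟩).1 ht
  exact ⟨a2, fun s hs => (collision_weak he (hfm s) hw (hDs s hs).1 (hDs s hs).2.1).2.1,
    fun s hs => (hDs s hs).2.1, fun s hs => (hDs s hs).1, a3⟩

theorem IsCompactMild.rate_nonneg (hg : IsCompactMild e K Φ N T g) {x y : ℝ} (hx : 0 ≤ x)
    (hy : 0 ≤ y) (s : ℝ) : 0 ≤ collisionRate K g x y s :=
  mul_nonneg (mul_nonneg (hg.kernel_nonneg x y hx hy) (hg.nonneg _ _)) (hg.nonneg _ _)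

theorem IsCompactMild.rate_symm (hg : IsCompactMild e K Φ N T g) {x y : ℝ} (hx : 0 ≤ x)
    (hy : 0 ≤ y) (s : ℝ) : collisionRate K g x y s = collisionRate K g y x s := by
  rw [collisionRate, collisionRate, hg.kernel_symm x y hx hy]
  ring

theorem IsCompactMild.integrable_moment (hg : IsCompactMild e K Φ N T g) {r : ℝ} (hr : -1 < r)
    {t : ℝ} (ht : t ∈ Icc 0 T) : Integrable (fun z => z ^ r * g z t) posMeasure := by
  obtain ⟨D, hD⟩ := hg.exists_moment_bound (ψ := fun z => z ^ r) (by fun_prop)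
    (fun x hx => Real.rpow_nonneg hx.le r)
    (intervalIntegral.intervalIntegrable_rpow' hr).1
  exact (hD t ht).1

theorem IsCompactMild.integrable (hg : IsCompactMild e K Φ N T g)
    {t : ℝ} (ht : t ∈ Icc 0 T) : Integrable (fun z => g z t) posMeasure := by
  simpa using hg.integrable_moment (r := 0) (by norm_num) ht

/-- A coalescence removes one particle, and a breakage event returns two fragments for two colliding
particles: the weak kernel of ψ = 1 is -e/2 ≤ 0. -/
theorem IsCompactMild.integral_le (hg : IsCompactMild e K Φ N T g) (he : IsProb e) (hT : 0 ≤ T)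
    {t : ℝ} (ht : t ∈ Icc 0 T) : ∫ z, g z t ∂posMeasure ≤ ∫ z, g z 0 ∂posMeasure := by
  obtain ⟨-, -, -, -, h⟩ := hg.moment_eq he hT isWeight_one (fun _ _ => zero_le_one) (c := 1)
    zero_le_one (fun _ _ _ _ => by norm_num) (fun R => integrableOn_const (by simp)) ht
  simp only [one_mul] at h
  rw [h]
  have : ∫ s in (0 : ℝ)..t, ∫ p, weakKernel e (fun _ => 1) p.1 p.2 * collisionRate K g p.1 p.2 s
      ∂quadMeasure ≤ 0 := by
    rw [intervalIntegral.integral_of_le ht.1]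
    refine integral_nonpos fun s => ?_
    refine integral_nonpos_of_ae (ae_quadMeasure fun x y hx hy => ?_)
    simp only [weakKernel_one hx hy]
    have := mul_nonneg (he.nonneg x y) (hg.rate_nonneg hx.le hy.le s)
    simp only [Pi.zero_apply]
    linarith
  linarith

theorem integral_antisymm_eq_zero {F : ℝ → ℝ → ℝ} (hF : ∀ x y, 0 < x → 0 < y → F y x = -F x y) :
    ∫ p, F p.1 p.2 ∂quadMeasure = 0 := by
  have h1 := integral_swap_quad F
  have h2 : ∫ p, F p.2 p.1 ∂quadMeasure = ∫ p, -F p.1 p.2 ∂quadMeasure :=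
    integral_congr_ae (ae_quadMeasure fun x y hx hy => hF x y hx hy)
  rw [integral_neg] at h2
  linarith

/-- For ψ = z the weak kernel is (y - x)/2, whatever the efficiency; it is antisymmetric and the
pair density is symmetric. -/
theorem IsCompactMild.integral_mul_self_eq (hg : IsCompactMild e K Φ N T g) (he : IsProb e)
    (hT : 0 ≤ T) {t : ℝ} (ht : t ∈ Icc 0 T) :
    ∫ z, z * g z t ∂posMeasure = ∫ z, z * g z 0 ∂posMeasure := by
  obtain ⟨-, -, -, -, h⟩ := hg.moment_eq he hT (isWeight_rpow (r := 1) (by norm_num))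
    (fun x hx => Real.rpow_nonneg hx.le 1) (c := 1)
    zero_le_one (fun x y _ _ => by simp only [Real.rpow_one]; linarith)
    (fun R => ((intervalIntegral.intervalIntegrable_rpow' (by norm_num)).1.const_mul _)) ht
  simp only [Real.rpow_one] at h
  rw [h, add_eq_left]
  have : ∀ s, ∫ p, weakKernel e (fun z => z) p.1 p.2 * collisionRate K g p.1 p.2 s
      ∂quadMeasure = 0 := by
    intro s
    refine integral_antisymm_eq_zero (F := fun x y => weakKernel e (fun z => z) x y *
      collisionRate K g x y s) fun x y hx hy => ?_
    have h1 : ∀ x y, 0 < x → 0 < y → weakKernel e (fun z => z) x y = (y - x) / 2 := by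
      intro x y hx hy
      have := weakKernel_rpow (e := e) (r := 1) (by norm_num) hx hy
      simp only [Real.rpow_one] at this
      rw [this]
      ring
    simp only [h1 x y hx hy, h1 y x hy hx, hg.rate_symm hy.le hx.le s]
    ring
  simp [this]

/-- Under `hker`, the production of the r-th moment is at most D (number + r-th moment)(number +
mass). Number and mass are controlled by their initial values, so the inequality is linear in the
r-th moment. The constants do not see N. -/
theorem IsCompactMild.moment_growth (hg : IsCompactMild e K Φ N T g) (he : IsProb e) (hT : 0 ≤ T)
    {r D m₀ m₁ : ℝ} (hr : -1 < r) (hr3 : r ≤ 3) (hD : 0 ≤ D)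
    (hker : ∀ x y, 0 < x → 0 < y → (weakKernel e (fun z => z ^ r) x y
      + weakKernel e (fun z => z ^ r) y x) * K x y
        ≤ D * ((1 + x ^ r) * (1 + y) + (1 + y ^ r) * (1 + x)))
    (hm₀ : ∫ z, g z 0 ∂posMeasure ≤ m₀) (hm₁ : ∫ z, z * g z 0 ∂posMeasure ≤ m₁)
    {t : ℝ} (ht : t ∈ Icc 0 T) :
    ∫ z, z ^ r * g z t ∂posMeasure
      ≤ 2 * (∫ z, z ^ r * g z 0 ∂posMeasure + T * (D * (m₀ + m₁) * m₀))
        * Real.exp (2 * (D * (m₀ + m₁)) * t) := by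
  have hψ0 : ∀ x : ℝ, 0 < x → 0 ≤ x ^ r := fun x hx => Real.rpow_nonneg hx.le r
  have hm₀0 : 0 ≤ m₀ := (integral_nonneg fun z => hg.nonneg z 0).trans hm₀
  have hm₁0 : 0 ≤ m₁ := (integral_nonneg_of_ae (ae_posMeasure fun z hz =>
    mul_nonneg hz.le (hg.nonneg z 0))).trans hm₁
  have hmom0 : ∀ s, 0 ≤ ∫ z, z ^ r * g z s ∂posMeasure := fun s =>
    integral_nonneg_of_ae (ae_posMeasure fun z hz => mul_nonneg (hψ0 z hz) (hg.nonneg z s))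
  have hb0 : 0 ≤ D * (m₀ + m₁) := by positivity
  have heq := fun t ht => hg.moment_eq (t := t) he hT (isWeight_rpow hr) hψ0 (c := 8) (by norm_num)
    (fun x y hx hy => by
      have h1 := add_rpow_le_eight hx hy hr3
      have h2 : 0 ≤ 1 + 1 / (r + 1) := by
        have : 0 < 1 / (r + 1) := one_div_pos.2 (by linarith)
        linarith
      have := mul_le_mul_of_nonneg_left h1 h2
      linarith)
    (fun R => (intervalIntegral.intervalIntegrable_rpow' hr).1.const_mul _) ht
  have hrhs : ∀ s ∈ Icc 0 T, ∫ p, weakKernel e (fun z => z ^ r) p.1 p.2 *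
      collisionRate K g p.1 p.2 s ∂quadMeasure
      ≤ D * (m₀ + m₁) * (m₀ + ∫ z, z ^ r * g z s ∂posMeasure) := by
    intro s hs
    obtain ⟨-, hwi, -, -, -⟩ := heq s hs
    have hi := hwi s hs
    have hi' : Integrable (fun p : ℝ × ℝ => weakKernel e (fun z => z ^ r) p.2 p.1 *
      collisionRate K g p.2 p.1 s) quadMeasure :=
      (integrable_swap_quad (F := fun x y => weakKernel e (fun z => z ^ r) x y *
        collisionRate K g x y s)).2 hi
    have hsw := integral_swap_quad (F := fun x y => weakKernel e (fun z => z ^ r) x y *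
        collisionRate K g x y s)
    have i0 := hg.integrable hs
    have i1 : Integrable (fun z => z * g z s) posMeasure := by
      simpa using hg.integrable_moment (r := 1) (by norm_num) hs
    have ir := hg.integrable_moment hr hs
    have j1 : Integrable (fun z => (1 + z ^ r) * g z s) posMeasure :=
      (i0.add ir).congr (ae_of_all _ fun z => by simp only [Pi.add_apply]; ring)
    have j2 : Integrable (fun z => (1 + z) * g z s) posMeasure :=
      (i0.add i1).congr (ae_of_all _ fun z => by simp only [Pi.add_apply]; ring)
    have hP := j1.mul_prod j2
    have hP' : Integrable (fun p : ℝ × ℝ => (1 + p.2 ^ r) * g p.2 s * ((1 + p.1) * g p.1 s))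
      quadMeasure := (integrable_swap_quad (F := fun x y =>
        (1 + x ^ r) * g x s * ((1 + y) * g y s))).2 hP
    have hPe : ∫ p : ℝ × ℝ, (1 + p.1 ^ r) * g p.1 s * ((1 + p.2) * g p.2 s) ∂quadMeasure
        = (∫ z, (1 + z ^ r) * g z s ∂posMeasure) * ∫ z, (1 + z) * g z s ∂posMeasure :=
      integral_prod_mul (fun z => (1 + z ^ r) * g z s) fun z => (1 + z) * g z s
    have hPs := integral_swap_quad (F := fun x y => (1 + x ^ r) * g x s * ((1 + y) * g y s))
    have hmain : ∫ p, (weakKernel e (fun z => z ^ r) p.1 p.2 * collisionRate K g p.1 p.2 s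
        + weakKernel e (fun z => z ^ r) p.2 p.1 * collisionRate K g p.2 p.1 s) ∂quadMeasure
        ≤ ∫ p, D * ((1 + p.1 ^ r) * g p.1 s * ((1 + p.2) * g p.2 s)
          + (1 + p.2 ^ r) * g p.2 s * ((1 + p.1) * g p.1 s)) ∂quadMeasure := by
      refine integral_mono_ae (hi.add hi') ((hP.add hP').const_mul D)
        (ae_quadMeasure fun x y hx hy => ?_)
      have h1 := mul_le_mul_of_nonneg_right (hker x y hx hy)
        (mul_nonneg (hg.nonneg x s) (hg.nonneg y s))
      simp only [hg.rate_symm hy.le hx.le s]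
      simp only [collisionRate]
      nlinarith
    rw [integral_add hi hi', hsw, integral_const_mul, integral_add hP hP', hPs, hPe] at hmain
    have e1 : ∫ z, (1 + z ^ r) * g z s ∂posMeasure
        ≤ m₀ + ∫ z, z ^ r * g z s ∂posMeasure := by
      have : ∫ z, (1 + z ^ r) * g z s ∂posMeasure
          = ∫ z, g z s ∂posMeasure + ∫ z, z ^ r * g z s ∂posMeasure := by
        rw [← integral_add i0 ir]
        exact integral_congr_ae (ae_of_all _ fun z => by simp only; ring)
      have := (hg.integral_le he hT hs).trans hm₀
      linarith
    have e2 : ∫ z, (1 + z) * g z s ∂posMeasure ≤ m₀ + m₁ := by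
      have : ∫ z, (1 + z) * g z s ∂posMeasure
          = ∫ z, g z s ∂posMeasure + ∫ z, z * g z s ∂posMeasure := by
        rw [← integral_add i0 i1]
        exact integral_congr_ae (ae_of_all _ fun z => by simp only; ring)
      have := (hg.integral_le he hT hs).trans hm₀
      have := hg.integral_mul_self_eq he hT hs
      linarith
    have e3 : 0 ≤ ∫ z, (1 + z) * g z s ∂posMeasure :=
      integral_nonneg_of_ae (ae_posMeasure fun z hz =>
        mul_nonneg (by linarith) (hg.nonneg z s))
    have e4 := mul_le_mul e1 e2 e3 (add_nonneg hm₀0 (hmom0 s))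
    have e5 := mul_le_mul_of_nonneg_left e4 hD
    nlinarith
  refine gronwall_family (ι := Unit) (φ := fun _ t => ∫ z, z ^ r * g z t ∂posMeasure)
    (I := Icc 0 T) (add_nonneg (hmom0 0) (mul_nonneg hT (mul_nonneg hb0 hm₀0)))
    (mul_nonneg zero_le_two hb0) (fun t ht => ht.1) ?_ ?_ () t ht
  · obtain ⟨D', hD'⟩ := hg.exists_moment_bound (ψ := fun z => z ^ r) (by fun_prop) hψ0
      (intervalIntegral.intervalIntegrable_rpow' hr).1
    exact ⟨D', fun _ t ht => (hD' t ht).2⟩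
  · intro S hS hφ _ t ht
    obtain ⟨h1, -, -, -, h2⟩ := heq t ht
    rw [h2, add_assoc]
    refine add_le_add le_rfl (integral_le_of_le_exp hS (mul_nonneg hb0 hm₀0) ht h1 fun s hs => ?_)
    have h3 := mul_le_mul_of_nonneg_left (hφ () s hs) hb0
    have h4 := hrhs s hs
    linarith

end

/-! ### Profiles with a bounded weighted moment, and the L¹ dissipation estimate -/

section

variable {e K K₁ K₂ Φ : ℝ → ℝ → ℝ} {ω : ℝ → ℝ} {C A B : ℝ} {g h : ℝ → ℝ}

/-! ### Kernels dominated by a weight -/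

/-- Bounds for a collision kernel `Φ` in terms of the weights `1 + x` and `ω`. -/
structure IsDominated (Φ : ℝ → ℝ → ℝ) (ω : ℝ → ℝ) (C : ℝ) : Prop where
  const_nonneg : 0 ≤ C
  weight_nonneg : ∀ x, 0 < x → 0 ≤ ω x
  le_weight : ∀ x, 0 < x → 1 + x ≤ C * ω x
  mul_le : ∀ x y, 0 < x → 0 < y → Φ x y * ((1 + x) * (1 + y)) ≤ C * (ω x * ω y)
  mul_right_le : ∀ x y, 0 ≤ x → 0 < y → Φ x y * (1 + y) ≤ C * ((1 + x) * ω y)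
  le_add_mul : ∀ x y, 0 < x → 0 < y → Φ x y ≤ C * ((x + y) * ((1 + x) * ω y))
  le_mul : ∀ x y, 0 ≤ x → 0 ≤ y → Φ x y ≤ C * ((1 + x) * (1 + y))

/-- A continuous symmetric kernel between `0` and `Φ`. -/
structure IsSubkernel (K Φ : ℝ → ℝ → ℝ) : Prop where
  continuous : Continuous (uncurry K)
  nonneg : ∀ x y, 0 ≤ x → 0 ≤ y → 0 ≤ K x y
  le : ∀ x y, 0 ≤ x → 0 ≤ y → K x y ≤ Φ x y
  symm : ∀ x y, 0 ≤ x → 0 ≤ y → K x y = K y x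

/-- A continuous non-negative density whose `ω`-moment is at most `A`. -/
structure IsProfile (ω : ℝ → ℝ) (A : ℝ) (g : ℝ → ℝ) : Prop where
  continuous : Continuous g
  nonneg : ∀ x, 0 ≤ g x
  integrable : Integrable (fun z => ω z * g z) posMeasure
  integral_le : ∫ z, ω z * g z ∂posMeasure ≤ A

/-- The pair density of a profile. -/
def pairRate (K : ℝ → ℝ → ℝ) (g : ℝ → ℝ) (x y : ℝ) : ℝ := K x y * g x * g y

/-- The weighted distance of two profiles. -/
def profileDist (g h : ℝ → ℝ) : ℝ := ∫ z, (1 + z) * |g z - h z| ∂posMeasure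

theorem profileDist_nonneg (g h : ℝ → ℝ) : 0 ≤ profileDist g h :=
  integral_nonneg_of_ae (ae_posMeasure fun z hz => mul_nonneg (by linarith) (abs_nonneg _))

theorem IsProfile.const_nonneg (hΦ : IsDominated Φ ω C) (hg : IsProfile ω A g) : 0 ≤ A :=
  (integral_nonneg_of_ae (ae_posMeasure fun z hz =>
    mul_nonneg (hΦ.weight_nonneg z hz) (hg.nonneg z))).trans hg.integral_le

theorem IsProfile.add (hg : IsProfile ω A g) (hh : IsProfile ω B h) :
    IsProfile ω (A + B) (fun z => g z + h z) where
  continuous := hg.continuous.add hh.continuous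
  nonneg := fun x => add_nonneg (hg.nonneg x) (hh.nonneg x)
  integrable := (hg.integrable.add hh.integrable).congr
    (ae_of_all _ fun z => by simp only [Pi.add_apply]; ring)
  integral_le := by
    have : ∫ z, ω z * (g z + h z) ∂posMeasure
        = ∫ z, ω z * g z ∂posMeasure + ∫ z, ω z * h z ∂posMeasure := by
      rw [← integral_add hg.integrable hh.integrable]
      exact integral_congr_ae (ae_of_all _ fun z => by simp only; ring)
    rw [this]
    exact add_le_add hg.integral_le hh.integral_le

theorem integrable_of_le_profile {φ : ℝ → ℝ} {c : ℝ} (hg : IsProfile ω A g)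
    (hφ : AEStronglyMeasurable φ posMeasure) (hle : ∀ z, 0 < z → |φ z| ≤ c * (ω z * g z)) :
    Integrable φ posMeasure :=
  (hg.integrable.const_mul c).mono' hφ (ae_posMeasure hle)

theorem integrable_of_le_profile_prod {F : ℝ → ℝ → ℝ} {c : ℝ} (hg : IsProfile ω A g)
    (hh : IsProfile ω B h) (hF : Measurable (uncurry F))
    (hle : ∀ x y, 0 < x → 0 < y → |F x y| ≤ c * (ω x * g x * (ω y * h y))) :
    Integrable (fun p : ℝ × ℝ => F p.1 p.2) quadMeasure := by
  have h1 : Integrable (fun p : ℝ × ℝ => ω p.1 * g p.1 * (ω p.2 * h p.2)) quadMeasure :=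
    hg.integrable.mul_prod hh.integrable
  exact (h1.const_mul c).mono' hF.aestronglyMeasurable (ae_quadMeasure hle)

/-- The mean of 1 + z over [0, r] is 1 + r/2 ≤ 1 + r, so the weight controls the averages as well.
-/
theorem isWeight_mul_sgn {u : ℝ → ℝ} (hu : Measurable u) :
    IsWeight (fun z => (1 + z) * sgn (u z)) (fun z => 1 + z) where
  measurable := (measurable_const.add measurable_id).mul (measurable_sgn.comp hu)
  measurable_weight := measurable_const.add measurable_id
  pos := fun x hx => by linarith
  le := fun x hx => by
    rw [abs_mul, abs_of_pos (by linarith : 0 < 1 + x)]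
    exact mul_le_of_le_one_right (by linarith) (abs_sgn_le _)
  intervalIntegrable := fun r hr => by
    have h1 : IntervalIntegrable (fun z : ℝ => 1 + z) volume 0 r :=
      Continuous.intervalIntegrable (by fun_prop) _ _
    refine h1.mono_fun ((measurable_const.add measurable_id).mul
      (measurable_sgn.comp hu)).aestronglyMeasurable (ae_of_all _ fun z => ?_)
    simp only [norm_mul]
    exact mul_le_of_le_one_right (norm_nonneg _) (abs_sgn_le _)
  average_le := fun r hr => by
    have h1 : IntervalIntegrable (fun z : ℝ => 1 + z) volume 0 r :=
      Continuous.intervalIntegrable (by fun_prop) _ _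
    have h2 : IntervalIntegrable (fun z => |(1 + z) * sgn (u z)|) volume 0 r := by
      refine h1.mono_fun (((measurable_const.add measurable_id).mul
        (measurable_sgn.comp hu)).norm).aestronglyMeasurable (ae_of_all _ fun z => ?_)
      simp only [abs_mul, norm_mul, Real.norm_eq_abs, abs_abs]
      exact mul_le_of_le_one_right (abs_nonneg _) (abs_sgn_le _)
    calc ∫ z in (0 : ℝ)..r, |(1 + z) * sgn (u z)| ≤ ∫ z in (0 : ℝ)..r, (1 + z) := by
          refine intervalIntegral.integral_mono_on hr.le h2 h1 fun z hz => ?_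
          rw [abs_mul, abs_of_nonneg (by linarith [hz.1] : 0 ≤ 1 + z)]
          exact mul_le_of_le_one_right (by linarith [hz.1]) (abs_sgn_le _)
      _ = r + r ^ 2 / 2 := by
          rw [intervalIntegral.integral_add (Continuous.intervalIntegrable (by fun_prop) _ _)
            (Continuous.intervalIntegrable (by fun_prop) _ _)]
          simp
      _ ≤ r * (1 + r) := by nlinarith

theorem continuous_pairRate (hK : Continuous (uncurry K)) (hg : Continuous g) :
    Continuous (uncurry (pairRate K g)) := by
  have hK' : Continuous fun p : ℝ × ℝ => K p.1 p.2 := hK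
  exact (hK'.mul (hg.comp continuous_fst)).mul (hg.comp continuous_snd)

theorem pairRate_nonneg (hK : IsSubkernel K Φ) (hg : IsProfile ω A g) {x y : ℝ} (hx : 0 ≤ x)
    (hy : 0 ≤ y) : 0 ≤ pairRate K g x y :=
  mul_nonneg (mul_nonneg (hK.nonneg x y hx hy) (hg.nonneg x)) (hg.nonneg y)

theorem mul_pair_le (hΦ : IsDominated Φ ω C) {k x y a b : ℝ} (hx : 0 < x) (hy : 0 < y)
    (hk : k ≤ Φ x y) (ha : 0 ≤ a) (hb : 0 ≤ b) :
    (1 + x) * (1 + y) * (k * a * b) ≤ C * (ω x * a * (ω y * b)) := by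
  have h1 := mul_le_mul_of_nonneg_right hk (by positivity : 0 ≤ (1 + x) * (1 + y))
  have h2 := mul_le_mul_of_nonneg_right (h1.trans (hΦ.mul_le x y hx hy)) (mul_nonneg ha hb)
  calc (1 + x) * (1 + y) * (k * a * b) = k * ((1 + x) * (1 + y)) * (a * b) := by ring
    _ ≤ C * (ω x * ω y) * (a * b) := h2
    _ = _ := by ring

theorem pairRate_integrable (hΦ : IsDominated Φ ω C) (hK : IsSubkernel K Φ)
    (hg : IsProfile ω A g) {c : ℝ → ℝ → ℝ} (hc : Measurable (uncurry c))
    (hc1 : ∀ x y, 0 < x → 0 < y → |c x y| ≤ (1 + x) * (1 + y)) :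
    Integrable (fun p : ℝ × ℝ => c p.1 p.2 * pairRate K g p.1 p.2) quadMeasure := by
  refine integrable_of_le_profile_prod (F := fun x y => c x y * pairRate K g x y) (c := C) hg hg
    (hc.mul (continuous_pairRate hK.continuous hg.continuous).measurable) fun x y hx hy => ?_
  rw [abs_mul, abs_of_nonneg (pairRate_nonneg hK hg hx.le hy.le)]
  exact (mul_le_mul_of_nonneg_right (hc1 x y hx hy)
    (pairRate_nonneg hK hg hx.le hy.le)).trans (mul_pair_le hΦ hx hy (hK.le x y hx.le hy.le)
      (hg.nonneg x) (hg.nonneg y))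

theorem pairRate_weight_integrable (hΦ : IsDominated Φ ω C) (hK : IsSubkernel K Φ)
    (hg : IsProfile ω A g) :
    Integrable (fun p : ℝ × ℝ => (1 + p.1) * pairRate K g p.1 p.2) quadMeasure ∧
    Integrable (fun p : ℝ × ℝ => (1 + (p.1 + p.2)) * pairRate K g p.1 p.2) quadMeasure := by
  constructor
  · refine pairRate_integrable hΦ hK hg (c := fun x _ => 1 + x) (by fun_prop) fun x y hx hy => ?_
    rw [abs_of_pos (by linarith)]
    nlinarith
  · refine pairRate_integrable hΦ hK hg (c := fun x y => 1 + (x + y)) (by fun_prop)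
      fun x y hx hy => ?_
    rw [abs_of_pos (by linarith)]
    nlinarith

theorem integral_pairRate_le (hΦ : IsDominated Φ ω C) (hK : IsSubkernel K Φ)
    (hg : IsProfile ω A g) :
    ∫ p, (1 + p.1) * pairRate K g p.1 p.2 ∂quadMeasure ≤ C * (A * A) ∧
    ∫ p, (1 + (p.1 + p.2)) * pairRate K g p.1 p.2 ∂quadMeasure ≤ C * (A * A) := by
  have hA := IsProfile.const_nonneg hΦ hg
  have h0 : ∫ p : ℝ × ℝ, C * (ω p.1 * g p.1 * (ω p.2 * g p.2)) ∂quadMeasure ≤ C * (A * A) := by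
    have h1 : ∫ p : ℝ × ℝ, ω p.1 * g p.1 * (ω p.2 * g p.2) ∂quadMeasure
        = (∫ z, ω z * g z ∂posMeasure) * ∫ z, ω z * g z ∂posMeasure :=
      integral_prod_mul (fun z => ω z * g z) fun z => ω z * g z
    rw [integral_const_mul, h1]
    have h2 : 0 ≤ ∫ z, ω z * g z ∂posMeasure := integral_nonneg_of_ae (ae_posMeasure fun z hz =>
      mul_nonneg (hΦ.weight_nonneg z hz) (hg.nonneg z))
    exact mul_le_mul_of_nonneg_left (mul_le_mul hg.integral_le hg.integral_le h2 hA)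
      hΦ.const_nonneg
  have hi : Integrable (fun p : ℝ × ℝ => C * (ω p.1 * g p.1 * (ω p.2 * g p.2))) quadMeasure :=
    (hg.integrable.mul_prod hg.integrable).const_mul C
  obtain ⟨i1, i2⟩ := pairRate_weight_integrable hΦ hK hg
  have hm := fun x y (hx : 0 < x) (hy : 0 < y) => mul_pair_le hΦ hx hy (hK.le x y hx.le hy.le)
      (hg.nonneg x) (hg.nonneg y)
  have hn := fun x y (hx : 0 < x) (hy : 0 < y) => pairRate_nonneg hK hg hx.le hy.le
  constructor
  · refine (integral_mono_ae i1 hi (ae_quadMeasure fun x y hx hy => ?_)).trans h0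
    refine le_trans ?_ (hm x y hx hy)
    exact mul_le_mul_of_nonneg_right (by nlinarith) (hn x y hx hy)
  · refine (integral_mono_ae i2 hi (ae_quadMeasure fun x y hx hy => ?_)).trans h0
    refine le_trans ?_ (hm x y hx hy)
    exact mul_le_mul_of_nonneg_right (by nlinarith) (hn x y hx hy)

theorem profileDist_integrable (hΦ : IsDominated Φ ω C) (hg : IsProfile ω A g)
    (hh : IsProfile ω B h) : Integrable (fun z => (1 + z) * |g z - h z|) posMeasure := by
  refine integrable_of_le_profile (hg.add hh) (c := C) ?_ fun z hz => ?_
  · exact Continuous.aestronglyMeasurable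
      ((continuous_const.add continuous_id).mul (hg.continuous.sub hh.continuous).abs)
  · rw [abs_mul, abs_abs, abs_of_pos (by linarith : 0 < 1 + z), ← mul_assoc]
    have h1 : |g z - h z| ≤ g z + h z := by
      rw [abs_le]; constructor <;> linarith [hg.nonneg z, hh.nonneg z]
    exact mul_le_mul (hΦ.le_weight z hz) h1 (abs_nonneg _)
      (by linarith [hΦ.le_weight z hz])

theorem profileDist_le (hΦ : IsDominated Φ ω C) (hg : IsProfile ω A g)
    (hh : IsProfile ω B h) : profileDist g h ≤ C * (A + B) := by
  have hs := hg.add hh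
  calc profileDist g h ≤ ∫ z, C * (ω z * (g z + h z)) ∂posMeasure := by
        refine integral_mono_ae (profileDist_integrable hΦ hg hh) (hs.integrable.const_mul C)
          (ae_posMeasure fun z hz => ?_)
        simp only
        rw [← mul_assoc]
        have h1 : |g z - h z| ≤ g z + h z := by
          rw [abs_le]; constructor <;> linarith [hg.nonneg z, hh.nonneg z]
        exact mul_le_mul (hΦ.le_weight z hz) h1 (abs_nonneg _)
          (by linarith [hΦ.le_weight z hz])
    _ ≤ C * (A + B) := by
        rw [integral_const_mul]
        exact mul_le_mul_of_nonneg_left hs.integral_le hΦ.const_nonneg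

/-- The pair densities of two profiles, symmetrized. -/
theorem pairRate_sub (x y : ℝ) : pairRate K₁ g x y - pairRate K₂ h x y
    = 1 / 2 * K₁ x y * ((g x - h x) * (g y + h y) + (g x + h x) * (g y - h y))
      + (K₁ x y - K₂ x y) * (h x * h y) := by
  unfold pairRate; ring

/-- The integrated bound uses K(x, y)(1 + y) ≤ C (1 + x) ω(y): the difference keeps its weight 1 +
x, and the sum g + h absorbs ω. No moment of the difference beyond the distance itself appears. -/
theorem integral_abs_mul_sum_le (hΦ : IsDominated Φ ω C) (hK : IsSubkernel K Φ)
    (hg : IsProfile ω A g) (hh : IsProfile ω B h) :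
    Integrable (fun p : ℝ × ℝ => (1 + p.1) * (1 + p.2) *
      (K p.1 p.2 * |g p.1 - h p.1| * (g p.2 + h p.2))) quadMeasure ∧
    ∫ p, (1 + p.2) * (K p.1 p.2 * |g p.1 - h p.1| * (g p.2 + h p.2)) ∂quadMeasure
      ≤ C * (A + B) * profileDist g h := by
  have hs := hg.add hh
  have hKc : Continuous fun p : ℝ × ℝ => K p.1 p.2 := hK.continuous
  have hgc := hg.continuous
  have hhc := hh.continuous
  have hcont : Continuous fun p : ℝ × ℝ => K p.1 p.2 * |g p.1 - h p.1| * (g p.2 + h p.2) := by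
    fun_prop
  have habs : ∀ z, |g z - h z| ≤ g z + h z := fun z => by
    rw [abs_le]; constructor <;> linarith [hg.nonneg z, hh.nonneg z]
  have hi : Integrable (fun p : ℝ × ℝ => (1 + p.1) * (1 + p.2) *
      (K p.1 p.2 * |g p.1 - h p.1| * (g p.2 + h p.2))) quadMeasure := by
    refine integrable_of_le_profile_prod (F := fun x y => (1 + x) * (1 + y) *
      (K x y * |g x - h x| * (g y + h y))) (c := C) hs hs ?_ fun x y hx hy => ?_
    · exact (Continuous.mul (by fun_prop) hcont).measurable
    · have h1 := hK.nonneg x y hx.le hy.le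
      rw [abs_of_nonneg (mul_nonneg (by positivity)
        (mul_nonneg (mul_nonneg h1 (abs_nonneg _)) (hs.nonneg y)))]
      refine le_trans ?_ (mul_pair_le hΦ hx hy (hK.le x y hx.le hy.le) (hs.nonneg x) (hs.nonneg y))
      have := hs.nonneg y
      have := habs x
      gcongr
  refine ⟨hi, ?_⟩
  have hprod : Integrable (fun p : ℝ × ℝ => (1 + p.1) * |g p.1 - h p.1| *
      (ω p.2 * (g p.2 + h p.2))) quadMeasure :=
    (profileDist_integrable hΦ hg hh).mul_prod hs.integrable
  have he : ∫ p : ℝ × ℝ, (1 + p.1) * |g p.1 - h p.1| * (ω p.2 * (g p.2 + h p.2)) ∂quadMeasure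
      = profileDist g h * ∫ z, ω z * (g z + h z) ∂posMeasure :=
    integral_prod_mul (fun z => (1 + z) * |g z - h z|) fun z => ω z * (g z + h z)
  calc ∫ p, (1 + p.2) * (K p.1 p.2 * |g p.1 - h p.1| * (g p.2 + h p.2)) ∂quadMeasure
      ≤ ∫ p : ℝ × ℝ, C * ((1 + p.1) * |g p.1 - h p.1| * (ω p.2 * (g p.2 + h p.2)))
          ∂quadMeasure := by
        refine integral_mono_of_nonneg (ae_quadMeasure fun x y hx hy => ?_) (hprod.const_mul C)
          (ae_quadMeasure fun x y hx hy => ?_)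
        · exact mul_nonneg (by linarith) (mul_nonneg (mul_nonneg (hK.nonneg x y hx.le hy.le)
            (abs_nonneg _)) (hs.nonneg y))
        · have h1 := mul_le_mul_of_nonneg_right (hK.le x y hx.le hy.le)
            (by linarith : 0 ≤ 1 + y)
          have h2 := mul_le_mul_of_nonneg_right (h1.trans (hΦ.mul_right_le x y hx.le hy))
            (mul_nonneg (abs_nonneg (g x - h x)) (hs.nonneg y))
          calc (1 + y) * (K x y * |g x - h x| * (g y + h y))
              = K x y * (1 + y) * (|g x - h x| * (g y + h y)) := by ring
            _ ≤ C * ((1 + x) * ω y) * (|g x - h x| * (g y + h y)) := h2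
            _ = _ := by ring
    _ ≤ C * (A + B) * profileDist g h := by
        rw [integral_const_mul, he]
        have := mul_le_mul_of_nonneg_left hs.integral_le
          (mul_nonneg hΦ.const_nonneg (profileDist_nonneg g h))
        linarith

/-! ### The dissipation estimate -/

/-- With u = g - h, s = g + h, the symmetrized difference of pair densities contains u(x)s(y) +
s(x)u(y). Both gain contributions have weight at most 1 + (x+y)/2, whereas the loss contributes
exactly -(1 + x)|u(x)|s(y). The coefficient of |u(x)|s(y) is therefore ½(1 + (x+y)/2) - ½(1 + x) =
(y - x)/4, and that of |u(y)|s(x) is 1 + 3x/4 + y/4. -/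
theorem weakKernel_mul_pairRate_sub_le (he : IsProb e) (hK₁ : IsSubkernel K₁ Φ)
    (hg : IsProfile ω A g) (hh : IsProfile ω B h) {x y : ℝ} (hx : 0 < x) (hy : 0 < y) :
    weakKernel e (fun z => (1 + z) * sgn (g z - h z)) x y *
      (pairRate K₁ g x y - pairRate K₂ h x y)
      ≤ 1 / 4 * (y - x) * (K₁ x y * |g x - h x| * (g y + h y))
        + (1 + 3 / 4 * x + 1 / 4 * y) * (K₁ y x * |g y - h y| * (g x + h x))
        + 2 * ((1 + (x + y)) * (|K₁ x y - K₂ x y| * (h x * h y))) := by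
  have hw := isWeight_mul_sgn (hg.continuous.sub hh.continuous).measurable
  simp only [Pi.sub_apply] at hw
  set ψ : ℝ → ℝ := fun z => (1 + z) * sgn (g z - h z) with hψ
  set P := weakKernel e ψ x y + ψ x with hP
  have hxy := add_pos hx hy
  have hPle : |P| ≤ 1 + 1 / 2 * (x + y) := by
    have hav : |(x + y)⁻¹ * ∫ z in (0 : ℝ)..(x + y), ψ z| ≤ 1 + 1 / 2 * (x + y) := by
      rw [abs_mul, abs_inv, abs_of_pos hxy, inv_mul_le_iff₀ hxy]
      calc |∫ z in (0 : ℝ)..(x + y), ψ z| ≤ ∫ z in (0 : ℝ)..(x + y), |ψ z| :=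
            intervalIntegral.abs_integral_le_integral_abs hxy.le
        _ ≤ ∫ z in (0 : ℝ)..(x + y), (1 + z) := by
            refine intervalIntegral.integral_mono_on hxy.le
              (hw.intervalIntegrable _ hxy).abs
              (Continuous.intervalIntegrable (by fun_prop) _ _) fun z hz => ?_
            rw [hψ]
            simp only
            rw [abs_mul, abs_of_nonneg (by linarith [hz.1] : 0 ≤ 1 + z)]
            exact mul_le_of_le_one_right (by linarith [hz.1]) (abs_sgn_le _)
        _ = (x + y) * (1 + 1 / 2 * (x + y)) := by
            rw [intervalIntegral.integral_add (Continuous.intervalIntegrable (by fun_prop) _ _)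
              (Continuous.intervalIntegrable (by fun_prop) _ _)]
            simp
            ring
    have hψa : |ψ (x + y)| ≤ 1 + (x + y) := hw.le _ hxy
    have h1 : P = e x y * (1 / 2 * ψ (x + y))
        + (1 - e x y) * ((x + y)⁻¹ * ∫ z in (0 : ℝ)..(x + y), ψ z) := by
      rw [hP, weakKernel]; ring
    have he0 := he.nonneg x y
    have he1 := sub_nonneg.2 (he.le_one x y)
    rw [h1]
    refine (abs_add_le _ _).trans ?_
    rw [abs_mul (e x y), abs_mul (1 - e x y), abs_of_nonneg he0, abs_of_nonneg he1, abs_mul (1 / 2),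
      abs_of_pos (by norm_num : (0 : ℝ) < 1 / 2)]
    have h2 := mul_le_mul_of_nonneg_left hav he1
    have h3 := mul_le_mul_of_nonneg_left
      (by linarith : 1 / 2 * |ψ (x + y)| ≤ 1 + 1 / 2 * (x + y)) he0
    linarith
  have hk0 := hK₁.nonneg x y hx.le hy.le
  have hkyx := hK₁.symm y x hy.le hx.le
  have hsx := add_nonneg (hg.nonneg x) (hh.nonneg x)
  have hsy := add_nonneg (hg.nonneg y) (hh.nonneg y)
  have hhh := mul_nonneg (hh.nonneg x) (hh.nonneg y)
  rw [show weakKernel e ψ x y = P - ψ x by rw [hP]; ring, pairRate_sub]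
  set a := |g x - h x| with ha
  set b := |g y - h y| with hb
  set d := |K₁ x y - K₂ x y| with hd
  have e1 : |1 / 2 * K₁ x y * ((g x - h x) * (g y + h y) + (g x + h x) * (g y - h y))
      + (K₁ x y - K₂ x y) * (h x * h y)|
      ≤ 1 / 2 * K₁ x y * (a * (g y + h y) + (g x + h x) * b) + d * (h x * h y) := by
    refine (abs_add_le _ _).trans (add_le_add ?_ ?_)
    · rw [abs_mul, abs_of_nonneg (by positivity : 0 ≤ 1 / 2 * K₁ x y)]
      refine mul_le_mul_of_nonneg_left ((abs_add_le _ _).trans ?_) (by positivity)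
      rw [abs_mul, abs_mul (g x + h x), abs_of_nonneg hsx, abs_of_nonneg hsy]
    · rw [abs_mul, abs_of_nonneg hhh]
  have e2 : P * (1 / 2 * K₁ x y * ((g x - h x) * (g y + h y) + (g x + h x) * (g y - h y))
      + (K₁ x y - K₂ x y) * (h x * h y)) ≤ (1 + 1 / 2 * (x + y)) *
      (1 / 2 * K₁ x y * (a * (g y + h y) + (g x + h x) * b) + d * (h x * h y)) := by
    refine (le_abs_self _).trans ?_
    rw [abs_mul]
    exact mul_le_mul hPle e1 (abs_nonneg _) (by positivity)
  have e3 : sgn (g x - h x) * (g x - h x) = a := sgn_mul_self _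
  have e4 : -(sgn (g x - h x) * (g y - h y)) ≤ b := by
    refine (neg_le_abs _).trans ?_
    rw [abs_mul]
    exact mul_le_of_le_one_left (abs_nonneg _) (abs_sgn_le _)
  have e5 : -(sgn (g x - h x) * (K₁ x y - K₂ x y)) ≤ d := by
    refine (neg_le_abs _).trans ?_
    rw [abs_mul]
    exact mul_le_of_le_one_left (abs_nonneg _) (abs_sgn_le _)
  -- The sign is kept only in sgn(u(x)) u(x) = |u(x)|; the other products are bounded by absolute
  -- values.
  have e6 : -ψ x * (1 / 2 * K₁ x y * ((g x - h x) * (g y + h y) + (g x + h x) * (g y - h y))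
      + (K₁ x y - K₂ x y) * (h x * h y)) ≤ (1 + x) * (1 / 2 * K₁ x y *
      (-(a * (g y + h y)) + (g x + h x) * b) + d * (h x * h y)) := by
    have f1 : -ψ x * (1 / 2 * K₁ x y * ((g x - h x) * (g y + h y) + (g x + h x) * (g y - h y))
      + (K₁ x y - K₂ x y) * (h x * h y)) = (1 + x) * (1 / 2 * K₁ x y *
      (-((sgn (g x - h x) * (g x - h x)) * (g y + h y))
        + (g x + h x) * -(sgn (g x - h x) * (g y - h y)))
        + -(sgn (g x - h x) * (K₁ x y - K₂ x y)) * (h x * h y)) := by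
      rw [hψ]; ring
    rw [f1, e3]
    gcongr
  have e7 : 0 ≤ d * (h x * h y) := mul_nonneg (abs_nonneg _) hhh
  have e8 : (P - ψ x) * (1 / 2 * K₁ x y * ((g x - h x) * (g y + h y)
      + (g x + h x) * (g y - h y)) + (K₁ x y - K₂ x y) * (h x * h y))
      ≤ (1 + 1 / 2 * (x + y)) *
      (1 / 2 * K₁ x y * (a * (g y + h y) + (g x + h x) * b) + d * (h x * h y))
      + (1 + x) * (1 / 2 * K₁ x y *
      (-(a * (g y + h y)) + (g x + h x) * b) + d * (h x * h y)) := by linarith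
  refine e8.trans ?_
  rw [hkyx]
  have e9 := mul_nonneg hy.le e7
  have e10 := mul_nonneg hx.le e7
  linarith

/-- The pointwise estimate is integrated over pairs. The products (1 + x)(1 + y) K g g are
integrable by the ω-moments, so the integrals can be split and the variables exchanged. -/
theorem collision_sgn_le (he : IsProb e) (hΦ : IsDominated Φ ω C) (hK₁ : IsSubkernel K₁ Φ)
    (hK₂ : IsSubkernel K₂ Φ) (hg : IsProfile ω A g) (hh : IsProfile ω B h) :
    Integrable (fun z => (1 + z) * sgn (g z - h z) *
      (collisionOp e (pairRate K₁ g) z - collisionOp e (pairRate K₂ h) z)) posMeasure ∧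
    ∫ z, |(1 + z) * sgn (g z - h z) *
      (collisionOp e (pairRate K₁ g) z - collisionOp e (pairRate K₂ h) z)| ∂posMeasure
      ≤ 3 * (C * (A * A)) + 3 * (C * (B * B)) ∧
    ∫ z, (1 + z) * sgn (g z - h z) *
      (collisionOp e (pairRate K₁ g) z - collisionOp e (pairRate K₂ h) z) ∂posMeasure
      ≤ C * (A + B) * profileDist g h
        + 2 * ∫ p, (1 + (p.1 + p.2)) * (|K₁ p.1 p.2 - K₂ p.1 p.2| * (h p.1 * h p.2))
          ∂quadMeasure := by
  set u : ℝ → ℝ := fun z => g z - h z with hu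
  set s : ℝ → ℝ := fun z => g z + h z with hs
  have hum : Measurable u := (hg.continuous.sub hh.continuous).measurable
  have hw := isWeight_mul_sgn hum
  set ψ : ℝ → ℝ := fun z => (1 + z) * sgn (u z) with hψ
  obtain ⟨i11, i12⟩ := pairRate_weight_integrable hΦ hK₁ hg
  obtain ⟨i21, i22⟩ := pairRate_weight_integrable hΦ hK₂ hh
  obtain ⟨b11, b12⟩ := integral_pairRate_le hΦ hK₁ hg
  obtain ⟨b21, b22⟩ := integral_pairRate_le hΦ hK₂ hh
  obtain ⟨p1, p2, p3, p4⟩ := collision_weak he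
    (continuous_pairRate hK₁.continuous hg.continuous).measurable hw i11 i12
  obtain ⟨q1, q2, q3, q4⟩ := collision_weak he
    (continuous_pairRate hK₂.continuous hh.continuous).measurable hw i21 i22
  have hfun : (fun z => ψ z * (collisionOp e (pairRate K₁ g) z - collisionOp e (pairRate K₂ h) z))
      = fun z => ψ z * collisionOp e (pairRate K₁ g) z - ψ z * collisionOp e (pairRate K₂ h) z := by
    ext z; ring
  have hint : Integrable (fun z => ψ z *
      (collisionOp e (pairRate K₁ g) z - collisionOp e (pairRate K₂ h) z)) posMeasure := by
    rw [hfun]; exact p1.sub q1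
  have habs : ∀ {K : ℝ → ℝ → ℝ} {k : ℝ → ℝ} {D : ℝ}, IsSubkernel K Φ → IsProfile ω D k →
      ∀ c : ℝ → ℝ → ℝ, ∫ p, c p.1 p.2 * |pairRate K k p.1 p.2| ∂quadMeasure
        = ∫ p, c p.1 p.2 * pairRate K k p.1 p.2 ∂quadMeasure := fun hK hk c =>
    integral_congr_ae (ae_quadMeasure fun x y hx hy => by
      simp only [abs_of_nonneg (pairRate_nonneg hK hk hx.le hy.le)])
  rw [habs hK₁ hg fun x _ => 1 + x, habs hK₁ hg fun x y => 1 + (x + y)] at p4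
  rw [habs hK₂ hh fun x _ => 1 + x, habs hK₂ hh fun x y => 1 + (x + y)] at q4
  refine ⟨hint, ?_, ?_⟩
  · have h1 : ∫ z, |ψ z * (collisionOp e (pairRate K₁ g) z - collisionOp e (pairRate K₂ h) z)|
        ∂posMeasure ≤ ∫ z, (|ψ z * collisionOp e (pairRate K₁ g) z|
          + |ψ z * collisionOp e (pairRate K₂ h) z|) ∂posMeasure := by
      refine integral_mono hint.abs (p1.abs.add q1.abs) fun z => ?_
      simp only [mul_sub]
      exact abs_sub _ _
    rw [integral_add p1.abs q1.abs] at h1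
    linarith
  have heq : ∫ z, ψ z * (collisionOp e (pairRate K₁ g) z - collisionOp e (pairRate K₂ h) z)
      ∂posMeasure = ∫ p, weakKernel e ψ p.1 p.2 *
        (pairRate K₁ g p.1 p.2 - pairRate K₂ h p.1 p.2) ∂quadMeasure := by
    rw [hfun, integral_sub p1 q1, p3, q3, ← integral_sub p2 q2]
    exact integral_congr_ae (ae_of_all _ fun p => by simp only; ring)
  have hwint : Integrable (fun p : ℝ × ℝ => weakKernel e ψ p.1 p.2 *
        (pairRate K₁ g p.1 p.2 - pairRate K₂ h p.1 p.2)) quadMeasure :=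
    (p2.sub q2).congr (ae_of_all _ fun p => by simp only [Pi.sub_apply]; ring)
  obtain ⟨d1, d2⟩ := integral_abs_mul_sum_le hΦ hK₁ hg hh
  have hKc : Continuous fun p : ℝ × ℝ => K₁ p.1 p.2 := hK₁.continuous
  have hKc' : Continuous fun p : ℝ × ℝ => K₂ p.1 p.2 := hK₂.continuous
  have hgc := hg.continuous
  have hhc := hh.continuous
  set G : ℝ → ℝ → ℝ := fun x y => 1 / 4 * (y - x) * (K₁ x y * |g x - h x| * (g y + h y)) with hG
  set H : ℝ → ℝ → ℝ := fun x y =>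
    (1 + 3 / 4 * y + 1 / 4 * x) * (K₁ x y * |g x - h x| * (g y + h y)) with hH
  set R : ℝ → ℝ → ℝ := fun x y =>
    (1 + (x + y)) * (|K₁ x y - K₂ x y| * (h x * h y)) with hR
  have hbase : ∀ x y, 0 < x → 0 < y → 0 ≤ K₁ x y * |g x - h x| * (g y + h y) := fun x y hx hy =>
    mul_nonneg (mul_nonneg (hK₁.nonneg x y hx.le hy.le) (abs_nonneg _))
      (add_nonneg (hg.nonneg y) (hh.nonneg y))
  have hGi : Integrable (fun p : ℝ × ℝ => G p.1 p.2) quadMeasure := by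
    refine integrable_bdd_mul d1 ?_ fun x y hx hy => ?_
    · exact Continuous.aestronglyMeasurable (by fun_prop)
    · simp only [hG]
      rw [abs_mul, abs_mul ((1 + x) * (1 + y))]
      refine mul_le_mul_of_nonneg_right ?_
        (abs_nonneg (K₁ x y * |g x - h x| * (g y + h y)))
      have hxy := mul_pos hx hy
      rw [abs_of_nonneg (by positivity : 0 ≤ (1 + x) * (1 + y)), abs_le]
      constructor <;> nlinarith
  have hHi : Integrable (fun p : ℝ × ℝ => H p.1 p.2) quadMeasure := by
    refine integrable_bdd_mul d1 ?_ fun x y hx hy => ?_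
    · exact Continuous.aestronglyMeasurable (by fun_prop)
    · simp only [hH]
      rw [abs_mul (1 + 3 / 4 * y + 1 / 4 * x), abs_mul ((1 + x) * (1 + y))]
      refine mul_le_mul_of_nonneg_right ?_
        (abs_nonneg (K₁ x y * |g x - h x| * (g y + h y)))
      have hxy := mul_pos hx hy
      rw [abs_of_nonneg (by positivity), abs_of_nonneg (by positivity)]
      nlinarith
  have hRi : Integrable (fun p : ℝ × ℝ => R p.1 p.2) quadMeasure := by
    refine integrable_of_le_profile_prod (F := R) (c := C) hh hh ?_ fun x y hx hy => ?_
    · exact Continuous.measurable (by unfold uncurry; fun_prop)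
    · have hle : |K₁ x y - K₂ x y| ≤ Φ x y := by
        have := hK₁.nonneg x y hx.le hy.le
        have := hK₁.le x y hx.le hy.le
        have := hK₂.nonneg x y hx.le hy.le
        have := hK₂.le x y hx.le hy.le
        rw [abs_le]; constructor <;> linarith
      have h1 := mul_pair_le hΦ hx hy hle (hh.nonneg x) (hh.nonneg y)
      have h2 : 0 ≤ |K₁ x y - K₂ x y| * (h x * h y) :=
        mul_nonneg (abs_nonneg _) (mul_nonneg (hh.nonneg x) (hh.nonneg y))
      simp only [hR]
      rw [abs_of_nonneg (mul_nonneg (by linarith) h2)]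
      have hxy := mul_pos hx hy
      have h3 := mul_le_mul_of_nonneg_right
        (by nlinarith : 1 + (x + y) ≤ (1 + x) * (1 + y)) h2
      linarith
  have hHi' : Integrable (fun p : ℝ × ℝ => H p.2 p.1) quadMeasure := integrable_swap_quad.2 hHi
  have hpt : ∀ x y, 0 < x → 0 < y → weakKernel e ψ x y *
      (pairRate K₁ g x y - pairRate K₂ h x y) ≤ G x y + H y x + 2 * R x y := fun x y hx hy =>
    weakKernel_mul_pairRate_sub_le he hK₁ hg hh hx hy
  -- After the exchange of variables in the second term the coefficients add up to (y - x)/4 + 1 +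
  -- 3y/4 + x/4 = 1 + y: the weight in x has cancelled.
  have hsum : ∫ p, G p.1 p.2 ∂quadMeasure + ∫ p, H p.1 p.2 ∂quadMeasure
      = ∫ p, (1 + p.2) * (K₁ p.1 p.2 * |g p.1 - h p.1| * (g p.2 + h p.2)) ∂quadMeasure := by
    rw [← integral_add hGi hHi]
    exact integral_congr_ae (ae_of_all _ fun p => by simp only [hG, hH]; ring)
  rw [heq]
  calc ∫ p, weakKernel e ψ p.1 p.2 * (pairRate K₁ g p.1 p.2 - pairRate K₂ h p.1 p.2) ∂quadMeasure
      ≤ ∫ p, (G p.1 p.2 + H p.2 p.1 + 2 * R p.1 p.2) ∂quadMeasure :=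
        integral_mono_ae hwint ((hGi.add hHi').add (hRi.const_mul 2)) (ae_quadMeasure hpt)
    _ = ∫ p, (1 + p.2) * (K₁ p.1 p.2 * |g p.1 - h p.1| * (g p.2 + h p.2)) ∂quadMeasure
        + 2 * ∫ p, R p.1 p.2 ∂quadMeasure := by
        rw [integral_add₃ hGi hHi' (hRi.const_mul 2), integral_swap_quad H, hsum,
          integral_const_mul]
    _ ≤ _ := by linarith

end

/-! ### Stability in L¹, and pointwise comparison of collision operators -/

section

variable {e K K₁ K₂ Φ : ℝ → ℝ → ℝ} {ω : ℝ → ℝ} {C A B : ℝ} {g h : ℝ → ℝ}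

/-! ### Stability in the weighted `L¹` norm -/

theorem collisionRate_eq_pairRate (K : ℝ → ℝ → ℝ) (g : ℝ → ℝ → ℝ) (t : ℝ) :
    (fun x y => collisionRate K g x y t) = pairRate K fun x => g x t := rfl

/-- The chain rule for |g - h| is applied at each fixed size, multiplied by 1 + z and integrated;
after exchanging time and size, `collision_sgn_le` bounds the integrand. The distance is a priori at
most C(A + A), so `gronwall_family` applies. The kernel error `R` involves only `h`, a freedom used
in the construction of the approximations. -/
theorem stability {g h : ℝ → ℝ → ℝ} {T R : ℝ} (he : IsProb e) (hΦ : IsDominated Φ ω C)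
    (hK₁ : IsSubkernel K₁ Φ) (hK₂ : IsSubkernel K₂ Φ) (hg : IsMild e K₁ T g) (hh : IsMild e K₂ T h)
    (hgA : ∀ t ∈ Icc 0 T, IsProfile ω A fun z => g z t)
    (hhA : ∀ t ∈ Icc 0 T, IsProfile ω A fun z => h z t) (hR0 : 0 ≤ R)
    (hR : ∀ t ∈ Icc 0 T, 2 * ∫ p, (1 + (p.1 + p.2)) *
      (|K₁ p.1 p.2 - K₂ p.1 p.2| * (h p.1 t * h p.2 t)) ∂quadMeasure ≤ R)
    {t : ℝ} (ht : t ∈ Icc 0 T) :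
    profileDist (fun z => g z t) (fun z => h z t)
      ≤ 2 * (profileDist (fun z => g z 0) (fun z => h z 0) + T * R)
        * Real.exp (2 * (C * (A + A)) * t) := by
  have hT : 0 ≤ T := ht.1.trans ht.2
  have h0T : (0 : ℝ) ∈ Icc 0 T := ⟨le_rfl, hT⟩
  have hA := IsProfile.const_nonneg hΦ (hgA 0 h0T)
  have hb0 : 0 ≤ C * (A + A) := mul_nonneg hΦ.const_nonneg (by linarith)
  set q : ℝ → ℝ → ℝ := fun z t => collisionOp e (pairRate K₁ fun x => g x t) z
    - collisionOp e (pairRate K₂ fun x => h x t) z with hq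
  have hqc : ContinuousOn (uncurry q) (strip T) := hg.continuousOn_op.sub hh.continuousOn_op
  set ρ : ℝ → ℝ → ℝ := fun z s => (1 + z) * sgn (g z s - h z s) * q z s with hρ
  have hρm : AEStronglyMeasurable (uncurry ρ)
      (posMeasure.prod (volume.restrict (Icc 0 T))) := by
    have h1 : Measurable fun p : ℝ × ℝ => (1 + p.1) * sgn (g p.1 p.2 - h p.1 p.2) :=
      (measurable_const.add measurable_fst).mul
        (measurable_sgn.comp (hg.continuous.sub hh.continuous).measurable)
    refine h1.aestronglyMeasurable.mul ?_
    rw [Measure.prod_restrict]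
    exact (hqc.mono (prod_mono Ioi_subset_Ici_self subset_rfl)).aestronglyMeasurable
      (measurableSet_Ioi.prod measurableSet_Icc)
  have hcs := fun s hs => collision_sgn_le he hΦ hK₁ hK₂ (hgA s hs) (hhA s hs)
  have hqz : ∀ z, 0 ≤ z → ContinuousOn (q z) (Icc 0 T) := fun z hz =>
    hqc.comp (f := fun s => (z, s)) (by fun_prop) fun s hs => ⟨hz, hs⟩
  have hpt : ∀ t ∈ Icc 0 T, ∀ z, 0 < z → (1 + z) * |g z t - h z t|
      ≤ (1 + z) * |g z 0 - h z 0| + ∫ s in (0 : ℝ)..t, ρ z s := by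
    intro t ht z hz
    have hu : ∀ t ∈ Icc 0 T, g z t - h z t = (g z 0 - h z 0) + ∫ s in (0 : ℝ)..t, q z s := by
      intro t ht
      have hsub : uIcc 0 t ⊆ Icc 0 T := by
        rw [uIcc_of_le ht.1]; exact Icc_subset_Icc_right ht.2
      have c1 : ContinuousOn (fun s => collisionOp e (pairRate K₁ fun x => g x s) z) (Icc 0 T) :=
        hg.continuousOn_op.comp (f := fun s => (z, s)) (by fun_prop) fun s hs => ⟨hz.le, hs⟩
      have c2 : ContinuousOn (fun s => collisionOp e (pairRate K₂ fun x => h x s) z) (Icc 0 T) :=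
        hh.continuousOn_op.comp (f := fun s => (z, s)) (by fun_prop) fun s hs => ⟨hz.le, hs⟩
      rw [hg.eq_add_integral z hz.le t ht, hh.eq_add_integral z hz.le t ht, hq]
      simp only [collisionRate_eq_pairRate]
      rw [intervalIntegral.integral_sub (c1.mono hsub).intervalIntegrable
        (c2.mono hsub).intervalIntegrable]
      ring
    have h1 := abs_le_add_integral_sgn (u := fun t => g z t - h z t) (hqz z hz.le) hu ht
    have h2 := mul_le_mul_of_nonneg_left h1 (by linarith : 0 ≤ 1 + z)
    rw [mul_add, ← intervalIntegral.integral_const_mul] at h2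
    refine h2.trans (le_of_eq ?_)
    congr 1
    exact intervalIntegral.integral_congr fun s _ => by simp only [hρ]; ring
  refine gronwall_family (ι := Unit)
    (φ := fun _ t => profileDist (fun z => g z t) (fun z => h z t)) (I := Icc 0 T)
    (add_nonneg (profileDist_nonneg _ _) (mul_nonneg hT hR0)) (mul_nonneg zero_le_two hb0)
    (fun t ht => ht.1) ⟨C * (A + A), fun _ t ht => profileDist_le hΦ (hgA t ht) (hhA t ht)⟩
    (fun S hS hφ _ t ht => ?_) () t ht
  obtain ⟨a1, a2, a3⟩ := integral_time_swap hρm (fun s hs => (hcs s hs).1)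
    (fun s hs => (hcs s hs).2.1) ht
  have h1 : profileDist (fun z => g z t) (fun z => h z t)
      ≤ profileDist (fun z => g z 0) (fun z => h z 0)
        + ∫ z, (∫ s in (0 : ℝ)..t, ρ z s) ∂posMeasure := by
    have i0 := profileDist_integrable hΦ (hgA 0 h0T) (hhA 0 h0T)
    unfold profileDist
    rw [← integral_add i0 a1]
    exact integral_mono_ae (profileDist_integrable hΦ (hgA t ht) (hhA t ht)) (i0.add a1)
      (ae_posMeasure (hpt t ht))
  rw [a3] at h1
  refine h1.trans ?_
  rw [add_assoc]
  refine add_le_add le_rfl (integral_le_of_le_exp hS hR0 ht a2 fun s hs => ?_)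
  have h2 := (hcs s hs).2.2
  have h3 := hR s hs
  have h4 := mul_le_mul_of_nonneg_left (hφ () s hs) hb0
  refine h2.trans ?_
  linarith

/-! ### Pointwise differences of the gain and loss terms -/

theorem inv_mul_pair_le (hΦ : IsDominated Φ ω C) {k x y a b : ℝ} (hx : 0 < x) (hy : 0 < y)
    (hk : k ≤ Φ x y) (ha : 0 ≤ a) (hb : 0 ≤ b) :
    (x + y)⁻¹ * (k * a * b) ≤ C * ((1 + x) * a * (ω y * b)) := by
  rw [inv_mul_le_iff₀ (add_pos hx hy)]
  have := mul_le_mul_of_nonneg_right (hk.trans (hΦ.le_add_mul x y hx hy)) (mul_nonneg ha hb)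
  calc k * a * b = k * (a * b) := by ring
    _ ≤ _ := this
    _ = _ := by ring

theorem pairRate_inv_integrable (hΦ : IsDominated Φ ω C) (hK : IsSubkernel K Φ)
    (hg : IsProfile ω A g) :
    Integrable (fun p : ℝ × ℝ => (p.1 + p.2)⁻¹ * pairRate K g p.1 p.2) quadMeasure := by
  refine integrable_of_le_profile_prod (F := fun x y => (x + y)⁻¹ * pairRate K g x y)
    (c := C * C) hg hg ?_ fun x y hx hy => ?_
  · exact (Measurable.inv (by fun_prop)).mul
      (continuous_pairRate hK.continuous hg.continuous).measurable
  · have hxy := add_pos hx hy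
    rw [abs_of_nonneg (mul_nonneg (inv_nonneg.2 hxy.le) (pairRate_nonneg hK hg hx.le hy.le))]
    refine (inv_mul_pair_le hΦ hx hy (hK.le x y hx.le hy.le) (hg.nonneg x) (hg.nonneg y)).trans ?_
    rw [mul_assoc C C]
    refine mul_le_mul_of_nonneg_left ?_ hΦ.const_nonneg
    have h1 := mul_le_mul_of_nonneg_right (hΦ.le_weight x hx) (hg.nonneg x)
    have h2 := mul_le_mul_of_nonneg_right h1 (mul_nonneg (hΦ.weight_nonneg y hy) (hg.nonneg y))
    linarith

theorem breakOp_integrand_eq {f : ℝ → ℝ → ℝ} {r : ℝ} :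
    r⁻¹ * ∫ y in (0 : ℝ)..r, (1 - e (r - y) y) * f (r - y) y
      = ∫ y in (0 : ℝ)..r, (1 - e (r - y) y) * ((r - y + y)⁻¹ * f (r - y) y) := by
  rw [← intervalIntegral.integral_const_mul]
  refine intervalIntegral.integral_congr fun y _ => ?_
  simp only [sub_add_cancel]
  ring

theorem breakOp_integrand_integrable {f : ℝ → ℝ → ℝ} (he : IsProb e) (hf : Measurable (uncurry f))
    (hi : Integrable (fun p : ℝ × ℝ => (p.1 + p.2)⁻¹ * f p.1 p.2) quadMeasure) :
    Integrable (fun r => r⁻¹ * ∫ y in (0 : ℝ)..r, (1 - e (r - y) y) * f (r - y) y) posMeasure := by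
  simp only [breakOp_integrand_eq]
  refine (integrable_and_integral_triangle
    (F := fun x y => (1 - e x y) * ((x + y)⁻¹ * f x y)) ?_).1
  refine integrable_bdd_mul hi ?_ fun x y _ _ => ?_
  · exact ((measurable_const.sub he.measurable).mul
      ((Measurable.inv (by fun_prop)).mul hf)).aestronglyMeasurable
  · rw [abs_mul]
    exact mul_le_of_le_one_left (abs_nonneg _) (he.abs_one_sub_le x y)

/-- Fragments are uniformly distributed, so a pair contributes to a given size at most (x + y)⁻¹
times its density. Extending the tail integral to (0, ∞) makes the bound uniform in z. -/
theorem abs_breakOp_sub_le {f₁ f₂ : ℝ → ℝ → ℝ} (hec : Continuous (uncurry e)) (he : IsProb e)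
    (hf₁ : Continuous (uncurry f₁)) (hf₂ : Continuous (uncurry f₂))
    (hi₁ : Integrable (fun p : ℝ × ℝ => (p.1 + p.2)⁻¹ * f₁ p.1 p.2) quadMeasure)
    (hi₂ : Integrable (fun p : ℝ × ℝ => (p.1 + p.2)⁻¹ * f₂ p.1 p.2) quadMeasure)
    {z : ℝ} (hz : 0 ≤ z) :
    |breakOp e f₁ z - breakOp e f₂ z|
      ≤ ∫ p, (p.1 + p.2)⁻¹ * |f₁ p.1 p.2 - f₂ p.1 p.2| ∂quadMeasure := by
  have b1 := breakOp_integrand_integrable he hf₁.measurable hi₁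
  have b2 := breakOp_integrand_integrable he hf₂.measurable hi₂
  have hi : Integrable (fun p : ℝ × ℝ => (p.1 + p.2)⁻¹ * |f₁ p.1 p.2 - f₂ p.1 p.2|)
      quadMeasure := by
    refine integrable_bdd_mul (hi₁.sub hi₂) ?_ fun x y _ _ => ?_
    · exact ((Measurable.inv (by fun_prop)).mul
        ((hf₁.sub hf₂).abs.measurable)).aestronglyMeasurable
    · simp only [Pi.sub_apply, ← mul_sub, abs_mul, abs_abs]
      exact le_rfl
  obtain ⟨t1, t2⟩ := integrable_and_integral_triangle
    (F := fun x y => (x + y)⁻¹ * |f₁ x y - f₂ x y|) hi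
  have hsec : ∀ f : ℝ → ℝ → ℝ, Continuous (uncurry f) → ∀ r : ℝ,
      Continuous fun y => f (r - y) y := fun f hf r =>
    hf.comp (f := fun y : ℝ => (r - y, y)) (by fun_prop)
  have hle : ∀ r, 0 < r → |r⁻¹ * (∫ y in (0 : ℝ)..r, (1 - e (r - y) y) * f₁ (r - y) y)
      - r⁻¹ * ∫ y in (0 : ℝ)..r, (1 - e (r - y) y) * f₂ (r - y) y|
      ≤ ∫ y in (0 : ℝ)..r, (r - y + y)⁻¹ * |f₁ (r - y) y - f₂ (r - y) y| := by
    intro r hr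
    have c1 : Continuous fun y => 1 - e (r - y) y := continuous_const.sub (hsec e hec r)
    have d1 := hsec f₁ hf₁ r
    have d2 := hsec f₂ hf₂ r
    have m1 : Continuous fun y => (1 - e (r - y) y) * f₁ (r - y) y := c1.mul d1
    have m2 : Continuous fun y => (1 - e (r - y) y) * f₂ (r - y) y := c1.mul d2
    simp only [sub_add_cancel]
    rw [← mul_sub, ← intervalIntegral.integral_sub (m1.intervalIntegrable _ _)
      (m2.intervalIntegrable _ _), abs_mul, abs_of_pos (inv_pos.2 hr),
      intervalIntegral.integral_const_mul]
    refine mul_le_mul_of_nonneg_left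
      ((intervalIntegral.abs_integral_le_integral_abs hr.le).trans ?_) (inv_pos.2 hr).le
    refine intervalIntegral.integral_mono_on hr.le
      ((m1.sub m2).abs.intervalIntegrable _ _)
      ((d1.sub d2).abs.intervalIntegrable _ _) fun y _ => ?_
    rw [← mul_sub, abs_mul]
    exact mul_le_of_le_one_left (abs_nonneg _) (he.abs_one_sub_le _ _)
  have hzs : Ioi z ⊆ Ioi (0 : ℝ) := Ioi_subset_Ioi hz
  have hb : breakOp e f₁ z - breakOp e f₂ z
      = ∫ r in Ioi z, (r⁻¹ * (∫ y in (0 : ℝ)..r, (1 - e (r - y) y) * f₁ (r - y) y)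
        - r⁻¹ * ∫ y in (0 : ℝ)..r, (1 - e (r - y) y) * f₂ (r - y) y) :=
    (integral_sub (IntegrableOn.mono_set b1 hzs) (IntegrableOn.mono_set b2 hzs)).symm
  rw [hb, ← t2]
  refine (abs_integral_le_integral_abs).trans ?_
  calc ∫ r in Ioi z, |r⁻¹ * (∫ y in (0 : ℝ)..r, (1 - e (r - y) y) * f₁ (r - y) y)
        - r⁻¹ * ∫ y in (0 : ℝ)..r, (1 - e (r - y) y) * f₂ (r - y) y|
      ≤ ∫ r in Ioi (0 : ℝ), |r⁻¹ * (∫ y in (0 : ℝ)..r, (1 - e (r - y) y) * f₁ (r - y) y)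
        - r⁻¹ * ∫ y in (0 : ℝ)..r, (1 - e (r - y) y) * f₂ (r - y) y| :=
        setIntegral_mono_set (b1.sub b2).abs (ae_of_all _ fun _ => abs_nonneg _) hzs.eventuallyLE
    _ ≤ _ := integral_mono_ae (b1.sub b2).abs t1 (ae_posMeasure hle)

theorem abs_pairRate_sub_le (hK₁ : IsSubkernel K₁ Φ)
    (hg : IsProfile ω A g) (hh : IsProfile ω B h) {x y : ℝ} (hx : 0 ≤ x) (hy : 0 ≤ y) :
    |pairRate K₁ g x y - pairRate K₂ h x y|
      ≤ 1 / 2 * (K₁ x y * |g x - h x| * (g y + h y) + K₁ y x * |g y - h y| * (g x + h x))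
        + |K₁ x y - K₂ x y| * (h x * h y) := by
  have hk0 := hK₁.nonneg x y hx hy
  have hsx := add_nonneg (hg.nonneg x) (hh.nonneg x)
  have hsy := add_nonneg (hg.nonneg y) (hh.nonneg y)
  have hhh := mul_nonneg (hh.nonneg x) (hh.nonneg y)
  rw [pairRate_sub, hK₁.symm y x hy hx]
  refine (abs_add_le _ _).trans (add_le_add ?_ ?_)
  · rw [abs_mul, abs_of_nonneg (by positivity : 0 ≤ 1 / 2 * K₁ x y)]
    have h1 : |(g x - h x) * (g y + h y) + (g x + h x) * (g y - h y)|
        ≤ |g x - h x| * (g y + h y) + (g x + h x) * |g y - h y| := by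
      refine (abs_add_le _ _).trans (le_of_eq ?_)
      rw [abs_mul, abs_mul (g x + h x), abs_of_nonneg hsx, abs_of_nonneg hsy]
    have := mul_le_mul_of_nonneg_left h1 (by positivity : 0 ≤ 1 / 2 * K₁ x y)
    linarith
  · rw [abs_mul, abs_of_nonneg hhh]

/-- The singular factor is absorbed by Φ ≤ C (x + y)(1 + x) ω(y) in the part containing g - h, and
by the factor x + y of the kernel error in the other part. -/
theorem integral_inv_mul_abs_sub_le {ε : ℝ} (hΦ : IsDominated Φ ω C) (hK₁ : IsSubkernel K₁ Φ)
    (hg : IsProfile ω A g) (hh : IsProfile ω B h) (hε : 0 ≤ ε)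
    (hd : ∀ x y, 0 ≤ x → 0 ≤ y → |K₁ x y - K₂ x y| ≤ ε * ((x + y) * Φ x y)) :
    ∫ p, (p.1 + p.2)⁻¹ * |pairRate K₁ g p.1 p.2 - pairRate K₂ h p.1 p.2| ∂quadMeasure
      ≤ C * (A + B) * profileDist g h + ε * (C * (B * B)) := by
  have hs := hg.add hh
  have hC := hΦ.const_nonneg
  have hB := IsProfile.const_nonneg hΦ hh
  set F : ℝ → ℝ → ℝ := fun x y => C * ((1 + x) * |g x - h x| * (ω y * (g y + h y))) with hF
  have hFi : Integrable (fun p : ℝ × ℝ => F p.1 p.2) quadMeasure :=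
    ((profileDist_integrable hΦ hg hh).mul_prod hs.integrable).const_mul C
  have hFe : ∫ p, F p.1 p.2 ∂quadMeasure ≤ C * (A + B) * profileDist g h := by
    have h1 : ∫ p : ℝ × ℝ, (1 + p.1) * |g p.1 - h p.1| * (ω p.2 * (g p.2 + h p.2)) ∂quadMeasure
        = profileDist g h * ∫ z, ω z * (g z + h z) ∂posMeasure :=
      integral_prod_mul (fun z => (1 + z) * |g z - h z|) fun z => ω z * (g z + h z)
    rw [hF, integral_const_mul, h1]
    have := mul_le_mul_of_nonneg_left hs.integral_le (mul_nonneg hC (profileDist_nonneg g h))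
    linarith
  set H : ℝ → ℝ → ℝ := fun x y => ε * (C * (ω x * h x * (ω y * h y))) with hH
  have hHi : Integrable (fun p : ℝ × ℝ => H p.1 p.2) quadMeasure :=
    ((hh.integrable.mul_prod hh.integrable).const_mul C).const_mul ε
  have hHe : ∫ p, H p.1 p.2 ∂quadMeasure ≤ ε * (C * (B * B)) := by
    have h1 : ∫ p : ℝ × ℝ, ω p.1 * h p.1 * (ω p.2 * h p.2) ∂quadMeasure
        = (∫ z, ω z * h z ∂posMeasure) * ∫ z, ω z * h z ∂posMeasure :=
      integral_prod_mul (fun z => ω z * h z) fun z => ω z * h z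
    have h2 : 0 ≤ ∫ z, ω z * h z ∂posMeasure := integral_nonneg_of_ae (ae_posMeasure fun z hz =>
      mul_nonneg (hΦ.weight_nonneg z hz) (hh.nonneg z))
    rw [hH, integral_const_mul, integral_const_mul, h1]
    have := hh.integral_le
    gcongr
  have hFi' : Integrable (fun p : ℝ × ℝ => F p.2 p.1) quadMeasure := integrable_swap_quad.2 hFi
  have hmain : ∫ p, (p.1 + p.2)⁻¹ * |pairRate K₁ g p.1 p.2 - pairRate K₂ h p.1 p.2| ∂quadMeasure
      ≤ ∫ p, (1 / 2 * F p.1 p.2 + 1 / 2 * F p.2 p.1 + H p.1 p.2) ∂quadMeasure := by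
    refine integral_mono_of_nonneg (ae_quadMeasure fun x y hx hy =>
      mul_nonneg (inv_nonneg.2 (add_pos hx hy).le) (abs_nonneg _))
      (((hFi.const_mul _).add (hFi'.const_mul _)).add hHi) (ae_quadMeasure fun x y hx hy => ?_)
    have hxy := add_pos hx hy
    have hk : ∀ x y, 0 < x → 0 < y →
        (x + y)⁻¹ * (K₁ x y * |g x - h x| * (g y + h y)) ≤ F x y := fun x y hx hy =>
      inv_mul_pair_le hΦ hx hy (hK₁.le x y hx.le hy.le) (abs_nonneg _) (hs.nonneg y)
    have h1 := hk x y hx hy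
    have h2 := hk y x hy hx
    rw [add_comm y x] at h2
    have h3 : (x + y)⁻¹ * (|K₁ x y - K₂ x y| * (h x * h y)) ≤ H x y := by
      have hhh := mul_nonneg (hh.nonneg x) (hh.nonneg y)
      rw [inv_mul_le_iff₀ hxy]
      have p1 := mul_le_mul_of_nonneg_right (hd x y hx.le hy.le) hhh
      have hΦ0 : 0 ≤ Φ x y := (hK₁.nonneg x y hx.le hy.le).trans (hK₁.le x y hx.le hy.le)
      have p2 := mul_pair_le hΦ hx hy le_rfl (hh.nonneg x) (hh.nonneg y)
      have p3 : Φ x y * h x * h y ≤ (1 + x) * (1 + y) * (Φ x y * h x * h y) := by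
        refine le_mul_of_one_le_left (mul_nonneg (mul_nonneg hΦ0 (hh.nonneg x)) (hh.nonneg y)) ?_
        nlinarith [mul_pos hx hy]
      have p4 := mul_le_mul_of_nonneg_left (p3.trans p2) (mul_nonneg hε hxy.le)
      simp only [hH]
      linarith
    have h4 := mul_le_mul_of_nonneg_left (abs_pairRate_sub_le (K₂ := K₂) hK₁ hg hh hx.le hy.le)
      (inv_nonneg.2 hxy.le)
    refine h4.trans ?_
    simp only
    linarith
  have hsw := integral_swap_quad F
  clear_value F H
  rw [integral_add₃ (hFi.const_mul _) (hFi'.const_mul _) hHi, integral_const_mul,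
    integral_const_mul, hsw] at hmain
  linarith

/-- Coalescence into size z ≤ Z only involves pairs of total size z, where the two kernels agree.
One factor is bounded by S and the other integrates to the distance; the two halves add up to k S
times it. -/
theorem abs_coagOp_sub_le {k S Z z : ℝ} (hec : Continuous (uncurry e)) (he : IsProb e)
    (hΦ : IsDominated Φ ω C) (hK₁ : IsSubkernel K₁ Φ)
    (hg : IsProfile ω A g) (hh : IsProfile ω B h) (hz : z ∈ Icc 0 Z)
    (hk : ∀ x ∈ Icc 0 Z, ∀ y ∈ Icc 0 Z, K₁ x y ≤ k)
    (heq : ∀ x y, 0 ≤ x → 0 ≤ y → x + y ≤ Z → K₂ x y = K₁ x y)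
    (hgS : ∀ x ∈ Icc 0 Z, g x ≤ S) (hhS : ∀ x ∈ Icc 0 Z, h x ≤ S) :
    |coagOp e (pairRate K₁ g) z - coagOp e (pairRate K₂ h) z| ≤ k * S * profileDist g h := by
  obtain ⟨hz0, hzZ⟩ := hz
  have hZ : (0 : ℝ) ∈ Icc 0 Z := ⟨le_rfl, hz0.trans hzZ⟩
  have hk0 : 0 ≤ k := (hK₁.nonneg 0 0 le_rfl le_rfl).trans (hk 0 hZ 0 hZ)
  have hS0 : 0 ≤ S := (hg.nonneg 0).trans (hgS 0 hZ)
  set u : ℝ → ℝ := fun x => |g x - h x| with hu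
  have huc : Continuous u := (hg.continuous.sub hh.continuous).abs
  have hec' : Continuous fun p : ℝ × ℝ => e p.1 p.2 := hec
  have hKc : Continuous fun p : ℝ × ℝ => K₁ p.1 p.2 := hK₁.continuous
  have hgc := hg.continuous
  have hhc := hh.continuous
  have m0 : Continuous fun y => e (z - y) y :=
    hec'.comp (f := fun y : ℝ => (z - y, y)) (by fun_prop)
  have m1 : Continuous fun y => K₁ (z - y) y :=
    hKc.comp (f := fun y : ℝ => (z - y, y)) (by fun_prop)
  have hcong : ∫ y in (0 : ℝ)..z, e (z - y) y * pairRate K₂ h (z - y) y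
      = ∫ y in (0 : ℝ)..z, e (z - y) y * pairRate K₁ h (z - y) y := by
    refine intervalIntegral.integral_congr fun y hy => ?_
    rw [uIcc_of_le hz0] at hy
    simp only [pairRate]
    rw [heq (z - y) y (by linarith [hy.2]) hy.1 (by linarith)]
  have i1 : Continuous fun y => e (z - y) y * pairRate K₁ g (z - y) y := by
    unfold pairRate; fun_prop
  have i2 : Continuous fun y => e (z - y) y * pairRate K₁ h (z - y) y := by
    unfold pairRate; fun_prop
  rw [coagOp, coagOp, hcong, ← mul_sub, ← intervalIntegral.integral_sub
    (i1.intervalIntegrable _ _) (i2.intervalIntegrable _ _), abs_mul,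
    abs_of_pos (by norm_num : (0 : ℝ) < 1 / 2)]
  have hle : |∫ y in (0 : ℝ)..z, (e (z - y) y * pairRate K₁ g (z - y) y
      - e (z - y) y * pairRate K₁ h (z - y) y)|
      ≤ ∫ y in (0 : ℝ)..z, (k * S * u (z - y) + k * S * u y) := by
    refine (intervalIntegral.abs_integral_le_integral_abs hz0).trans
      (intervalIntegral.integral_mono_on hz0 ((i1.sub i2).abs.intervalIntegrable _ _)
        (Continuous.intervalIntegrable (by fun_prop) _ _) fun y hy => ?_)
    have hx : z - y ∈ Icc 0 Z := ⟨by linarith [hy.2], by linarith [hy.1]⟩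
    have hy' : y ∈ Icc 0 Z := ⟨hy.1, hy.2.trans hzZ⟩
    have hK0 := hK₁.nonneg (z - y) y hx.1 hy.1
    have hKk := hk _ hx _ hy'
    have hid : pairRate K₁ g (z - y) y - pairRate K₁ h (z - y) y
        = K₁ (z - y) y * ((g (z - y) - h (z - y)) * g y + h (z - y) * (g y - h y)) := by
      unfold pairRate; ring
    rw [← mul_sub, abs_mul]
    refine (mul_le_of_le_one_left (abs_nonneg _) (he.abs_le _ _)).trans ?_
    rw [hid, abs_mul, abs_of_nonneg hK0]
    have h1 : |(g (z - y) - h (z - y)) * g y + h (z - y) * (g y - h y)|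
        ≤ S * u (z - y) + S * u y := by
      refine (abs_add_le _ _).trans ?_
      rw [abs_mul, abs_mul, abs_of_nonneg (hg.nonneg y), abs_of_nonneg (hh.nonneg (z - y)),
        mul_comm _ (g y)]
      exact add_le_add (mul_le_mul_of_nonneg_right (hgS y hy') (abs_nonneg _))
        (mul_le_mul_of_nonneg_right (hhS _ hx) (abs_nonneg _))
    refine (mul_le_mul hKk h1 (abs_nonneg _) hk0).trans (le_of_eq (by ring))
  have hsub : ∫ y in (0 : ℝ)..z, u (z - y) = ∫ y in (0 : ℝ)..z, u y := by
    rw [intervalIntegral.integral_comp_sub_left u z]; simp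
  have hux : Continuous fun y => u (z - y) := by fun_prop
  rw [intervalIntegral.integral_add ((hux.const_mul (k * S)).intervalIntegrable _ _)
    ((huc.const_mul (k * S)).intervalIntegrable _ _), intervalIntegral.integral_const_mul,
    intervalIntegral.integral_const_mul, hsub] at hle
  have hd : ∫ y in (0 : ℝ)..z, u y ≤ profileDist g h := by
    have hi := profileDist_integrable hΦ hg hh
    rw [intervalIntegral.integral_of_le hz0]
    calc ∫ y in Ioc 0 z, u y ≤ ∫ y in Ioc 0 z, (1 + y) * |g y - h y| := by
          refine setIntegral_mono_on (huc.integrableOn_Ioc)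
            (Continuous.integrableOn_Ioc (by fun_prop)) measurableSet_Ioc fun y hy => ?_
          exact le_mul_of_one_le_left (abs_nonneg _) (by linarith [hy.1])
      _ ≤ _ := setIntegral_mono_set hi
          (ae_posMeasure fun y hy => mul_nonneg (by linarith) (abs_nonneg _))
          Ioc_subset_Ioi_self.eventuallyLE
  have := mul_le_mul_of_nonneg_left hd (mul_nonneg hk0 hS0)
  linarith

/-- The rate at which particles of size `z` are lost. -/
def lossRate (K : ℝ → ℝ → ℝ) (g : ℝ → ℝ) (z : ℝ) : ℝ := ∫ y, K z y * g y ∂posMeasure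

theorem lossOp_pairRate (z : ℝ) : lossOp (pairRate K g) z = g z * lossRate K g z := by
  rw [lossRate, ← integral_const_mul]
  exact integral_congr_ae (ae_of_all _ fun y => by simp only [pairRate]; ring)

theorem lossRate_integrable (hΦ : IsDominated Φ ω C) (hK : IsSubkernel K Φ)
    (hg : IsProfile ω A g) {z : ℝ} (hz : 0 ≤ z) :
    Integrable (fun y => K z y * g y) posMeasure ∧ 0 ≤ lossRate K g z ∧
      lossRate K g z ≤ C * (1 + z) * A := by
  have hKc : Continuous fun p : ℝ × ℝ => K p.1 p.2 := hK.continuous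
  have hgc := hg.continuous
  have hle : ∀ y, 0 < y → K z y * g y ≤ C * (1 + z) * (ω y * g y) := fun y hy => by
    have h0 := hK.nonneg z y hz hy.le
    have h1 := (hK.le z y hz hy.le)
    have h2 : Φ z y ≤ Φ z y * (1 + y) := le_mul_of_one_le_right (h0.trans h1) (by linarith)
    have h3 := mul_le_mul_of_nonneg_right ((h1.trans h2).trans (hΦ.mul_right_le z y hz hy))
      (hg.nonneg y)
    linarith
  have hn : ∀ y, 0 < y → 0 ≤ K z y * g y := fun y hy =>
    mul_nonneg (hK.nonneg z y hz hy.le) (hg.nonneg y)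
  have hi : Integrable (fun y => K z y * g y) posMeasure := by
    refine integrable_of_le_profile hg (c := C * (1 + z)) ?_ fun y hy => ?_
    · have : Continuous fun y => K z y := hKc.comp (f := fun y : ℝ => (z, y)) (by fun_prop)
      exact (this.mul hgc).aestronglyMeasurable
    · rw [abs_of_nonneg (hn y hy)]; exact hle y hy
  refine ⟨hi, integral_nonneg_of_ae (ae_posMeasure hn), ?_⟩
  refine (integral_mono_ae hi (hg.integrable.const_mul (C * (1 + z))) (ae_posMeasure hle)).trans ?_
  rw [integral_const_mul]
  exact mul_le_mul_of_nonneg_left hg.integral_le (mul_nonneg hΦ.const_nonneg (by linarith))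

/-- At fixed z the kernel grows at most linearly in y, so the weight 1 + y of the distance suffices.
-/
theorem abs_lossRate_sub_le {ε z : ℝ} (hΦ : IsDominated Φ ω C) (hK₁ : IsSubkernel K₁ Φ)
    (hK₂ : IsSubkernel K₂ Φ) (hg : IsProfile ω A g) (hh : IsProfile ω B h) (hε : 0 ≤ ε)
    (hd : ∀ x y, 0 ≤ x → 0 ≤ y → |K₁ x y - K₂ x y| ≤ ε * ((x + y) * Φ x y)) (hz : 0 ≤ z) :
    |lossRate K₁ g z - lossRate K₂ h z|
      ≤ C * (1 + z) * profileDist g h + ε * (C * (1 + z) ^ 2 * B) := by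
  have i1 := (lossRate_integrable hΦ hK₁ hg hz).1
  have i2 := (lossRate_integrable hΦ hK₂ hh hz).1
  have hC := hΦ.const_nonneg
  have hD := profileDist_integrable hΦ hg hh
  rw [lossRate, lossRate, ← integral_sub i1 i2]
  refine abs_integral_le_integral_abs.trans ?_
  have hmono : ∫ y, |K₁ z y * g y - K₂ z y * h y| ∂posMeasure
      ≤ ∫ y, (C * (1 + z) * ((1 + y) * |g y - h y|) + ε * (C * (1 + z) ^ 2) * (ω y * h y))
        ∂posMeasure := by
    refine integral_mono_ae (i1.sub i2).abs ((hD.const_mul _).add (hh.integrable.const_mul _))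
      (ae_posMeasure fun y hy => ?_)
    have hΦ0 : 0 ≤ Φ z y := (hK₁.nonneg z y hz hy.le).trans (hK₁.le z y hz hy.le)
    have e0 : K₁ z y * g y - K₂ z y * h y = K₁ z y * (g y - h y) + (K₁ z y - K₂ z y) * h y := by
      ring
    simp only
    rw [e0]
    refine (abs_add_le _ _).trans (add_le_add ?_ ?_)
    · rw [abs_mul, abs_of_nonneg (hK₁.nonneg z y hz hy.le)]
      have := mul_le_mul_of_nonneg_right ((hK₁.le z y hz hy.le).trans (hΦ.le_mul z y hz hy.le))
        (abs_nonneg (g y - h y))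
      linarith
    · rw [abs_mul, abs_of_nonneg (hh.nonneg y)]
      have h1 := hd z y hz hy.le
      have h2 : (z + y) * Φ z y ≤ (1 + z) * (1 + y) * Φ z y := by
        refine mul_le_mul_of_nonneg_right ?_ hΦ0
        nlinarith [mul_nonneg hz hy.le]
      have h3 := mul_le_mul_of_nonneg_left (hΦ.mul_right_le z y hz hy) (by linarith : 0 ≤ 1 + z)
      have h4 : (z + y) * Φ z y ≤ C * (1 + z) ^ 2 * ω y := by linarith
      have h5 := mul_le_mul_of_nonneg_right (h1.trans (mul_le_mul_of_nonneg_left h4 hε))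
        (hh.nonneg y)
      linarith
  refine hmono.trans ?_
  rw [integral_add (hD.const_mul _) (hh.integrable.const_mul _), integral_const_mul,
    integral_const_mul]
  have := mul_le_mul_of_nonneg_left hh.integral_le
    (mul_nonneg hε (mul_nonneg hC (sq_nonneg (1 + z))))
  unfold profileDist
  linarith

end

section

variable {e Φ : ℝ → ℝ → ℝ} {ω g₀ : ℝ → ℝ} {C A T : ℝ}

/-! ### Passing to the limit in a sequence of mild solutions -/

/-- A constant in the pointwise comparison of two collision operators on `[0, Z]`. -/
def diffConst (C A S Z : ℝ) : ℝ :=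
  C * (1 + Z) ^ 2 * S + C * (A + A) + C * (A * A) + S * (C * (1 + Z)) + S * (C * (1 + Z) ^ 2 * A)

theorem diffConst_nonneg {S Z : ℝ} (hC : 0 ≤ C) (hA : 0 ≤ A) (hS : 0 ≤ S) (hZ : 0 ≤ Z) :
    0 ≤ diffConst C A S Z := by
  unfold diffConst; positivity

/-- The loss difference splits as (g - h) L₁ + h (L₁ - L₂), with L₁, L₂ the two loss rates. The L¹
distance does not control (g - h)(z), so the first part is moved to the left-hand side; it acts as
damping. -/
theorem abs_collisionOp_sub_add_le {K₁ K₂ : ℝ → ℝ → ℝ} {g h : ℝ → ℝ} {ε S Z z : ℝ}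
    (hec : Continuous (uncurry e)) (he : IsProb e)
    (hΦ : IsDominated Φ ω C) (hK₁ : IsSubkernel K₁ Φ) (hK₂ : IsSubkernel K₂ Φ)
    (hg : IsProfile ω A g) (hh : IsProfile ω A h) (hε : 0 ≤ ε)
    (hd : ∀ x y, 0 ≤ x → 0 ≤ y → |K₁ x y - K₂ x y| ≤ ε * ((x + y) * Φ x y)) (hz : z ∈ Icc 0 Z)
    (heq : ∀ x y, 0 ≤ x → 0 ≤ y → x + y ≤ Z → K₂ x y = K₁ x y)
    (hgS : ∀ x ∈ Icc 0 Z, g x ≤ S) (hhS : ∀ x ∈ Icc 0 Z, h x ≤ S) :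
    |collisionOp e (pairRate K₁ g) z - collisionOp e (pairRate K₂ h) z
      + (g z - h z) * lossRate K₁ g z| ≤ diffConst C A S Z * (profileDist g h + ε) := by
  have hC := hΦ.const_nonneg
  have hA := IsProfile.const_nonneg hΦ hg
  have hZ : 0 ≤ Z := hz.1.trans hz.2
  have hS : 0 ≤ S := (hg.nonneg 0).trans (hgS 0 ⟨le_rfl, hZ⟩)
  have hD := profileDist_nonneg g h
  have h1 := abs_coagOp_sub_le (k := C * (1 + Z) ^ 2) hec he hΦ hK₁ hg hh hz
    (fun x hx y hy => (hK₁.le x y hx.1 hy.1).trans ((hΦ.le_mul x y hx.1 hy.1).trans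
      (mul_le_mul_of_nonneg_left (by nlinarith [hx.1, hx.2, hy.1, hy.2]) hC))) heq hgS hhS
  have h2 := (abs_breakOp_sub_le hec he (continuous_pairRate hK₁.continuous hg.continuous)
    (continuous_pairRate hK₂.continuous hh.continuous) (pairRate_inv_integrable hΦ hK₁ hg)
    (pairRate_inv_integrable hΦ hK₂ hh) hz.1).trans
    (integral_inv_mul_abs_sub_le hΦ hK₁ hg hh hε hd)
  have h3 : |h z * (lossRate K₁ g z - lossRate K₂ h z)|
      ≤ S * (C * (1 + Z) * profileDist g h + ε * (C * (1 + Z) ^ 2 * A)) := by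
    rw [abs_mul, abs_of_nonneg (hh.nonneg z)]
    refine mul_le_mul (hhS z hz) ((abs_lossRate_sub_le hΦ hK₁ hK₂ hg hh hε hd hz.1).trans ?_)
      (abs_nonneg _) hS
    have := hz.1
    have := hz.2
    gcongr
  have hid : collisionOp e (pairRate K₁ g) z - collisionOp e (pairRate K₂ h) z
      + (g z - h z) * lossRate K₁ g z
      = (coagOp e (pairRate K₁ g) z - coagOp e (pairRate K₂ h) z)
        + (breakOp e (pairRate K₁ g) z - breakOp e (pairRate K₂ h) z)
        - h z * (lossRate K₁ g z - lossRate K₂ h z) := by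
    simp only [collisionOp, lossOp_pairRate]; ring
  rw [hid]
  refine (abs_sub _ _).trans ((add_le_add ((abs_add_le _ _).trans (add_le_add h1 h2)) h3).trans ?_)
  unfold diffConst
  have p1 : 0 ≤ C * (1 + Z) ^ 2 * S * ε := by positivity
  have p2 : 0 ≤ C * (A + A) * ε := by positivity
  have p3 : 0 ≤ C * (A * A) * profileDist g h := by positivity
  have p4 : 0 ≤ S * (C * (1 + Z)) * ε := by positivity
  have p5 : 0 ≤ S * (C * (1 + Z) ^ 2 * A) * profileDist g h := by positivity
  linarith

theorem abs_le_of_sgn_mul_le {u q : ℝ → ℝ} {B : ℝ} (hB : 0 ≤ B) (hum : Measurable u)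
    (hq : ContinuousOn q (Icc 0 T)) (hu : ∀ t ∈ Icc 0 T, u t = u 0 + ∫ s in (0 : ℝ)..t, q s)
    (hle : ∀ s ∈ Icc 0 T, sgn (u s) * q s ≤ B) {t : ℝ} (ht : t ∈ Icc 0 T) :
    |u t| ≤ |u 0| + T * B := by
  refine (abs_le_add_integral_sgn hq hu ht).trans (add_le_add le_rfl ?_)
  have hsub : uIcc 0 t ⊆ Icc 0 T := by
    rw [uIcc_of_le ht.1]; exact Icc_subset_Icc_right ht.2
  have hqi : IntervalIntegrable q volume 0 t := (hq.mono hsub).intervalIntegrable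
  have hi : IntervalIntegrable (fun s => sgn (u s) * q s) volume 0 t := by
    refine hqi.mono_fun ((measurable_sgn.comp hum).aestronglyMeasurable.mul
      hqi.aestronglyMeasurable_restrict_uIoc) (ae_of_all _ fun s => ?_)
    simp only [norm_mul]
    exact mul_le_of_le_one_left (norm_nonneg _) (abs_sgn_le _)
  have h1 := intervalIntegral.integral_mono_on ht.1 hi
    (intervalIntegrable_const (c := B)) fun s hs => hle s ⟨hs.1, hs.2.trans ht.2⟩
  rw [intervalIntegral.integral_const, smul_eq_mul, sub_zero] at h1
  exact h1.trans (mul_le_mul_of_nonneg_right ht.2 hB)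

theorem IsMild.continuousOn_section {e K : ℝ → ℝ → ℝ} {g : ℝ → ℝ → ℝ} (hg : IsMild e K T g) {z : ℝ}
    (hz : 0 ≤ z) :
    ContinuousOn (fun s => collisionOp e (pairRate K fun x => g x s) z) (Icc 0 T) :=
  hg.continuousOn_op.comp (f := fun s => (z, s)) (by fun_prop) fun _ hs => ⟨hz, hs⟩

/-- Mild solutions for kernels tending to `Φ` that form a Cauchy sequence in `L¹`. -/
structure IsApproximation (e Φ : ℝ → ℝ → ℝ) (ω : ℝ → ℝ) (C A T : ℝ) (g₀ : ℝ → ℝ)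
    (K g : ℕ → ℝ → ℝ → ℝ) (η ε : ℕ → ℝ) : Prop where
  continuous : Continuous (uncurry e)
  isProb : IsProb e
  isDominated : IsDominated Φ ω C
  isSubkernel_self : IsSubkernel Φ Φ
  isSubkernel : ∀ n, IsSubkernel (K n) Φ
  isMild : ∀ n, IsMild e (K n) T (g n)
  isProfile : ∀ n, ∀ t ∈ Icc 0 T, IsProfile ω A fun z => g n z t
  dist_le : ∀ n m, ∀ t ∈ Icc 0 T,
    profileDist (fun z => g n z t) (fun z => g m z t) ≤ η n + η m
  tendsto_dist : Tendsto η atTop (𝓝 0)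
  error_nonneg : ∀ n, 0 ≤ ε n
  abs_sub_le : ∀ n x y, 0 ≤ x → 0 ≤ y → |K n x y - Φ x y| ≤ ε n * ((x + y) * Φ x y)
  tendsto_error : Tendsto ε atTop (𝓝 0)
  eventually_eq : ∀ Z, ∀ᶠ n in atTop, ∀ x y, 0 ≤ x → 0 ≤ y → x + y ≤ Z → K n x y = Φ x y
  exists_bound : ∀ Z, ∃ S, ∀ n, ∀ t ∈ Icc 0 T, ∀ z ∈ Icc 0 Z, g n z t ≤ S
  eventually_initial : ∀ Z, ∀ᶠ n in atTop, ∀ z ∈ Icc 0 Z, g n z 0 = g₀ z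

variable {K g : ℕ → ℝ → ℝ → ℝ} {η ε : ℕ → ℝ}

/-- Passage from L¹ to uniform bounds on [0, Z]. At fixed size u = g n - g m satisfies u' = -L u +
error with L ≥ 0, the error being a multiple of η + ε; the damping is dropped and u(0) = 0 once the
truncations exceed Z. -/
theorem IsApproximation.exists_cauchy (ha : IsApproximation e Φ ω C A T g₀ K g η ε) (hT : 0 ≤ T)
    {Z : ℝ} (hZ : 0 ≤ Z) : ∃ b : ℕ → ℝ, Tendsto b atTop (𝓝 0) ∧ ∀ᶠ N in atTop, ∀ n ≥ N, ∀ m ≥ N,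
      ∀ t ∈ Icc 0 T, ∀ z ∈ Icc 0 Z, |g n z t - g m z t| ≤ b n + b m := by
  obtain ⟨S, hS⟩ := ha.exists_bound Z
  have h0T : (0 : ℝ) ∈ Icc 0 T := ⟨le_rfl, hT⟩
  have hA := IsProfile.const_nonneg ha.isDominated (ha.isProfile 0 0 h0T)
  have hS0 : 0 ≤ S := ((ha.isMild 0).nonneg 0 0).trans (hS 0 0 h0T 0 ⟨le_rfl, hZ⟩)
  set M := diffConst C A S Z with hM
  have hM0 : 0 ≤ M := diffConst_nonneg ha.isDominated.const_nonneg hA hS0 hZ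
  refine ⟨fun n => T * (M * (η n + ε n)), ?_, ?_⟩
  · have := ((ha.tendsto_dist.add ha.tendsto_error).const_mul M).const_mul T
    simpa using this
  have hev := (ha.eventually_eq Z).and (ha.eventually_initial Z)
  filter_upwards [eventually_forall_ge_atTop.2 hev] with N hN n hn m hm t ht z hz
  obtain ⟨en, hin⟩ := hN n hn
  obtain ⟨em, him⟩ := hN m hm
  have hmn := ha.isMild n
  have hmm := ha.isMild m
  have hε0 := add_nonneg (ha.error_nonneg n) (ha.error_nonneg m)
  have hd : ∀ x y, 0 ≤ x → 0 ≤ y → |K n x y - K m x y| ≤ (ε n + ε m) * ((x + y) * Φ x y) := by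
    intro x y hx hy
    have h1 := ha.abs_sub_le n x y hx hy
    have h2 := ha.abs_sub_le m x y hx hy
    rw [abs_sub_comm] at h2
    have := _root_.abs_sub_le (K n x y) (Φ x y) (K m x y)
    linarith
  have hη := fun s hs => (profileDist_nonneg _ _).trans (ha.dist_le n m s hs)
  set q : ℝ → ℝ := fun s => collisionOp e (pairRate (K n) fun x => g n x s) z
    - collisionOp e (pairRate (K m) fun x => g m x s) z with hq
  have hqc : ContinuousOn q (Icc 0 T) :=
    (hmn.continuousOn_section hz.1).sub (hmm.continuousOn_section hz.1)
  have hu : ∀ t ∈ Icc 0 T, g n z t - g m z t = (g n z 0 - g m z 0) + ∫ s in (0 : ℝ)..t, q s := by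
    intro t ht
    have hsub : uIcc 0 t ⊆ Icc 0 T := by
      rw [uIcc_of_le ht.1]; exact Icc_subset_Icc_right ht.2
    rw [hmn.eq_add_integral z hz.1 t ht, hmm.eq_add_integral z hz.1 t ht, hq]
    simp only [collisionRate_eq_pairRate]
    rw [intervalIntegral.integral_sub
      ((hmn.continuousOn_section hz.1).mono hsub).intervalIntegrable
      ((hmm.continuousOn_section hz.1).mono hsub).intervalIntegrable]
    ring
  have hsec : ∀ k, Continuous fun s => g k z s := fun k =>
    (ha.isMild k).continuous.comp (f := fun s => (z, s)) (by fun_prop)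
  have h := abs_le_of_sgn_mul_le (u := fun t => g n z t - g m z t)
    (B := M * ((η n + η m) + (ε n + ε m)))
    (mul_nonneg hM0 (add_nonneg (hη t ht) hε0)) ((hsec n).sub (hsec m)).measurable hqc hu
    (fun s hs => ?_) ht
  · rw [hin z hz, him z hz, sub_self, abs_zero] at h
    linarith
  · have h1 := abs_collisionOp_sub_add_le ha.continuous ha.isProb ha.isDominated
      (ha.isSubkernel n) (ha.isSubkernel m) (ha.isProfile n s hs) (ha.isProfile m s hs) hε0 hd hz
      (fun x y hx hy hxy => by rw [en x y hx hy hxy, em x y hx hy hxy])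
      (fun x hx => hS n s hs x hx) (fun x hx => hS m s hs x hx)
    have h2 := (lossRate_integrable ha.isDominated (ha.isSubkernel n) (ha.isProfile n s hs)
      hz.1).2.1
    set L := lossRate (K n) (fun z => g n z s) z
    set u := g n z s - g m z s
    -- The term |u| L is non-negative and is discarded; what remains is covered by the comparison of
    -- operators.
    have h3 : sgn u * q s = sgn u * (q s + u * L) - |u| * L := by
      rw [← sgn_mul_self u]; ring
    rw [h3]
    have h4 : sgn u * (q s + u * L) ≤ |q s + u * L| := by
      refine (le_abs_self _).trans ?_
      rw [abs_mul]
      exact mul_le_of_le_one_left (abs_nonneg _) (abs_sgn_le _)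
    have h5 := mul_nonneg (abs_nonneg u) h2
    have h6 := mul_le_mul_of_nonneg_left
      (add_le_add_left (ha.dist_le n m s hs) (ε n + ε m)) hM0
    linarith

/-- Locally uniform convergence carries over continuity, Fatou carries over the ω-moment, and the
comparison of operators shows that the right-hand sides converge locally uniformly too. The
integrated equation therefore passes to the limit. -/
theorem IsApproximation.exists_limit (ha : IsApproximation e Φ ω C A T g₀ K g η ε) (hT : 0 ≤ T) :
    ∃ G : ℝ → ℝ → ℝ, IsMild e Φ T G ∧ (∀ t ∈ Icc 0 T, IsProfile ω A fun z => G z t) ∧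
      ∀ z, 0 ≤ z → G z 0 = g₀ z := by
  have h0T : (0 : ℝ) ∈ Icc 0 T := ⟨le_rfl, hT⟩
  have hA := IsProfile.const_nonneg ha.isDominated (ha.isProfile 0 0 h0T)
  have hC := ha.isDominated.const_nonneg
  set F : ℕ → ℝ → ℝ → ℝ := fun n z t => g n (max 0 z) (clamp T t) with hF
  have hcl : ∀ t, clamp T t ∈ Icc 0 T := fun t => ⟨clamp_nonneg T t, clamp_le hT t⟩
  have hFc : ∀ n, Continuous (uncurry (F n)) := fun n =>
    (ha.isMild n).continuous.comp (f := fun p : ℝ × ℝ => (max 0 p.1, clamp T p.2))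
      (by have := continuous_clamp T; fun_prop)
  have hFs : ∀ n z t, 0 ≤ z → t ∈ Icc 0 T → F n z t = g n z t := fun n z t hz ht => by
    simp only [hF, max_eq_right hz, clamp_of_mem ht.1 ht.2]
  have hcau : ∀ Z, 0 ≤ Z → ∃ b : ℕ → ℝ, Tendsto b atTop (𝓝 0) ∧ ∀ᶠ N in atTop,
      ∀ n ≥ N, ∀ m ≥ N, ∀ z ≤ Z, ∀ t, |F n z t - F m z t| ≤ b n + b m := by
    intro Z hZ
    obtain ⟨b, hb, hN⟩ := ha.exists_cauchy hT hZ
    refine ⟨b, hb, hN.mono fun N hN n hn m hm z hz t => ?_⟩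
    exact hN n hn m hm _ (hcl t) _ ⟨le_max_left _ _, max_le hZ hz⟩
  have hlim : ∀ z t, ∃ l, Tendsto (fun n => F n z t) atTop (𝓝 l) := by
    intro z t
    obtain ⟨b, hb, hN⟩ := hcau (max 0 z) (le_max_left _ _)
    refine cauchySeq_tendsto_of_complete (Metric.cauchySeq_iff.2 fun δ hδ => ?_)
    have hb' := eventually_forall_ge_atTop.2 (hb.eventually (gt_mem_nhds (half_pos hδ)))
    obtain ⟨N, h1, h2⟩ := (hN.and hb').exists
    refine ⟨N, fun n hn m hm => ?_⟩
    rw [Real.dist_eq]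
    have := h1 n hn m hm z (le_max_right _ _) t
    linarith [h2 n hn, h2 m hm]
  choose G hG using hlim
  have hunif : ∀ Z, ∀ δ > 0, ∀ᶠ n in atTop, ∀ z ≤ Z, ∀ t, |F n z t - G z t| ≤ δ := by
    intro Z δ hδ
    obtain ⟨b, hb, hN⟩ := hcau (max 0 Z) (le_max_left _ _)
    obtain ⟨N, hN⟩ := hN.exists
    filter_upwards [hb.eventually (gt_mem_nhds hδ), eventually_ge_atTop N] with n h1 hn z hz t
    have h2 : Tendsto (fun m => |F n z t - F m z t|) atTop (𝓝 |F n z t - G z t|) :=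
      ((hG z t).const_sub _).abs
    have h3 : Tendsto (fun m => b n + b m) atTop (𝓝 (b n + 0)) := hb.const_add _
    have h4 := le_of_tendsto_of_tendsto h2 h3 ((eventually_ge_atTop N).mono fun m hm =>
      hN n hn m hm z (hz.trans (le_max_right _ _)) t)
    linarith
  have hGc : Continuous (uncurry G) := by
    have hl : TendstoLocallyUniformly (fun n => uncurry (F n)) (uncurry G) atTop := by
      rw [Metric.tendstoLocallyUniformly_iff]
      intro δ hδ p
      refine ⟨{q | q.1 < p.1 + 1}, (isOpen_lt (by fun_prop) (by fun_prop)).mem_nhds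
        (by simp), (hunif (p.1 + 1) (δ / 2) (half_pos hδ)).mono fun n hn q hq => ?_⟩
      rw [dist_comm, Real.dist_eq]
      exact (hn q.1 (le_of_lt hq) q.2).trans_lt (half_lt_self hδ)
    exact hl.continuous (Frequently.of_forall hFc)
  have hG0 : ∀ z t, 0 ≤ G z t := fun z t =>
    ge_of_tendsto' (hG z t) fun n => (ha.isMild n).nonneg _ _
  have hGs : ∀ z t, 0 ≤ z → t ∈ Icc 0 T → Tendsto (fun n => g n z t) atTop (𝓝 (G z t)) :=
    fun z t hz ht => by simpa only [hFs _ z t hz ht] using hG z t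
  have hprof : ∀ t ∈ Icc 0 T, IsProfile ω A fun z => G z t := by
    intro t ht
    obtain ⟨h1, h2⟩ := integrable_and_integral_le_of_tendsto
      (F := fun n z => ω z * g n z t) (G := fun z => ω z * G z t)
      (fun n => (ha.isProfile n t ht).integrable)
      (fun n z hz => mul_nonneg (ha.isDominated.weight_nonneg z hz) ((ha.isMild n).nonneg z t))
      (fun n => (ha.isProfile n t ht).integral_le)
      (fun z hz => (hGs z t hz.le ht).const_mul _)
    exact ⟨hGc.comp (f := fun z => (z, t)) (by fun_prop), fun z => hG0 z t, h1, h2⟩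
  have hdist : ∀ n, ∀ t ∈ Icc 0 T, profileDist (fun z => g n z t) (fun z => G z t) ≤ η n := by
    intro n t ht
    -- Fatou as m → ∞ in dist(g n, g m) ≤ η n + η m; the index is shifted so that η m < δ
    -- throughout.
    refine le_of_forall_pos_le_add fun δ hδ => ?_
    obtain ⟨N, hN⟩ := (eventually_forall_ge_atTop.2
      (ha.tendsto_dist.eventually (gt_mem_nhds hδ))).exists
    refine (integrable_and_integral_le_of_tendsto
      (F := fun m z => (1 + z) * |g n z t - g (m + N) z t|)
      (G := fun z => (1 + z) * |g n z t - G z t|)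
      (fun m => profileDist_integrable ha.isDominated (ha.isProfile n t ht)
        (ha.isProfile (m + N) t ht))
      (fun m z hz => mul_nonneg (by linarith) (abs_nonneg _))
      (fun m => (ha.dist_le n (m + N) t ht).trans ?_)
      (fun z hz => ?_)).2
    · have := hN (m + N) (by omega)
      linarith
    · exact ((((tendsto_add_atTop_iff_nat N).2 (hGs z t hz.le ht)).const_sub _).abs).const_mul _
  set Q : ℝ → ℝ → ℝ := fun z t => collisionOp e (pairRate Φ fun x => G x t) z with hQ
  have hop : ∀ Z, 0 ≤ Z → ∀ δ > 0, ∀ᶠ n in atTop, ∀ z ∈ Icc 0 Z, ∀ t ∈ Icc 0 T,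
      |collisionOp e (pairRate (K n) fun x => g n x t) z - Q z t| ≤ δ := by
    intro Z hZ δ hδ
    obtain ⟨S, hS⟩ := ha.exists_bound Z
    have hGS : ∀ t ∈ Icc 0 T, ∀ x ∈ Icc 0 Z, G x t ≤ S := fun t ht x hx =>
      le_of_tendsto' (hGs x t hx.1 ht) fun n => hS n t ht x hx
    have hS0 : 0 ≤ S := (hG0 0 0).trans (hGS 0 h0T 0 ⟨le_rfl, hZ⟩)
    have hM0 : 0 ≤ diffConst C A S Z := diffConst_nonneg hC hA hS0 hZ
    set L := C * (1 + Z) * A with hL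
    have hL0 : 0 ≤ L := by positivity
    -- Chosen so that the damping term, with loss rate at most L, stays below δ/2; here only uniform
    -- convergence of the densities controls it.
    have hδ' : 0 < δ / 2 / (L + 1) := by positivity
    have ht0 : Tendsto (fun n => diffConst C A S Z * (η n + ε n)) atTop (𝓝 0) := by
      simpa using (ha.tendsto_dist.add ha.tendsto_error).const_mul (diffConst C A S Z)
    filter_upwards [hunif Z _ hδ', ha.eventually_eq Z,
      ht0.eventually (gt_mem_nhds (half_pos hδ))] with n h1 h2 h3 z hz t ht
    have h4 := abs_collisionOp_sub_add_le ha.continuous ha.isProb ha.isDominated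
      (ha.isSubkernel n) ha.isSubkernel_self (ha.isProfile n t ht) (hprof t ht)
      (ha.error_nonneg n) (ha.abs_sub_le n) hz
      (fun x y hx hy hxy => (h2 x y hx hy hxy).symm) (fun x hx => hS n t ht x hx)
      (fun x hx => hGS t ht x hx)
    obtain ⟨-, h5, h6⟩ := lossRate_integrable ha.isDominated (ha.isSubkernel n)
      (ha.isProfile n t ht) hz.1
    have h7 := h1 z hz.2 t
    rw [hFs n z t hz.1 ht] at h7
    have h8 : |(g n z t - G z t) * lossRate (K n) (fun z => g n z t) z| ≤ δ / 2 := by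
      rw [abs_mul, abs_of_nonneg h5]
      have h9 : lossRate (K n) (fun z => g n z t) z ≤ L + 1 := by
        refine h6.trans ?_
        have : C * (1 + z) * A ≤ L := by
          have := hz.2
          rw [hL]; gcongr
        linarith
      refine (mul_le_mul h7 h9 h5 hδ'.le).trans (le_of_eq ?_)
      field_simp
    have h10 := mul_le_mul_of_nonneg_left (add_le_add_left (hdist n t ht) (ε n)) hM0
    have h11 := h4.trans (h10.trans h3.le)
    set X := collisionOp e (pairRate (K n) fun x => g n x t) z
    set Y := (g n z t - G z t) * lossRate (K n) (fun z => g n z t) z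
    have h12 : X - Q z t = (X - Q z t + Y) - Y := by ring
    rw [h12]
    refine (abs_sub _ _).trans ?_
    linarith
  have hQc : ContinuousOn (uncurry Q) (strip T) := by
    have hl : TendstoLocallyUniformlyOn (fun n => uncurry fun z t =>
        collisionOp e (pairRate (K n) fun x => g n x t) z) (uncurry Q) atTop (strip T) := by
      rw [Metric.tendstoLocallyUniformlyOn_iff]
      intro δ hδ p hp
      have hp1 : 0 ≤ p.1 := hp.1
      refine ⟨{q | q.1 < p.1 + 1} ∩ strip T, inter_mem (mem_nhdsWithin_of_mem_nhds
        ((isOpen_lt (by fun_prop) (by fun_prop)).mem_nhds (by simp))) self_mem_nhdsWithin,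
        (hop (p.1 + 1) (by linarith) (δ / 2) (half_pos hδ)).mono fun n hn q hq => ?_⟩
      rw [dist_comm, Real.dist_eq]
      exact (hn q.1 ⟨hq.2.1, le_of_lt hq.1⟩ q.2 hq.2.2).trans_lt (half_lt_self hδ)
    exact hl.continuousOn (Frequently.of_forall fun n => (ha.isMild n).continuousOn_op)
  refine ⟨G, ⟨hGc, hG0, hQc, fun z hz t ht => ?_⟩, hprof, fun z hz => ?_⟩
  · have hsub : uIcc 0 t ⊆ Icc 0 T := by
      rw [uIcc_of_le ht.1]; exact Icc_subset_Icc_right ht.2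
    have hQi : IntervalIntegrable (Q z) volume 0 t := ContinuousOn.intervalIntegrable
      ((hQc.comp (f := fun s => (z, s)) (by fun_prop) fun _ hs => ⟨hz, hs⟩ :
        ContinuousOn (Q z) (Icc 0 T)).mono hsub)
    have hint : Tendsto (fun n => ∫ s in (0 : ℝ)..t,
        collisionOp e (pairRate (K n) fun x => g n x s) z) atTop
        (𝓝 (∫ s in (0 : ℝ)..t, Q z s)) := by
      rw [Metric.tendsto_nhds]
      intro δ hδ
      have hδ' : 0 < δ / (T + 1) := by positivity
      filter_upwards [hop z hz _ hδ'] with n hn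
      have hi := (((ha.isMild n).continuousOn_section hz).mono hsub).intervalIntegrable
        (μ := volume)
      rw [Real.dist_eq, ← intervalIntegral.integral_sub hi hQi]
      have h1 := intervalIntegral.norm_integral_le_of_norm_le_const (a := 0) (b := t)
        (C := δ / (T + 1)) (f := fun s => collisionOp e (pairRate (K n) fun x => g n x s) z - Q z s)
        fun s hs => by
          rw [uIoc_of_le ht.1] at hs
          exact hn z ⟨hz, le_rfl⟩ s ⟨hs.1.le, hs.2.trans ht.2⟩
      rw [sub_zero, abs_of_nonneg ht.1] at h1
      refine lt_of_le_of_lt h1 ?_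
      rw [div_mul_eq_mul_div, div_lt_iff₀ (by linarith)]
      exact mul_lt_mul_of_pos_left (by linarith [ht.2]) hδ
    refine tendsto_nhds_unique (hGs z t hz ht) (((hGs z 0 hz h0T).add hint).congr fun n => ?_)
    exact ((ha.isMild n).eq_add_integral z hz t ht).symm
  · refine tendsto_nhds_unique (hGs z 0 hz h0T) (tendsto_const_nhds.congr' ?_)
    filter_upwards [ha.eventually_initial z] with n hn
    exact (hn z ⟨hz, le_rfl⟩).symm

end

section

variable {e K Φ : ℝ → ℝ → ℝ} {ω : ℝ → ℝ} {C A T : ℝ}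

/-! ### Local bounds and mass conservation -/

theorem isProfile_zero (hA : 0 ≤ A) : IsProfile ω A fun _ => 0 where
  continuous := continuous_const
  nonneg := fun _ => le_rfl
  integrable := by simp
  integral_le := by simpa using hA

/-- The gain terms are compared with those of the zero profile, whose distance to g is at most C A,
and the loss is dropped. The bound is affine in the supremum over [0, Z] alone, although breakage
brings in fragments of arbitrarily large particles. -/
theorem collisionOp_le {g : ℝ → ℝ} {S Z z : ℝ} (hec : Continuous (uncurry e)) (he : IsProb e)
    (hΦ : IsDominated Φ ω C) (hK : IsSubkernel K Φ) (hg : IsProfile ω A g) (hz : z ∈ Icc 0 Z)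
    (hgS : ∀ x ∈ Icc 0 Z, g x ≤ S) :
    collisionOp e (pairRate K g) z
      ≤ C * (1 + Z) ^ 2 * (C * A) * S + C * A * (C * A) := by
  have hC := hΦ.const_nonneg
  have hA := IsProfile.const_nonneg hΦ hg
  have hZ : 0 ≤ Z := hz.1.trans hz.2
  have hS : 0 ≤ S := (hg.nonneg 0).trans (hgS 0 ⟨le_rfl, hZ⟩)
  have h0 : IsProfile ω 0 fun _ => 0 := isProfile_zero le_rfl
  have hD : profileDist g (fun _ => 0) ≤ C * A := by simpa using profileDist_le hΦ hg h0
  have hp0 : pairRate K (fun _ => 0) = fun _ _ => 0 := by ext x y; simp [pairRate]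
  have h1 := abs_coagOp_sub_le (K₂ := K) (k := C * (1 + Z) ^ 2) hec he hΦ hK hg h0 hz
    (fun x hx y hy => (hK.le x y hx.1 hy.1).trans ((hΦ.le_mul x y hx.1 hy.1).trans
      (mul_le_mul_of_nonneg_left (by nlinarith [hx.1, hx.2, hy.1, hy.2]) hC)))
    (fun _ _ _ _ _ => rfl) hgS fun _ _ => hS
  have h2 := (abs_breakOp_sub_le hec he (continuous_pairRate hK.continuous hg.continuous)
    (continuous_pairRate hK.continuous h0.continuous) (pairRate_inv_integrable hΦ hK hg)
    (pairRate_inv_integrable hΦ hK h0) hz.1).trans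
    (integral_inv_mul_abs_sub_le (K₂ := K) (ε := 0) hΦ hK hg h0 le_rfl fun x y _ _ => by simp)
  have hc0 : coagOp e (pairRate K fun _ => 0) z = 0 := by simp [hp0, coagOp]
  have hb0 : breakOp e (pairRate K fun _ => 0) z = 0 := by simp [hp0, breakOp]
  rw [hc0, sub_zero] at h1
  rw [hb0, sub_zero, zero_mul, add_zero, add_zero] at h2
  have h3 := (lossRate_integrable hΦ hK hg hz.1).2.1
  have h4 := mul_nonneg (hg.nonneg z) h3
  rw [collisionOp, lossOp_pairRate]
  have h5 := mul_le_mul_of_nonneg_left hD (by positivity : 0 ≤ C * (1 + Z) ^ 2 * S)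
  have h6 := mul_le_mul_of_nonneg_left hD (by positivity : 0 ≤ C * A)
  linarith [(le_abs_self _).trans h1, (le_abs_self _).trans h2]

/-- Gronwall for the supremum over [0, Z]. The constants depend on C, A, T, Z and the initial bound
only, so the estimate is uniform along the truncations. -/
theorem IsMild.local_bound {g : ℝ → ℝ → ℝ} {S₀ Z : ℝ} (hT : 0 ≤ T) (hZ : 0 ≤ Z)
    (hec : Continuous (uncurry e)) (he : IsProb e) (hΦ : IsDominated Φ ω C)
    (hK : IsSubkernel K Φ) (hg : IsMild e K T g)
    (hp : ∀ t ∈ Icc 0 T, IsProfile ω A fun z => g z t) (hS₀ : ∀ z ∈ Icc 0 Z, g z 0 ≤ S₀)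
    {t z : ℝ} (ht : t ∈ Icc 0 T) (hz : z ∈ Icc 0 Z) :
    g z t ≤ 2 * (S₀ + T * (C * A * (C * A)))
      * Real.exp (2 * (C * (1 + Z) ^ 2 * (C * A)) * T) := by
  have hC := hΦ.const_nonneg
  have hA := IsProfile.const_nonneg hΦ (hp t ht)
  have hS0 : 0 ≤ S₀ := (hg.nonneg 0 0).trans (hS₀ 0 ⟨le_rfl, hZ⟩)
  set b := C * (1 + Z) ^ 2 * (C * A) with hb
  have hb0 : 0 ≤ b := by positivity
  have ha0 : 0 ≤ S₀ + T * (C * A * (C * A)) := by positivity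
  have hgr := gronwall_family (ι := Icc (0 : ℝ) Z) (φ := fun i t => g i t) (I := Icc 0 T) ha0
    (mul_nonneg zero_le_two hb0) (fun t ht => ht.1) ?_ (fun S hS hφ i t ht => ?_) ⟨z, hz⟩ t ht
  · refine hgr.trans (mul_le_mul_of_nonneg_left (Real.exp_le_exp.2 ?_) (by positivity))
    exact mul_le_mul_of_nonneg_left ht.2 (by positivity)
  · obtain ⟨S, hS⟩ := ((isCompact_Icc (a := (0 : ℝ)) (b := Z)).prod
      (isCompact_Icc (a := (0 : ℝ)) (b := T))).bddAbove_image hg.continuous.continuousOn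
    exact ⟨S, fun i t ht => hS ⟨(i, t), ⟨i.2, ht⟩, rfl⟩⟩
  · have hsub : uIcc 0 t ⊆ Icc 0 T := by
      rw [uIcc_of_le ht.1]; exact Icc_subset_Icc_right ht.2
    have hi := ((hg.continuousOn_section i.2.1).mono hsub).intervalIntegrable (μ := volume)
    have h1 := integral_le_of_le_exp (T := T) (a := C * A * (C * A)) (b := b) hS (by positivity)
      ht hi fun s hs => by
        have := collisionOp_le (S := S * Real.exp (2 * b * s)) hec he hΦ hK (hp s hs) i.2
          fun x hx => hφ ⟨x, hx⟩ s hs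
        linarith
    have h2 := hS₀ i i.2
    have h3 := hg.eq_add_integral i i.2.1 t ht
    simp only [collisionRate_eq_pairRate] at h3
    rw [h3]
    linarith

theorem isWeight_id : IsWeight (fun z => z) fun z => 1 + z where
  measurable := measurable_id
  measurable_weight := by fun_prop
  pos := fun x hx => by linarith
  le := fun x hx => by rw [abs_of_pos hx]; linarith
  intervalIntegrable := fun r _ => continuous_id.intervalIntegrable _ _
  average_le := fun r hr => by
    have : ∫ z in (0 : ℝ)..r, |z| = ∫ z in (0 : ℝ)..r, z := by
      refine intervalIntegral.integral_congr fun z hz => ?_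
      rw [uIcc_of_le hr.le] at hz
      exact abs_of_nonneg hz.1
    rw [this, integral_id]
    nlinarith

theorem IsProfile.integrable_mul_self {g : ℝ → ℝ} (hΦ : IsDominated Φ ω C)
    (hg : IsProfile ω A g) : Integrable (fun z => z * g z) posMeasure := by
  refine integrable_of_le_profile hg (c := C)
    (continuous_id.mul hg.continuous).aestronglyMeasurable fun z hz => ?_
  rw [abs_of_nonneg (mul_nonneg hz.le (hg.nonneg z)), ← mul_assoc]
  exact mul_le_mul_of_nonneg_right (by linarith [hΦ.le_weight z hz]) (hg.nonneg z)

/-- The ω-moments make the pair density integrable against 1 + x + y, so ψ = z is an admissible test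
function without any truncation. -/
theorem IsMild.integral_mul_self_eq {g : ℝ → ℝ → ℝ} (he : IsProb e) (hΦ : IsDominated Φ ω C)
    (hK : IsSubkernel K Φ) (hg : IsMild e K T g)
    (hp : ∀ t ∈ Icc 0 T, IsProfile ω A fun z => g z t) {t : ℝ} (ht : t ∈ Icc 0 T) :
    ∫ z, z * g z t ∂posMeasure = ∫ z, z * g z 0 ∂posMeasure := by
  have h0T : (0 : ℝ) ∈ Icc 0 T := ⟨le_rfl, ht.1.trans ht.2⟩
  have habs : ∀ s ∈ Icc 0 T, ∀ c : ℝ → ℝ → ℝ,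
      ∫ p, c p.1 p.2 * |pairRate K (fun x => g x s) p.1 p.2| ∂quadMeasure
        = ∫ p, c p.1 p.2 * pairRate K (fun x => g x s) p.1 p.2 ∂quadMeasure := fun s hs c =>
    integral_congr_ae (ae_quadMeasure fun x y hx hy => by
      simp only [abs_of_nonneg (pairRate_nonneg hK (hp s hs) hx.le hy.le)])
  obtain ⟨-, -, h⟩ := moment_equation (f := fun s => pairRate K fun x => g x s)
    (B := 3 * (C * (A * A))) he isWeight_id
    (fun z hz t ht => hg.eq_add_integral z hz.le t ht) hg.continuousOn_op
    (fun s hs => (continuous_pairRate hK.continuous (hp s hs).continuous).measurable)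
    (fun s hs => (pairRate_weight_integrable hΦ hK (hp s hs)).1)
    (fun s hs => (pairRate_weight_integrable hΦ hK (hp s hs)).2)
    (fun s hs => by
      rw [habs s hs fun x _ => 1 + x, habs s hs fun x y => 1 + (x + y)]
      obtain ⟨h1, h2⟩ := integral_pairRate_le hΦ hK (hp s hs)
      linarith)
    ((hp 0 h0T).integrable_mul_self hΦ) ht
  rw [h, add_eq_left]
  have hw : ∀ x y, 0 < x → 0 < y → weakKernel e (fun z => z) x y = (y - x) / 2 := by
    intro x y hx hy
    have := weakKernel_rpow (e := e) (r := 1) (by norm_num) hx hy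
    simp only [Real.rpow_one] at this
    rw [this]
    ring
  have : ∀ s, ∫ p, weakKernel e (fun z => z) p.1 p.2 * pairRate K (fun x => g x s) p.1 p.2
      ∂quadMeasure = 0 := by
    intro s
    refine integral_antisymm_eq_zero (F := fun x y => weakKernel e (fun z => z) x y *
      pairRate K (fun x => g x s) x y) fun x y hx hy => ?_
    simp only [hw x y hx hy, hw y x hy hx, pairRate, hK.symm y x hy.le hx.le]
    ring
  simp [this]

/-- Stability with equal kernels and zero initial distance gives equality almost everywhere;
continuity extends it to every size, including z = 0 as a boundary point. -/
theorem IsMild.eq_of_profile {g h : ℝ → ℝ → ℝ} (he : IsProb e) (hΦ : IsDominated Φ ω C)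
    (hK : IsSubkernel K Φ) (hg : IsMild e K T g) (hh : IsMild e K T h)
    (hgA : ∀ t ∈ Icc 0 T, IsProfile ω A fun z => g z t)
    (hhA : ∀ t ∈ Icc 0 T, IsProfile ω A fun z => h z t) (h0 : ∀ z, 0 < z → g z 0 = h z 0)
    {z t : ℝ} (hz : 0 ≤ z) (ht : t ∈ Icc 0 T) : g z t = h z t := by
  have hd0 : profileDist (fun z => g z 0) (fun z => h z 0) = 0 :=
    integral_eq_zero_of_ae (ae_posMeasure fun z hz => by simp [h0 z hz])
  have hd := stability (R := 0) he hΦ hK hK hg hh hgA hhA le_rfl (fun _ _ => by simp) ht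
  rw [hd0] at hd
  have hd' : profileDist (fun z => g z t) (fun z => h z t) = 0 :=
    le_antisymm (by simpa using hd) (profileDist_nonneg _ _)
  have hgc := (hgA t ht).continuous
  have hhc := (hhA t ht).continuous
  have hae := (integral_eq_zero_iff_of_nonneg_ae (ae_posMeasure fun z hz =>
    mul_nonneg (by linarith) (abs_nonneg _)) (profileDist_integrable hΦ (hgA t ht) (hhA t ht))).1 hd'
  have heq : EqOn (fun z => (1 + z) * |g z t - h z t|) (fun _ => 0) (Ici 0) := by
    have h1 : EqOn (fun z => (1 + z) * |g z t - h z t|) (fun _ => 0) (Ioi 0) :=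
      Measure.eqOn_open_of_ae_eq hae isOpen_Ioi (Continuous.continuousOn (by fun_prop))
        continuousOn_const
    have h2 := h1.closure (by fun_prop) continuous_const
    rwa [closure_Ioi] at h2
  have h1 : (1 + z) * |g z t - h z t| = 0 := heq hz
  rcases mul_eq_zero.1 h1 with h2 | h2
  · linarith
  · linarith [abs_eq_zero.1 h2]

end

/-! ### The product-power kernel: domination by the class weight, moment production -/

section

variable {e K : ℝ → ℝ → ℝ} {c α α' σ₁ σ₂ : ℝ}

/-! ### Bounds for the collision kernel -/

theorem rpow_le_one_add {x a : ℝ} (hx : 0 ≤ x) (ha : 0 ≤ a) (ha1 : a ≤ 1) : x ^ a ≤ 1 + x := by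
  rcases hx.eq_or_lt with rfl | hx
  · have := Real.zero_rpow_le_one a
    linarith
  · have := rpow_le_rpow_add_rpow hx ha ha1
    simpa using this

/-- Weighted arithmetic-geometric mean: x^a y^(1-a) ≤ x + y, and the leftover power of y is a + b -
1. This extracts the factor x + y needed against the singular fragment density. -/
theorem rpow_mul_rpow_le {x y a b : ℝ} (hx : 0 < x) (hy : 0 < y) (ha : 0 ≤ a) (ha1 : a ≤ 1) :
    x ^ a * y ^ b ≤ (x + y) * y ^ (a + b - 1) := by
  have h1 := Real.geom_mean_le_arith_mean2_weighted ha (sub_nonneg.2 ha1) hx.le hy.le (by ring)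
  have h2 : a * x + (1 - a) * y ≤ x + y := by nlinarith
  have h3 : y ^ b = y ^ (1 - a) * y ^ (a + b - 1) := by
    rw [← Real.rpow_add hy]; congr 1; ring
  rw [h3, ← mul_assoc]
  exact mul_le_mul_of_nonneg_right (h1.trans h2) (Real.rpow_nonneg hy.le _)

theorem collisionKernel_nonneg (hc : 0 ≤ c) {x y : ℝ} (hx : 0 ≤ x) (hy : 0 ≤ y) :
    0 ≤ collisionKernel c α α' x y := by
  have := Real.rpow_nonneg hx α
  have := Real.rpow_nonneg hx α'
  have := Real.rpow_nonneg hy α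
  have := Real.rpow_nonneg hy α'
  unfold collisionKernel
  positivity

theorem collisionKernel_le (hc : 0 ≤ c) {x y M : ℝ} (h1 : x ^ α * y ^ α' ≤ M)
    (h2 : x ^ α' * y ^ α ≤ M) : collisionKernel c α α' x y ≤ 2 * c * M := by
  have := mul_le_mul_of_nonneg_left (add_le_add h1 h2) hc
  unfold collisionKernel
  linarith

theorem continuous_collisionKernel (hα : 0 < α) (hα' : 0 < α') :
    Continuous (uncurry (collisionKernel c α α')) := by
  have h1 := Real.continuous_rpow_const hα.le
  have h2 := Real.continuous_rpow_const hα'.le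
  exact continuous_const.mul
    (((h1.comp continuous_fst).mul (h2.comp continuous_snd)).add
      ((h2.comp continuous_fst).mul (h1.comp continuous_snd)))

theorem isSubkernel_collisionKernel (hc : 0 ≤ c) (hα : 0 < α) (hα' : 0 < α') :
    IsSubkernel (collisionKernel c α α') (collisionKernel c α α') where
  continuous := continuous_collisionKernel hα hα'
  nonneg := fun _ _ hx hy => collisionKernel_nonneg hc hx hy
  le := fun _ _ _ _ => le_rfl
  symm := fun x y _ _ => by unfold collisionKernel; ring

theorem collisionKernel_le_add_rpow (hc : 0 ≤ c) (hα : 0 < α) (hα' : 0 < α') {x y : ℝ}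
    (hx : 0 ≤ x) (hy : 0 ≤ y) : collisionKernel c α α' x y ≤ 2 * c * (x + y) ^ (α + α') := by
  have h : ∀ a b : ℝ, 0 < a → 0 < b → x ^ a * y ^ b ≤ (x + y) ^ (a + b) := fun a b ha hb => by
    rw [Real.rpow_add_of_nonneg (add_nonneg hx hy) ha.le hb.le]
    exact mul_le_mul (Real.rpow_le_rpow hx (by linarith) ha.le)
      (Real.rpow_le_rpow hy (by linarith) hb.le) (Real.rpow_nonneg hy _)
      (Real.rpow_nonneg (add_nonneg hx hy) _)
  refine collisionKernel_le hc (h _ _ hα hα') ?_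
  rw [add_comm α]
  exact h _ _ hα' hα

/-- The weight of the solution class. -/
def classWeight (σ₁ σ₂ z : ℝ) : ℝ := z ^ (-σ₁) + z ^ σ₂

theorem rpow_le_classWeight {z r : ℝ} (hz : 0 < z) (h1 : -σ₁ ≤ r) (h2 : r ≤ σ₂) :
    z ^ r ≤ classWeight σ₁ σ₂ z := rpow_le_rpow_add_rpow hz h1 h2

/-- Admissible exponents of the collision kernel and of the weight. -/
structure IsExponents (α α' σ₁ σ₂ : ℝ) : Prop where
  pos : 0 < α
  pos' : 0 < α'
  le_half : α ≤ 1 / 2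
  le_half' : α' ≤ 1 / 2
  le_left : 1 - α ≤ σ₁
  le_left' : 1 - α' ≤ σ₁
  left_lt : σ₁ < 1
  le_right : 1 + α ≤ σ₂
  le_right' : 1 + α' ≤ σ₂
  right_le : σ₂ ≤ 2

/-- The condition σ₂ ≥ 1 + max(α, α') is what puts y^b (1 + y) below the weight, as required for
stability and for integrable pair densities. The condition σ₁ ≥ 1 - min(α, α') puts y^(a+b-1) below
it, as required for the pointwise breakage bound. The linear bound only needs α, α' ≤ 1 and serves
the loss rates and local suprema. -/
theorem IsExponents.isDominated (h : IsExponents α α' σ₁ σ₂) (hc : 0 ≤ c) :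
    IsDominated (collisionKernel c α α') (classWeight σ₁ σ₂) (8 * c + 2) := by
  have hpos := h.pos
  have hpos' := h.pos'
  have hh := h.le_half
  have hh' := h.le_half'
  have hl := h.le_left
  have hl' := h.le_left'
  have hr := h.le_right
  have hr' := h.le_right'
  have hσ := h.left_lt
  have hω : ∀ x, 0 < x → 0 ≤ classWeight σ₁ σ₂ x := fun x hx =>
    add_nonneg (Real.rpow_nonneg hx.le _) (Real.rpow_nonneg hx.le _)
  have hw : ∀ x b, 0 < x → 0 < b → 1 + b ≤ σ₂ → x ^ b * (1 + x) ≤ 2 * classWeight σ₁ σ₂ x := by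
    intro x b hx hb hb2
    have h1 : x ^ b ≤ classWeight σ₁ σ₂ x := rpow_le_classWeight hx (by linarith) (by linarith)
    have h2 : x ^ (b + 1) ≤ classWeight σ₁ σ₂ x :=
      rpow_le_classWeight hx (by linarith) (by linarith)
    rw [Real.rpow_add_one hx.ne'] at h2
    linarith
  have lift : ∀ {X M k : ℝ}, X ≤ 2 * c * M → 2 * c ≤ 8 * c + 2 → 0 ≤ M → k = 8 * c + 2 →
      X ≤ k * M := fun h1 h2 h3 h4 => by
    rw [h4]; exact h1.trans (mul_le_mul_of_nonneg_right h2 h3)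
  refine ⟨by linarith, hω, fun x hx => ?_, fun x y hx hy => ?_, fun x y hx hy => ?_,
    fun x y hx hy => ?_, fun x y hx hy => ?_⟩
  · have h1 : x ^ (0 : ℝ) ≤ classWeight σ₁ σ₂ x :=
      rpow_le_classWeight hx (by linarith) (by linarith)
    have h2 : x ^ (1 : ℝ) ≤ classWeight σ₁ σ₂ x :=
      rpow_le_classWeight hx (by linarith) (by linarith)
    rw [Real.rpow_zero] at h1
    rw [Real.rpow_one] at h2
    have := mul_nonneg hc (hω x hx)
    linarith
  · have key : ∀ a b : ℝ, 0 < a → 0 < b → 1 + a ≤ σ₂ → 1 + b ≤ σ₂ →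
        x ^ a * y ^ b * ((1 + x) * (1 + y))
          ≤ 4 * (classWeight σ₁ σ₂ x * classWeight σ₁ σ₂ y) := by
      intro a b ha hb ha2 hb2
      have h1 := hw x a hx ha ha2
      have h2 := hw y b hy hb hb2
      have h3 := mul_le_mul h1 h2 (mul_nonneg (Real.rpow_nonneg hy.le b) (by linarith))
        (mul_nonneg zero_le_two (hω x hx))
      linarith
    have k1 := mul_le_mul_of_nonneg_left (add_le_add (key α α' hpos hpos' hr hr')
      (key α' α hpos' hpos hr' hr)) hc
    have k2 := mul_nonneg (hω x hx) (hω y hy)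
    unfold collisionKernel
    linarith
  · have key : ∀ a b : ℝ, 0 < a → 0 < b → a ≤ 1 → 1 + b ≤ σ₂ →
        x ^ a * y ^ b * (1 + y) ≤ 2 * ((1 + x) * classWeight σ₁ σ₂ y) := by
      intro a b ha hb ha1 hb2
      have h1 := rpow_le_one_add hx ha.le ha1
      have h3 := mul_le_mul h1 (hw y b hy hb hb2)
        (mul_nonneg (Real.rpow_nonneg hy.le b) (by linarith)) (by linarith)
      linarith
    have k1 := mul_le_mul_of_nonneg_left (add_le_add (key α α' hpos hpos' (by linarith) hr')
      (key α' α hpos' hpos (by linarith) hr)) hc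
    have k2 := mul_nonneg (by linarith : 0 ≤ 1 + x) (hω y hy)
    have k3 := mul_nonneg hc k2
    unfold collisionKernel
    linarith
  · have key : ∀ a b : ℝ, 0 < a → 0 < b → a ≤ 1 / 2 → b ≤ 1 / 2 → 1 - a ≤ σ₁ →
        x ^ a * y ^ b ≤ (x + y) * ((1 + x) * classWeight σ₁ σ₂ y) := by
      intro a b ha hb ha1 hb1 hal
      refine (rpow_mul_rpow_le hx hy ha.le (by linarith)).trans ?_
      refine mul_le_mul_of_nonneg_left ?_ (by linarith)
      refine (rpow_le_classWeight (σ₁ := σ₁) (σ₂ := σ₂) hy (by linarith) (by linarith)).trans ?_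
      exact le_mul_of_one_le_left (hω y hy) (by linarith)
    refine lift (collisionKernel_le hc (key α α' hpos hpos' hh hh' hl)
      (key α' α hpos' hpos hh' hh hl')) (by linarith) ?_ rfl
    exact mul_nonneg (by linarith) (mul_nonneg (by linarith) (hω y hy))
  · have key : ∀ a b : ℝ, 0 < a → 0 < b → a ≤ 1 → b ≤ 1 → x ^ a * y ^ b ≤ (1 + x) * (1 + y) :=
      fun a b ha hb ha1 hb1 => mul_le_mul (rpow_le_one_add hx ha.le ha1)
        (rpow_le_one_add hy hb.le hb1) (Real.rpow_nonneg hy b) (by linarith)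
    exact lift (collisionKernel_le hc (key α α' hpos hpos' (by linarith) (by linarith))
      (key α' α hpos' hpos (by linarith) (by linarith))) (by linarith) (by positivity) rfl

/-- The moment production of the collision kernel for negative exponents. -/
theorem IsExponents.weakKernel_neg_le (h : IsExponents α α' σ₁ σ₂) (hc : 0 ≤ c) (he : IsProb e)
    (hK : IsSubkernel K (collisionKernel c α α')) {x y : ℝ} (hx : 0 < x) (hy : 0 < y) :
    (weakKernel e (fun z => z ^ (-σ₁)) x y + weakKernel e (fun z => z ^ (-σ₁)) y x) * K x y
      ≤ 4 * c / (1 - σ₁) * ((1 + x ^ (-σ₁)) * (1 + y) + (1 + y ^ (-σ₁)) * (1 + x)) := by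
  have hpos := h.pos
  have hpos' := h.pos'
  have hh := h.le_half
  have hh' := h.le_half'
  have hl := h.le_left
  have hl' := h.le_left'
  have hσ := h.left_lt
  have hτ : 0 < 1 - σ₁ := by linarith
  -- For a negative exponent breakage is the worst case: 1/(1 - σ₁) dominates the coalescence
  -- coefficient 1/2, whatever the efficiency.
  have hi : (1 : ℝ) / 2 ≤ 1 / (-σ₁ + 1) := one_div_le_one_div_of_le (by linarith) (by linarith)
  set p := (x + y) ^ (-σ₁) with hp
  have hp0 : 0 ≤ p := Real.rpow_nonneg (by linarith) _
  have hcoef : ∀ a b, 1 / 2 * e a b + (1 - e a b) / (-σ₁ + 1) ≤ 1 / (-σ₁ + 1) := by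
    intro a b
    have h1 := mul_le_mul_of_nonneg_right hi (he.nonneg a b)
    have h2 : (1 - e a b) / (-σ₁ + 1) = 1 / (-σ₁ + 1) - 1 / (-σ₁ + 1) * e a b := by ring
    linarith
  have hwk : weakKernel e (fun z => z ^ (-σ₁)) x y + weakKernel e (fun z => z ^ (-σ₁)) y x
      ≤ 2 / (1 - σ₁) * p := by
    rw [weakKernel_rpow (by linarith) hx hy, weakKernel_rpow (by linarith) hy hx, add_comm y x]
    have h1 := mul_le_mul_of_nonneg_right (hcoef x y) hp0
    have h2 := mul_le_mul_of_nonneg_right (hcoef y x) hp0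
    have h3 := Real.rpow_nonneg hx.le (-σ₁)
    have h4 := Real.rpow_nonneg hy.le (-σ₁)
    have h5 : 2 / (1 - σ₁) * p = 1 / (-σ₁ + 1) * p + 1 / (-σ₁ + 1) * p := by
      rw [show -σ₁ + 1 = 1 - σ₁ by ring]; ring
    linarith
  have hxp : p ≤ x ^ (-σ₁) :=
    Real.rpow_le_rpow_of_nonpos hx (by linarith) (by linarith)
  -- Here a ≤ 1/2 ≤ 1 - a ≤ σ₁, so x^(a-σ₁) has exponent between -σ₁ and 0.
  have key : ∀ a b : ℝ, 0 < a → 0 < b → a ≤ 1 / 2 → b ≤ 1 / 2 → 1 - a ≤ σ₁ →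
      x ^ a * y ^ b * p ≤ (1 + x ^ (-σ₁)) * (1 + y) := by
    intro a b ha hb ha1 hb1 hal
    have h1 : x ^ a * p ≤ 1 + x ^ (-σ₁) := by
      refine (mul_le_mul_of_nonneg_left hxp (Real.rpow_nonneg hx.le a)).trans ?_
      rw [← Real.rpow_add hx]
      have := rpow_le_rpow_add_rpow (r := a + -σ₁) hx (a := -σ₁) (b := 0) (by linarith)
        (by linarith)
      rw [Real.rpow_zero] at this
      linarith
    have h2 := rpow_le_one_add hy.le hb.le (by linarith)
    have := mul_le_mul h1 h2 (Real.rpow_nonneg hy.le b) (by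
      have := Real.rpow_nonneg hx.le (-σ₁); linarith)
    linarith
  have hΦp : collisionKernel c α α' x y * p ≤ 2 * c * ((1 + x ^ (-σ₁)) * (1 + y)) := by
    have := mul_le_mul_of_nonneg_left (add_le_add (key α α' hpos hpos' hh hh' hl)
      (key α' α hpos' hpos hh' hh hl')) hc
    unfold collisionKernel
    linarith
  have hm : 0 ≤ (1 + y ^ (-σ₁)) * (1 + x) := by
    have := Real.rpow_nonneg hy.le (-σ₁)
    positivity
  have h2τ : 0 ≤ 2 / (1 - σ₁) := by positivity
  calc _ ≤ 2 / (1 - σ₁) * p * K x y := mul_le_mul_of_nonneg_right hwk (hK.nonneg x y hx.le hy.le)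
    _ ≤ 2 / (1 - σ₁) * p * collisionKernel c α α' x y :=
        mul_le_mul_of_nonneg_left (hK.le x y hx.le hy.le) (mul_nonneg h2τ hp0)
    _ = 2 / (1 - σ₁) * (collisionKernel c α α' x y * p) := by ring
    _ ≤ 2 / (1 - σ₁) * (2 * c * ((1 + x ^ (-σ₁)) * (1 + y))) := mul_le_mul_of_nonneg_left hΦp h2τ
    _ = 4 * c / (1 - σ₁) * ((1 + x ^ (-σ₁)) * (1 + y)) := by ring
    _ ≤ _ := mul_le_mul_of_nonneg_left (by linarith) (by positivity)

theorem add_rpow_le_of_le {x y r : ℝ} (hx : 0 < x) (hy : 0 < y) (hyx : y ≤ x) (hr1 : 1 ≤ r)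
    (hr3 : r ≤ 3) : (x + y) ^ r ≤ x ^ r + 7 * (y * x ^ (r - 1)) := by
  -- With y ≤ x, 1 + y/x is a convex combination of 1 and 2. On [1, 2] the function s^r lies below
  -- its chord, whose slope 2^r - 1 is at most 7.
  have hconv := @(convexOn_rpow hr1).2 1 (by simp) 2 (by simp) (1 - y / x) (y / x) (by rw [sub_nonneg, div_le_one hx]; exact hyx)
    (by positivity) (by ring)
  simp only [smul_eq_mul, mul_one, Real.one_rpow] at hconv
  have h8 : (2 : ℝ) ^ r ≤ 8 := by
    calc (2 : ℝ) ^ r ≤ 2 ^ (3 : ℝ) := Real.rpow_le_rpow_of_exponent_le (by norm_num) hr3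
      _ = 8 := by norm_num
  have h1 : x + y = x * (1 - y / x + y / x * 2) := by field_simp; ring
  have hd : 0 ≤ y / x := by positivity
  rw [h1, Real.mul_rpow hx.le (by linarith)]
  have h2 : (1 - y / x + y / x * 2) ^ r ≤ 1 + 7 * (y / x) := by
    have := mul_le_mul_of_nonneg_left h8 hd
    linarith
  refine (mul_le_mul_of_nonneg_left h2 (Real.rpow_nonneg hx.le r)).trans (le_of_eq ?_)
  rw [Real.rpow_sub_one hx.ne']
  field_simp

/-- The moment production of the collision kernel for exponents at least one. -/
theorem IsExponents.weakKernel_pos_le (h : IsExponents α α' σ₁ σ₂) (hc : 0 ≤ c) (he : IsProb e)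
    (hK : IsSubkernel K (collisionKernel c α α')) {r : ℝ} (hr1 : 1 ≤ r) (hr3 : r ≤ 3) {x y : ℝ}
    (hx : 0 < x) (hy : 0 < y) :
    (weakKernel e (fun z => z ^ r) x y + weakKernel e (fun z => z ^ r) y x) * K x y
      ≤ 14 * c * ((1 + x ^ r) * (1 + y) + (1 + y ^ r) * (1 + x)) := by
  have hpos := h.pos
  have hpos' := h.pos'
  have hh := h.le_half
  have hh' := h.le_half'
  set p := (x + y) ^ r with hp
  have hp0 : 0 ≤ p := Real.rpow_nonneg (by linarith) _
  -- For r ≥ 1 the order is reversed: 1/(r + 1) ≤ 1/2, so coalescence is the worst case.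
  have hcoef : ∀ a b, 1 / 2 * e a b + (1 - e a b) / (r + 1) ≤ 1 / 2 := by
    intro a b
    have h1 := mul_le_mul_of_nonneg_left
      (one_div_le_one_div_of_le (by norm_num) (by linarith : (2 : ℝ) ≤ r + 1))
      (sub_nonneg.2 (he.le_one a b))
    have h2 : (1 - e a b) / (r + 1) = (1 - e a b) * (1 / (r + 1)) := by ring
    linarith
  have hwk : weakKernel e (fun z => z ^ r) x y + weakKernel e (fun z => z ^ r) y x
      ≤ p - x ^ r - y ^ r := by
    rw [weakKernel_rpow (by linarith) hx hy, weakKernel_rpow (by linarith) hy hx, add_comm y x]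
    have h1 := mul_le_mul_of_nonneg_right (hcoef x y) hp0
    have h2 := mul_le_mul_of_nonneg_right (hcoef y x) hp0
    linarith
  have main : ∀ x y, 0 < x → 0 < y → y ≤ x → ((x + y) ^ r - x ^ r - y ^ r)
      * collisionKernel c α α' x y ≤ 14 * c * ((1 + x ^ r) * (1 + y)) := by
    intro x y hx hy hyx
    have hΔ : (x + y) ^ r - x ^ r - y ^ r ≤ 7 * (y * x ^ (r - 1)) := by
      have := add_rpow_le_of_le hx hy hyx hr1 hr3
      have := Real.rpow_nonneg hy.le r
      linarith
    -- Since y ≤ x and a + b ≤ 1, the exponent of x stays at most r, and the moment inequality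
    -- closes.
    have key : ∀ a b : ℝ, 0 < a → 0 < b → a ≤ 1 / 2 → b ≤ 1 / 2 →
        y * x ^ (r - 1) * (x ^ a * y ^ b) ≤ (1 + x ^ r) * (1 + y) := by
      intro a b ha hb ha1 hb1
      have h1 : x ^ (r - 1) * (x ^ a * y ^ b) ≤ x ^ (r - 1 + (a + b)) := by
        rw [Real.rpow_add hx, Real.rpow_add hx]
        exact mul_le_mul_of_nonneg_left (mul_le_mul_of_nonneg_left
          (Real.rpow_le_rpow hy.le hyx hb.le) (Real.rpow_nonneg hx.le a))
          (Real.rpow_nonneg hx.le _)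
      have h2 := rpow_le_rpow_add_rpow (r := r - 1 + (a + b)) hx (a := 0) (b := r) (by linarith)
        (by linarith)
      rw [Real.rpow_zero] at h2
      have h3 := mul_le_mul_of_nonneg_left (h1.trans h2) hy.le
      have := Real.rpow_nonneg hx.le r
      linarith
    have hs := mul_le_mul_of_nonneg_left (add_le_add (key α α' hpos hpos' hh hh')
      (key α' α hpos' hpos hh' hh)) hc
    refine (mul_le_mul_of_nonneg_right hΔ (collisionKernel_nonneg hc hx.le hy.le)).trans ?_
    unfold collisionKernel
    linarith
  have hΔ0 : 0 ≤ p - x ^ r - y ^ r := by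
    have := Real.add_rpow_le_rpow_add hx.le hy.le hr1
    linarith
  have m1 : 0 ≤ 14 * c * ((1 + x ^ r) * (1 + y)) := by
    have := Real.rpow_nonneg hx.le r
    positivity
  have m2 : 0 ≤ 14 * c * ((1 + y ^ r) * (1 + x)) := by
    have := Real.rpow_nonneg hy.le r
    positivity
  refine (mul_le_mul_of_nonneg_right hwk (hK.nonneg x y hx.le hy.le)).trans
    ((mul_le_mul_of_nonneg_left (hK.le x y hx.le hy.le) hΔ0).trans ?_)
  rcases le_total y x with hyx | hyx
  · have := main x y hx hy hyx
    linarith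
  · have h1 := main y x hy hx hyx
    rw [add_comm y x, (isSubkernel_collisionKernel hc hpos hpos').symm y x hy.le hx.le] at h1
    linarith

end

section

variable {e K Φ : ℝ → ℝ → ℝ} {ω f₀ : ℝ → ℝ} {c α α' σ₁ σ₂ C A A₀ T N : ℝ}

/-! ### Truncated problems -/

/-- A continuous cutoff function, equal to `1` up to `N / 2` and to `0` from `N` on. -/
def cutoff (N s : ℝ) : ℝ := max 0 (min 1 (2 - 2 / N * s))

theorem continuous_cutoff (N : ℝ) : Continuous (cutoff N) := by unfold cutoff; fun_prop

theorem cutoff_nonneg (N s : ℝ) : 0 ≤ cutoff N s := le_max_left _ _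

theorem cutoff_le_one (N s : ℝ) : cutoff N s ≤ 1 := max_le zero_le_one (min_le_left _ _)

theorem cutoff_eq_zero (hN : 0 < N) {s : ℝ} (hs : N ≤ s) : cutoff N s = 0 := by
  have h : 2 ≤ 2 / N * s := by rw [div_mul_eq_mul_div, le_div_iff₀ hN]; linarith
  exact max_eq_left ((min_le_right _ _).trans (by linarith))

theorem cutoff_eq_one (hN : 0 < N) {s : ℝ} (hs : 2 * s ≤ N) : cutoff N s = 1 := by
  have h : 2 / N * s ≤ 1 := by rw [div_mul_eq_mul_div, div_le_iff₀ hN]; linarith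
  rw [cutoff, min_eq_left (by linarith), max_eq_right zero_le_one]

theorem one_sub_cutoff_le (hN : 0 < N) {s : ℝ} (hs : 0 ≤ s) : 1 - cutoff N s ≤ 2 / N * s := by
  have h0 : 0 ≤ 2 / N * s := by positivity
  have h1 : min 1 (2 - 2 / N * s) ≤ cutoff N s := le_max_right _ _
  rcases min_cases 1 (2 - 2 / N * s) with ⟨h, _⟩ | ⟨h, _⟩ <;> rw [h] at h1 <;> linarith

/-- A kernel without collisions of total size at least `N`. -/
def cutKernel (Φ : ℝ → ℝ → ℝ) (N x y : ℝ) : ℝ := Φ x y * cutoff N (x + y)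

theorem IsSubkernel.cut (hΦ : IsSubkernel Φ Φ) (N : ℝ) : IsSubkernel (cutKernel Φ N) Φ where
  continuous := by
    have h : Continuous fun p : ℝ × ℝ => Φ p.1 p.2 := hΦ.continuous
    exact h.mul ((continuous_cutoff N).comp (by fun_prop : Continuous fun p : ℝ × ℝ => p.1 + p.2))
  nonneg := fun x y hx hy => mul_nonneg (hΦ.nonneg x y hx hy) (cutoff_nonneg _ _)
  le := fun x y hx hy => mul_le_of_le_one_right (hΦ.nonneg x y hx hy) (cutoff_le_one _ _)
  symm := fun x y hx hy => by rw [cutKernel, cutKernel, hΦ.symm x y hx hy, add_comm]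

theorem abs_cutKernel_sub_le (hΦ : IsSubkernel Φ Φ) (hN : 0 < N) {x y : ℝ} (hx : 0 ≤ x)
    (hy : 0 ≤ y) : |cutKernel Φ N x y - Φ x y| ≤ 2 / N * ((x + y) * Φ x y) := by
  have h0 := hΦ.nonneg x y hx hy
  have h1 := one_sub_cutoff_le hN (add_nonneg hx hy)
  have h2 : cutKernel Φ N x y - Φ x y = -(Φ x y * (1 - cutoff N (x + y))) := by
    rw [cutKernel]; ring
  rw [h2, abs_neg, abs_mul, abs_of_nonneg h0, abs_of_nonneg (sub_nonneg.2 (cutoff_le_one _ _))]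
  have := mul_le_mul_of_nonneg_left h1 h0
  linarith

theorem abs_cutKernel_sub_cutKernel_le (hΦ : IsSubkernel Φ Φ) (hN : 0 < N) {N' : ℝ} (hN' : N ≤ N')
    {x y : ℝ} (hx : 0 ≤ x) (hy : 0 ≤ y) :
    |cutKernel Φ N' x y - cutKernel Φ N x y| ≤ 2 / N * ((x + y) * Φ x y) := by
  have h0 := hΦ.nonneg x y hx hy
  have hs := add_nonneg hx hy
  have h1 := one_sub_cutoff_le hN hs
  have h2 := (one_sub_cutoff_le (hN.trans_le hN') hs).trans
    (mul_le_mul_of_nonneg_right (div_le_div_of_nonneg_left zero_le_two hN hN') hs)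
  have h3 := cutoff_le_one N (x + y)
  have h4 := cutoff_le_one N' (x + y)
  have h5 : |cutoff N' (x + y) - cutoff N (x + y)| ≤ 2 / N * (x + y) := by
    rw [abs_le]; constructor <;> linarith
  rw [cutKernel, cutKernel, ← mul_sub, abs_mul, abs_of_nonneg h0]
  have := mul_le_mul_of_nonneg_left h5 h0
  linarith

theorem IsMild.isCompactMild {g : ℝ → ℝ → ℝ} (hg : IsMild e K T g) (hK : IsSubkernel K Φ)
    (h0 : ∀ z, N ≤ z → ∀ t, g z t = 0) : IsCompactMild e K Φ N T g :=
  ⟨hg, hK.continuous, hK.nonneg, hK.le, hK.symm, h0⟩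

theorem IsProfile.integrable_rpow (hf : IsProfile (classWeight σ₁ σ₂) A₀ f₀) {r : ℝ}
    (h1 : -σ₁ ≤ r) (h2 : r ≤ σ₂) : Integrable (fun z => z ^ r * f₀ z) posMeasure := by
  refine integrable_of_le_profile hf (c := 1)
    ((by fun_prop : Measurable fun z : ℝ => z ^ r).mul hf.continuous.measurable).aestronglyMeasurable
    fun z hz => ?_
  rw [abs_of_nonneg (mul_nonneg (Real.rpow_nonneg hz.le r) (hf.nonneg z)), one_mul]
  exact mul_le_mul_of_nonneg_right (rpow_le_classWeight hz h1 h2) (hf.nonneg z)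

theorem integral_mul_initial_le {g : ℝ → ℝ} {ψ : ℝ → ℝ} (hψ : ∀ z, 0 < z → 0 ≤ ψ z)
    (hg0 : ∀ z, 0 < z → 0 ≤ g z) (hle : ∀ z, 0 < z → g z ≤ f₀ z)
    (hi : Integrable (fun z => ψ z * f₀ z) posMeasure) :
    ∫ z, ψ z * g z ∂posMeasure ≤ ∫ z, ψ z * f₀ z ∂posMeasure :=
  integral_mono_of_nonneg (ae_posMeasure fun z hz => mul_nonneg (hψ z hz) (hg0 z hz)) hi
    (ae_posMeasure fun z hz => mul_le_mul_of_nonneg_left (hle z hz) (hψ z hz))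

/-- Growth of moments, uniformly in the truncation. -/
theorem IsExponents.moment_le (h : IsExponents α α' σ₁ σ₂) (he : IsProb e) (hT : 0 ≤ T)
    (hf : IsProfile (classWeight σ₁ σ₂) A₀ f₀) {r D : ℝ} (hr : -1 < r) (hr3 : r ≤ 3) (hD : 0 ≤ D)
    (hker : ∀ K, IsSubkernel K (collisionKernel c α α') → ∀ x y, 0 < x → 0 < y →
      (weakKernel e (fun z => z ^ r) x y + weakKernel e (fun z => z ^ r) y x) * K x y
        ≤ D * ((1 + x ^ r) * (1 + y) + (1 + y ^ r) * (1 + x))) :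
    ∃ a b : ℝ, 0 ≤ a ∧ 0 ≤ b ∧ ∀ (K : ℝ → ℝ → ℝ) (N : ℝ) (g : ℝ → ℝ → ℝ),
      IsSubkernel K (collisionKernel c α α') →
      IsCompactMild e K (collisionKernel c α α') N T g → (∀ z, 0 < z → g z 0 ≤ f₀ z) →
      ∀ t ∈ Icc 0 T, ∫ z, z ^ r * g z t ∂posMeasure
        ≤ a * ∫ z, z ^ r * g z 0 ∂posMeasure + b := by
  have hα := h.pos
  have hl := h.le_left
  have hh := h.le_half
  have hr' := h.le_right
  have i0 := hf.integrable_rpow (r := 0) (by linarith) (by linarith)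
  have i1 := hf.integrable_rpow (r := 1) (by linarith) (by linarith)
  simp only [Real.rpow_zero] at i0
  simp only [Real.rpow_one] at i1
  set m₀ := ∫ z, 1 * f₀ z ∂posMeasure with hm₀
  set m₁ := ∫ z, z * f₀ z ∂posMeasure with hm₁
  have hm₀0 : 0 ≤ m₀ := integral_nonneg fun z => mul_nonneg zero_le_one (hf.nonneg z)
  have hm₁0 : 0 ≤ m₁ := integral_nonneg_of_ae (ae_posMeasure fun z hz =>
    mul_nonneg hz.le (hf.nonneg z))
  have hb0 : 0 ≤ D * (m₀ + m₁) := by positivity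
  refine ⟨2 * Real.exp (2 * (D * (m₀ + m₁)) * T),
    2 * Real.exp (2 * (D * (m₀ + m₁)) * T) * (T * (D * (m₀ + m₁) * m₀)), by positivity,
    by positivity, fun K N g hK hg hle t ht => ?_⟩
  have e0 : ∫ z, g z 0 ∂posMeasure ≤ m₀ := by
    have := integral_mul_initial_le (ψ := fun _ => 1) (fun _ _ => zero_le_one)
      (fun z _ => hg.nonneg z 0) hle i0
    rw [hm₀]
    simpa using this
  have e1 : ∫ z, z * g z 0 ∂posMeasure ≤ m₁ := integral_mul_initial_le (ψ := fun z => z)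
    (fun _ hz => hz.le) (fun z _ => hg.nonneg z 0) hle i1
  refine (hg.moment_growth he hT hr hr3 hD (hker K hK) e0 e1 ht).trans ?_
  have hpos : 0 ≤ ∫ z, z ^ r * g z 0 ∂posMeasure := integral_nonneg_of_ae
    (ae_posMeasure fun z hz => mul_nonneg (Real.rpow_nonneg hz.le r) (hg.nonneg z 0))
  have hexp : Real.exp (2 * (D * (m₀ + m₁)) * t) ≤ Real.exp (2 * (D * (m₀ + m₁)) * T) :=
    Real.exp_le_exp.2 (mul_le_mul_of_nonneg_left ht.2 (by positivity))
  have := mul_le_mul_of_nonneg_left hexp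
    (by positivity : 0 ≤ 2 * (∫ z, z ^ r * g z 0 ∂posMeasure + T * (D * (m₀ + m₁) * m₀)))
  linarith

/-- The two powers of the class weight are treated separately by moment growth. The bound depends on
the datum, the efficiency and T, but not on the truncation, so it survives in the limit. -/
theorem IsExponents.exists_profile_bound (h : IsExponents α α' σ₁ σ₂) (hc : 0 ≤ c) (he : IsProb e)
    (hT : 0 ≤ T) (hf : IsProfile (classWeight σ₁ σ₂) A₀ f₀) :
    ∃ A, ∀ (K : ℝ → ℝ → ℝ) (N : ℝ) (g : ℝ → ℝ → ℝ), IsSubkernel K (collisionKernel c α α') →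
      IsCompactMild e K (collisionKernel c α α') N T g → (∀ z, 0 < z → g z 0 ≤ f₀ z) →
      ∀ t ∈ Icc 0 T, IsProfile (classWeight σ₁ σ₂) A fun z => g z t := by
  have hα := h.pos
  have hl := h.le_left
  have hh := h.le_half
  have hr := h.le_right
  have hr2 := h.right_le
  have hσ := h.left_lt
  have hD : 0 ≤ 4 * c / (1 - σ₁) := div_nonneg (by positivity) (by linarith)
  obtain ⟨a, b, ha, hb, hab⟩ := h.moment_le he hT hf (r := -σ₁) (by linarith) (by linarith)
    hD fun K hK x y hx hy => h.weakKernel_neg_le hc he hK hx hy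
  obtain ⟨a', b', ha', hb', hab'⟩ := h.moment_le he hT hf (r := σ₂) (by linarith) (by linarith)
    (by positivity : 0 ≤ 14 * c)
    fun K hK x y hx hy => h.weakKernel_pos_le hc he hK (by linarith) (by linarith) hx hy
  refine ⟨a * ∫ z, z ^ (-σ₁) * f₀ z ∂posMeasure + b + (a' * ∫ z, z ^ σ₂ * f₀ z ∂posMeasure + b'),
    fun K N g hK hg hle t ht => ?_⟩
  have i1 := hg.integrable_moment (r := -σ₁) (by linarith) ht
  have i2 := hg.integrable_moment (r := σ₂) (by linarith) ht
  have hfun : (fun z => classWeight σ₁ σ₂ z * g z t)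
      = fun z => z ^ (-σ₁) * g z t + z ^ σ₂ * g z t := by
    ext z; rw [classWeight]; ring
  have hini : ∀ r, -σ₁ ≤ r → r ≤ σ₂ → ∫ z, z ^ r * g z 0 ∂posMeasure
      ≤ ∫ z, z ^ r * f₀ z ∂posMeasure := fun r h1 h2 =>
    integral_mul_initial_le (fun z hz => Real.rpow_nonneg hz.le r) (fun z _ => hg.nonneg z 0) hle
      (hf.integrable_rpow h1 h2)
  refine ⟨hg.continuous_section t, fun z => hg.nonneg z t, by rw [hfun]; exact i1.add i2, ?_⟩
  rw [hfun, integral_add i1 i2]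
  have h1 := mul_le_mul_of_nonneg_left (hini (-σ₁) le_rfl (by linarith)) ha
  have h2 := mul_le_mul_of_nonneg_left (hini σ₂ (by linarith) le_rfl) ha'
  have h3 := hab K N g hK hg hle t ht
  have h4 := hab' K N g hK hg hle t ht
  linarith

/-- The initial datum need not have a third moment. After cutting at L it has one, of size at most
L² times the mass, and moment growth with r = 3 propagates this order. -/
theorem IsExponents.exists_cube_bound (h : IsExponents α α' σ₁ σ₂) (hc : 0 ≤ c) (he : IsProb e)
    (hT : 0 ≤ T) (hf : IsProfile (classWeight σ₁ σ₂) A₀ f₀) :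
    ∃ P, 0 ≤ P ∧ ∀ (K : ℝ → ℝ → ℝ) (N : ℝ) (g : ℝ → ℝ → ℝ) (L : ℝ),
      IsSubkernel K (collisionKernel c α α') →
      IsCompactMild e K (collisionKernel c α α') N T g → (∀ z, 0 < z → g z 0 ≤ f₀ z) →
      1 ≤ L → (∀ z, L ≤ z → g z 0 = 0) → ∀ t ∈ Icc 0 T,
      Integrable (fun z => (1 + z) ^ 3 * g z t) posMeasure ∧
        ∫ z, (1 + z) ^ 3 * g z t ∂posMeasure ≤ P * L ^ 2 := by
  have hα := h.pos
  have hl := h.le_left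
  have hh := h.le_half
  have hr := h.le_right
  obtain ⟨a, b, ha, hb, hab⟩ := h.moment_le he hT hf (r := 3) (by norm_num) le_rfl
    (by positivity : 0 ≤ 14 * c)
    fun K hK x y hx hy => h.weakKernel_pos_le hc he hK (by norm_num) le_rfl hx hy
  have i0 := hf.integrable_rpow (r := 0) (by linarith) (by linarith)
  have i1 := hf.integrable_rpow (r := 1) (by linarith) (by linarith)
  simp only [Real.rpow_zero] at i0
  simp only [Real.rpow_one] at i1
  have hm₀0 : 0 ≤ ∫ z, 1 * f₀ z ∂posMeasure :=
    integral_nonneg fun z => mul_nonneg zero_le_one (hf.nonneg z)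
  have hm₁0 : 0 ≤ ∫ z, z * f₀ z ∂posMeasure := integral_nonneg_of_ae (ae_posMeasure fun z hz =>
    mul_nonneg hz.le (hf.nonneg z))
  refine ⟨4 * (∫ z, 1 * f₀ z ∂posMeasure + (a * ∫ z, z * f₀ z ∂posMeasure + b)), by positivity,
    fun K N g L hK hg hle hL hL0 t ht => ?_⟩
  have j0 := hg.integrable ht
  have j3 := hg.integrable_moment (r := 3) (by norm_num) ht
  have hcube : ∀ z : ℝ, 0 < z → (1 + z) ^ 3 * g z t ≤ 4 * (g z t + z ^ (3 : ℝ) * g z t) := by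
    intro z hz
    have h1 : z ^ (3 : ℝ) = z ^ 3 := by exact_mod_cast Real.rpow_natCast z 3
    have h2 : (1 + z) ^ 3 ≤ 4 * (1 + z ^ 3) := by
      nlinarith [mul_nonneg (by linarith : 0 ≤ 1 + z) (sq_nonneg (1 - z))]
    rw [h1]
    have := mul_le_mul_of_nonneg_right h2 (hg.nonneg z t)
    linarith
  have hn : ∀ z : ℝ, 0 < z → 0 ≤ (1 + z) ^ 3 * g z t := fun z hz =>
    mul_nonneg (by positivity) (hg.nonneg z t)
  have j : Integrable (fun z => 4 * (g z t + z ^ (3 : ℝ) * g z t)) posMeasure :=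
    (j0.add j3).const_mul 4
  have hgc := hg.continuous_section t
  refine ⟨j.mono' (Continuous.aestronglyMeasurable (by fun_prop)) (ae_posMeasure fun z hz => ?_),
    ?_⟩
  · rw [Real.norm_of_nonneg (hn z hz)]; exact hcube z hz
  have h0 : ∫ z, g z t ∂posMeasure ≤ ∫ z, 1 * f₀ z ∂posMeasure := by
    refine (hg.integral_le he hT ht).trans ?_
    have := integral_mul_initial_le (ψ := fun _ => 1) (fun _ _ => zero_le_one)
      (fun z _ => hg.nonneg z 0) hle i0
    simpa using this
  have h3 : ∫ z, z ^ (3 : ℝ) * g z 0 ∂posMeasure ≤ L ^ 2 * ∫ z, z * f₀ z ∂posMeasure := by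
    rw [← integral_const_mul]
    refine integral_mono_of_nonneg (ae_posMeasure fun z hz =>
      mul_nonneg (Real.rpow_nonneg hz.le _) (hg.nonneg z 0)) (i1.const_mul _)
      (ae_posMeasure fun z hz => ?_)
    have e1 : z ^ (3 : ℝ) = z ^ 3 := by exact_mod_cast Real.rpow_natCast z 3
    have hf0 := hf.nonneg z
    simp only [e1]
    rcases le_total L z with hLz | hLz
    · rw [hL0 z hLz, mul_zero]; positivity
    · have e2 : z ^ 3 ≤ L ^ 2 * z := by
        have : z ^ 2 ≤ L ^ 2 := by gcongr
        nlinarith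
      rw [← mul_assoc]
      exact mul_le_mul e2 (hle z hz) (hg.nonneg z 0) (by positivity)
  have h4 := hab K N g hK hg hle t ht
  have h5 := mul_le_mul_of_nonneg_left h3 ha
  have hL1 : 1 ≤ L ^ 2 := one_le_pow₀ hL
  have h6 := le_mul_of_one_le_right hm₀0 hL1
  have h7 := le_mul_of_one_le_right hb hL1
  have h8 : ∫ z, (1 + z) ^ 3 * g z t ∂posMeasure
      ≤ 4 * (∫ z, g z t ∂posMeasure + ∫ z, z ^ (3 : ℝ) * g z t ∂posMeasure) := by
    rw [← integral_add j0 j3, ← integral_const_mul]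
    exact integral_mono_of_nonneg (ae_posMeasure hn) j (ae_posMeasure hcube)
  linarith

/-- The kernels differ by at most (2/N)(x + y) Φ. With w = (1 + x)(1 + y), each of 1 + x + y, x + y
and Φ/C is at most w, so the cube of w integrates to the square of the third moment. -/
theorem integral_cutKernel_error_le {N' M : ℝ} {h : ℝ → ℝ} (hd : IsDominated Φ ω C)
    (hΦ : IsSubkernel Φ Φ) (hN : 0 < N) (hN' : N ≤ N') (h0 : ∀ z, 0 ≤ h z)
    (hi : Integrable (fun z => (1 + z) ^ 3 * h z) posMeasure)
    (hM : ∫ z, (1 + z) ^ 3 * h z ∂posMeasure ≤ M) :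
    2 * ∫ p, (1 + (p.1 + p.2)) * (|cutKernel Φ N' p.1 p.2 - cutKernel Φ N p.1 p.2|
      * (h p.1 * h p.2)) ∂quadMeasure ≤ 4 * C / N * (M * M) := by
  have hC := hd.const_nonneg
  have hprod : Integrable (fun p : ℝ × ℝ => (1 + p.1) ^ 3 * h p.1 * ((1 + p.2) ^ 3 * h p.2))
    quadMeasure := hi.mul_prod hi
  have hpe : ∫ p : ℝ × ℝ, (1 + p.1) ^ 3 * h p.1 * ((1 + p.2) ^ 3 * h p.2) ∂quadMeasure
      = (∫ z, (1 + z) ^ 3 * h z ∂posMeasure) * ∫ z, (1 + z) ^ 3 * h z ∂posMeasure :=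
    integral_prod_mul (fun z => (1 + z) ^ 3 * h z) fun z => (1 + z) ^ 3 * h z
  have hI0 : 0 ≤ ∫ z, (1 + z) ^ 3 * h z ∂posMeasure := integral_nonneg_of_ae
    (ae_posMeasure fun z hz => mul_nonneg (by positivity) (h0 z))
  have h1 : ∫ p, (1 + (p.1 + p.2)) * (|cutKernel Φ N' p.1 p.2 - cutKernel Φ N p.1 p.2|
      * (h p.1 * h p.2)) ∂quadMeasure
      ≤ ∫ p : ℝ × ℝ, 2 / N * C * ((1 + p.1) ^ 3 * h p.1 * ((1 + p.2) ^ 3 * h p.2))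
        ∂quadMeasure := by
    refine integral_mono_of_nonneg (ae_quadMeasure fun x y hx hy => ?_) (hprod.const_mul _)
      (ae_quadMeasure fun x y hx hy => ?_)
    · have := h0 x
      have := h0 y
      exact mul_nonneg (by linarith) (mul_nonneg (abs_nonneg _) (by positivity))
    · have hhh := mul_nonneg (h0 x) (h0 y)
      have hxy := mul_pos hx hy
      have k1 := abs_cutKernel_sub_cutKernel_le hΦ hN hN' hx.le hy.le
      have k2 := hd.le_mul x y hx.le hy.le
      set w := (1 + x) * (1 + y) with hw
      have w1 : x + y ≤ w := by nlinarith
      have w2 : 1 + (x + y) ≤ w := by nlinarith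
      have w0 : 0 ≤ w := by positivity
      have hΦ0 := hΦ.nonneg x y hx.le hy.le
      have k3 : (1 + (x + y)) * ((x + y) * Φ x y) ≤ w * (w * (C * w)) :=
        mul_le_mul w2 (mul_le_mul w1 k2 hΦ0 w0) (mul_nonneg (by linarith) hΦ0) w0
      have k4 : (1 + (x + y)) * |cutKernel Φ N' x y - cutKernel Φ N x y|
          ≤ 2 / N * (w * (w * (C * w))) := by
        have a1 := mul_le_mul_of_nonneg_left k1 (by linarith : 0 ≤ 1 + (x + y))
        have a2 := mul_le_mul_of_nonneg_left k3 (by positivity : 0 ≤ 2 / N)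
        linarith
      have k5 := mul_le_mul_of_nonneg_right k4 hhh
      calc (1 + (x + y)) * (|cutKernel Φ N' x y - cutKernel Φ N x y| * (h x * h y))
          = (1 + (x + y)) * |cutKernel Φ N' x y - cutKernel Φ N x y| * (h x * h y) := by ring
        _ ≤ _ := k5
        _ = _ := by rw [hw]; ring
  rw [integral_const_mul, hpe] at h1
  have h2 := mul_le_mul hM hM hI0 (hI0.trans hM)
  have h3 := mul_le_mul_of_nonneg_left h2 (by positivity : 0 ≤ 2 / N * C)
  calc _ ≤ 2 * (2 / N * C * (M * M)) := by linarith
    _ = _ := by ring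

end

section

variable {e K Φ : ℝ → ℝ → ℝ} {ω f₀ : ℝ → ℝ} {c α α' σ₁ σ₂ C A A₀ T N : ℝ}

/-! ### Existence of approximations -/

theorem profileDist_comm (g h : ℝ → ℝ) : profileDist g h = profileDist h g := by
  unfold profileDist
  simp only [abs_sub_comm]

theorem IsProfile.integrable_one_add_mul (hd : IsDominated Φ ω C) (hf : IsProfile ω A₀ f₀) :
    Integrable (fun z => (1 + z) * f₀ z) posMeasure := by
  have hfc := hf.continuous
  refine integrable_of_le_profile hf (c := C)
    (Continuous.aestronglyMeasurable (by fun_prop)) fun z hz => ?_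
  rw [abs_of_nonneg (mul_nonneg (by linarith) (hf.nonneg z)), ← mul_assoc]
  exact mul_le_mul_of_nonneg_right (hd.le_weight z hz) (hf.nonneg z)

/-- The distance of a profile to its truncation. -/
def cutError (f₀ : ℝ → ℝ) (L : ℝ) : ℝ := ∫ z, (1 - cutoff L z) * ((1 + z) * f₀ z) ∂posMeasure

theorem cutError_integrable (hd : IsDominated Φ ω C) (hf : IsProfile ω A₀ f₀) (L : ℝ) :
    Integrable (fun z => (1 - cutoff L z) * ((1 + z) * f₀ z)) posMeasure := by
  have hfc := hf.continuous
  have hcc := continuous_cutoff L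
  refine (hf.integrable_one_add_mul hd).mono (Continuous.aestronglyMeasurable (by fun_prop))
    (ae_of_all _ fun z => ?_)
  rw [norm_mul]
  refine mul_le_of_le_one_left (norm_nonneg _) ?_
  rw [Real.norm_of_nonneg (sub_nonneg.2 (cutoff_le_one L z))]
  linarith [cutoff_nonneg L z]

theorem cutError_nonneg (hf : IsProfile ω A₀ f₀) (L : ℝ) : 0 ≤ cutError f₀ L :=
  integral_nonneg_of_ae (ae_posMeasure fun z hz => mul_nonneg
    (sub_nonneg.2 (cutoff_le_one L z)) (mul_nonneg (by linarith) (hf.nonneg z)))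

theorem tendsto_cutError (hd : IsDominated Φ ω C) (hf : IsProfile ω A₀ f₀) :
    Tendsto (fun n : ℕ => cutError f₀ (n + 1)) atTop (𝓝 0) := by
  have hfc := hf.continuous
  have h := tendsto_integral_of_dominated_convergence (μ := posMeasure)
    (F := fun (n : ℕ) z => (1 - cutoff (n + 1) z) * ((1 + z) * f₀ z)) (f := fun _ => 0)
    (fun z => |(1 + z) * f₀ z|) (fun n => (cutError_integrable hd hf _).aestronglyMeasurable)
    (hf.integrable_one_add_mul hd).abs (fun n => ae_of_all _ fun z => ?_)
    (ae_of_all _ fun z => ?_)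
  · simpa [cutError] using h
  · rw [Real.norm_eq_abs, abs_mul]
    refine mul_le_of_le_one_left (abs_nonneg _) ?_
    rw [abs_of_nonneg (sub_nonneg.2 (cutoff_le_one _ z))]
    linarith [cutoff_nonneg ((n : ℝ) + 1) z]
  · refine tendsto_const_nhds.congr' ?_
    filter_upwards [tendsto_natCast_atTop_atTop.eventually_ge_atTop (2 * z)] with n hn
    rw [cutoff_eq_one (by positivity) (by linarith), sub_self, zero_mul]

theorem profileDist_cut_le (hd : IsDominated Φ ω C) (hf : IsProfile ω A₀ f₀) {g h : ℝ → ℝ}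
    {L L' : ℝ} (hg : ∀ z, 0 < z → g z = f₀ z * cutoff L z)
    (hh : ∀ z, 0 < z → h z = f₀ z * cutoff L' z) :
    profileDist g h ≤ cutError f₀ L + cutError f₀ L' := by
  have i1 := cutError_integrable hd hf L
  have i2 := cutError_integrable hd hf L'
  rw [cutError, cutError, ← integral_add i1 i2]
  refine integral_mono_of_nonneg (ae_posMeasure fun z hz => mul_nonneg (by linarith)
    (abs_nonneg _)) (i1.add i2) (ae_posMeasure fun z hz => ?_)
  have h1 := cutoff_le_one L z
  have h2 := cutoff_le_one L' z
  have h3 : |cutoff L z - cutoff L' z| ≤ (1 - cutoff L z) + (1 - cutoff L' z) := by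
    rw [abs_le]; constructor <;> linarith
  have h4 := mul_le_mul_of_nonneg_left h3 (mul_nonneg (by linarith : 0 ≤ 1 + z) (hf.nonneg z))
  simp only
  rw [hg z hz, hh z hz, ← mul_sub, abs_mul, abs_of_nonneg (hf.nonneg z)]
  linarith

/-- Datum and kernel are truncated at different scales, L = n + 1 for sizes and N = L⁵ for
collisions. The stability error then tends to zero although third moments may grow like L². -/
theorem IsExponents.exists_isApproximation (h : IsExponents α α' σ₁ σ₂) (hc : 0 ≤ c)
    (hec : Continuous (uncurry e)) (he : IsProb e) (hT : 0 ≤ T)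
    (hf : IsProfile (classWeight σ₁ σ₂) A₀ f₀) :
    ∃ (A : ℝ) (K g : ℕ → ℝ → ℝ → ℝ) (η ε : ℕ → ℝ),
      IsApproximation e (collisionKernel c α α') (classWeight σ₁ σ₂) (8 * c + 2) A T f₀ K g η ε := by
  set Φ := collisionKernel c α α' with hΦdef
  set C := 8 * c + 2 with hCdef
  have hd : IsDominated Φ (classWeight σ₁ σ₂) C := h.isDominated hc
  have hC := hd.const_nonneg
  have hΦ : IsSubkernel Φ Φ := isSubkernel_collisionKernel hc h.pos h.pos'
  have h0T : (0 : ℝ) ∈ Icc 0 T := ⟨le_rfl, hT⟩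
  have hfc := hf.continuous
  -- The error (4C/N)(P L²)² is of order L⁴/N, so any power of L above the fourth will do.
  set N : ℕ → ℝ := fun n => ((n : ℝ) + 1) ^ 5 with hNdef
  have hL1 : ∀ n : ℕ, (1 : ℝ) ≤ (n : ℝ) + 1 := fun n => by
    have : (0 : ℝ) ≤ n := n.cast_nonneg
    linarith
  have hNL : ∀ n : ℕ, (n : ℝ) + 1 ≤ N n := fun n => le_self_pow₀ (hL1 n) (by norm_num)
  have hN : ∀ n, 0 < N n := fun n => by positivity
  have hNm : ∀ n m, n ≤ m → N n ≤ N m := fun n m hnm => by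
    have : (n : ℝ) ≤ m := by exact_mod_cast hnm
    simp only [hNdef]
    gcongr
  have hKs : ∀ n, IsSubkernel (cutKernel Φ (N n)) Φ := fun n => hΦ.cut (N n)
  have hex : ∀ n : ℕ, ∃ g : ℝ → ℝ → ℝ, IsMild e (cutKernel Φ (N n)) T g ∧
      (∀ z, 0 ≤ z → g z 0 = f₀ z * cutoff (n + 1) z) ∧ ∀ z, N n ≤ z → ∀ t, g z t = 0 := by
    intro n
    have hcc := continuous_cutoff ((n : ℝ) + 1)
    refine exists_mild_of_truncated (C := 2 * c) (γ := α + α') (hN n) hT hec he (hKs n).continuous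
      (hKs n).nonneg (fun x y _ _ hxy => ?_) (by positivity) (add_pos h.pos h.pos')
      (fun x y hx hy => ((hKs n).le x y hx hy).trans
        (collisionKernel_le_add_rpow hc h.pos h.pos' hx hy)) (hfc.mul hcc)
      (fun x => mul_nonneg (hf.nonneg x) (cutoff_nonneg _ _)) fun x hx => ?_
    · rw [cutKernel, cutoff_eq_zero (hN n) hxy, mul_zero]
    · rw [cutoff_eq_zero (by positivity) ((hNL n).trans hx), mul_zero]
  choose g hg hg0 hgN using hex
  have hgc := fun n => (hg n).isCompactMild (hKs n) (hgN n)
  have hgle : ∀ n z, 0 ≤ z → g n z 0 ≤ f₀ z := fun n z hz => by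
    rw [hg0 n z hz]; exact mul_le_of_le_one_right (hf.nonneg z) (cutoff_le_one _ _)
  obtain ⟨A, hA⟩ := h.exists_profile_bound hc he hT hf
  have hprof : ∀ n, ∀ t ∈ Icc 0 T, IsProfile (classWeight σ₁ σ₂) A fun z => g n z t := fun n =>
    hA _ _ _ (hKs n) (hgc n) fun z hz => hgle n z hz.le
  have hA0 := IsProfile.const_nonneg hd (hprof 0 0 h0T)
  obtain ⟨P, hP0, hP⟩ := h.exists_cube_bound hc he hT hf
  set E := 2 * Real.exp (2 * (C * (A + A)) * T) with hE
  set R : ℕ → ℝ := fun n => 4 * C * P ^ 2 * (1 / ((n : ℝ) + 1)) with hRdef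
  have hR0 : ∀ n, 0 ≤ R n := fun n => by positivity
  set η : ℕ → ℝ := fun n => E * (cutError f₀ (n + 1) + T * R n) with hη
  have hdist : ∀ n m, n ≤ m → ∀ t ∈ Icc 0 T,
      profileDist (fun z => g m z t) (fun z => g n z t) ≤ η m + η n := by
    intro n m hnm t ht
    -- The solution with the smaller truncation takes the role of `h`: only its third moment enters
    -- the kernel error.
    have hst := stability (R := R n) he hd (hKs m) (hKs n) (hg m) (hg n) (hprof m) (hprof n)
      (hR0 n) (fun s hs => by
        obtain ⟨j1, j2⟩ := hP _ _ _ ((n : ℝ) + 1) (hKs n) (hgc n) (fun z hz => hgle n z hz.le)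
          (hL1 n) (fun z hz => by
            rw [hg0 n z (by linarith [hL1 n]), cutoff_eq_zero (by positivity) hz, mul_zero]) s hs
        refine (integral_cutKernel_error_le hd hΦ (hN n) (hNm n m hnm)
          (fun z => (hg n).nonneg z s) j1 j2).trans (le_of_eq ?_)
        have : (n : ℝ) + 1 ≠ 0 := by positivity
        simp only [hRdef, hNdef]
        field_simp) ht
    have hd0 := profileDist_cut_le hd hf (g := fun z => g m z 0) (h := fun z => g n z 0)
      (fun z hz => hg0 m z hz.le) (fun z hz => hg0 n z hz.le)
    refine hst.trans ?_
    have hexp : Real.exp (2 * (C * (A + A)) * t) ≤ Real.exp (2 * (C * (A + A)) * T) :=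
      Real.exp_le_exp.2 (mul_le_mul_of_nonneg_left ht.2 (by positivity))
    have hTR : 0 ≤ T * R m := mul_nonneg hT (hR0 m)
    have hTR' : 0 ≤ T * R n := mul_nonneg hT (hR0 n)
    have h1 : 2 * (profileDist (fun z => g m z 0) (fun z => g n z 0) + T * R n)
        ≤ 2 * (cutError f₀ (m + 1) + T * R m + (cutError f₀ (n + 1) + T * R n)) := by linarith
    have hnn : 0 ≤ 2 * (cutError f₀ (m + 1) + T * R m + (cutError f₀ (n + 1) + T * R n)) := by
      have := cutError_nonneg hf ((m : ℝ) + 1)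
      have := cutError_nonneg hf ((n : ℝ) + 1)
      linarith
    refine (mul_le_mul h1 hexp (Real.exp_pos _).le hnn).trans (le_of_eq ?_)
    simp only [hη, hE]
    ring
  have hlarge : ∀ Z : ℝ, ∀ᶠ n : ℕ in atTop, 2 * Z ≤ (n : ℝ) + 1 := fun Z =>
    (tendsto_natCast_atTop_atTop.eventually_ge_atTop (2 * Z)).mono fun n hn => by linarith
  refine ⟨A, fun n => cutKernel Φ (N n), g, η, fun n => 2 / N n, hec, he, hd, hΦ, hKs, hg, hprof,
    fun n m t ht => ?_, ?_, fun n => by positivity,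
    fun n x y hx hy => abs_cutKernel_sub_le hΦ (hN n) hx hy, ?_, fun Z => ?_, fun Z => ?_,
    fun Z => ?_⟩
  · rcases le_total n m with hnm | hnm
    · rw [profileDist_comm, add_comm]; exact hdist n m hnm t ht
    · exact hdist m n hnm t ht
  · have h1 : Tendsto R atTop (𝓝 0) := by
      simpa [hRdef] using
        (tendsto_one_div_add_atTop_nhds_zero_nat (𝕜 := ℝ)).const_mul (4 * C * P ^ 2)
    simpa using ((tendsto_cutError hd hf).add (h1.const_mul T)).const_mul E
  · have h1 : Tendsto (fun n : ℕ => 2 * (1 / ((n : ℝ) + 1))) atTop (𝓝 0) := by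
      simpa using (tendsto_one_div_add_atTop_nhds_zero_nat (𝕜 := ℝ)).const_mul 2
    refine squeeze_zero (fun n => by positivity) (fun n => ?_) h1
    rw [mul_one_div]
    exact div_le_div_of_nonneg_left zero_le_two (by positivity) (hNL n)
  · filter_upwards [hlarge Z] with n hn x y hx hy hxy
    rw [cutKernel, cutoff_eq_one (hN n) (by linarith [hNL n]), mul_one]
  · obtain ⟨S₀, hS₀⟩ := (isCompact_Icc (a := (0 : ℝ)) (b := Z)).bddAbove_image hfc.continuousOn
    refine ⟨_, fun n t ht z hz => (hg n).local_bound (S₀ := S₀) hT (hz.1.trans hz.2) hec he hd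
      (hKs n) (hprof n) (fun x hx => (hgle n x hx.1).trans (hS₀ ⟨x, hx, rfl⟩)) ht hz⟩
  · filter_upwards [hlarge Z] with n hn z hz
    rw [hg0 n z hz.1, cutoff_eq_one (by positivity) (by linarith [hz.2]), mul_one]

end

/-! ### Return to the classical formulation and conclusion -/

section

variable {E K Φ : ℝ → ℝ → ℝ} {ω : ℝ → ℝ} {g : ℝ → ℝ → ℝ} {C A T σ₁ σ₂ : ℝ}

/-! ### Classical and mild solutions -/

/-- The extension of an efficiency to the plane. -/
def extend (E : ℝ → ℝ → ℝ) (x y : ℝ) : ℝ := E (max 0 x) (max 0 y)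

theorem extend_of_nonneg {x y : ℝ} (hx : 0 ≤ x) (hy : 0 ≤ y) : extend E x y = E x y := by
  rw [extend, max_eq_right hx, max_eq_right hy]

theorem IsEfficiency.continuous_extend (hE : IsEfficiency E) : Continuous (uncurry (extend E)) :=
  hE.continuousOn.comp_continuous (f := fun p : ℝ × ℝ => (max 0 p.1, max 0 p.2)) (by fun_prop)
    fun _ => ⟨mem_Ici.2 (le_max_left _ _), mem_Ici.2 (le_max_left _ _)⟩

theorem IsEfficiency.isProb_extend (hE : IsEfficiency E) : IsProb (extend E) where
  measurable := hE.continuous_extend.measurable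
  nonneg := fun _ _ => hE.nonneg _ _ (le_max_left _ _) (le_max_left _ _)
  le_one := fun _ _ => hE.le_one _ _ (le_max_left _ _) (le_max_left _ _)

theorem breakIntegrand_binary {z t r y : ℝ} (hz : z < r) :
    breakIntegrand Φ E binaryDistribution g z t r y
      = 2 * r⁻¹ * ((1 - E (r - y) y) * collisionRate Φ g (r - y) y t) := by
  rw [breakIntegrand, binaryDistribution, sub_add_cancel, if_pos hz.le]
  ring

theorem integral_breakIntegrand_binary {z t r : ℝ} (hz : z < r) :
    ∫ y in (0 : ℝ)..r, breakIntegrand Φ E binaryDistribution g z t r y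
      = 2 * (r⁻¹ * ∫ y in (0 : ℝ)..r, (1 - E (r - y) y) * collisionRate Φ g (r - y) y t) := by
  simp only [breakIntegrand_binary hz, intervalIntegral.integral_const_mul]
  ring

/-- The factor 1/2 of the breakage gain cancels the 2 in the binary distribution. On the tail r > z,
the restriction of fragments to sizes at most r is automatic. -/
theorem rhs_binary_eq (z t : ℝ) : rhs Φ E binaryDistribution g z t
    = collisionOp E (fun x y => collisionRate Φ g x y t) z := by
  have h : breakGain Φ E binaryDistribution g z t
      = breakOp E (fun x y => collisionRate Φ g x y t) z := by
    rw [breakGain, breakOp, ← integral_const_mul]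
    refine setIntegral_congr_fun measurableSet_Ioi fun r hr => ?_
    rw [integral_breakIntegrand_binary hr]
    ring
  rw [rhs, h]
  rfl

theorem rhs_binary_eq_extend {G : ℝ → ℝ → ℝ} {z t : ℝ} (hz : 0 ≤ z)
    (hG : ∀ x, 0 ≤ x → G x t = g x t) : rhs Φ E binaryDistribution g z t
      = collisionOp (extend E) (fun x y => collisionRate Φ G x y t) z := by
  rw [rhs_binary_eq]
  refine collisionOp_congr hz (fun x y hx hy => (extend_of_nonneg hx hy).symm) fun x y hx hy => ?_
  rw [collisionRate, collisionRate, hG x hx, hG y hy]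

/-- The operator is continuous on the strip, so the fundamental theorem of calculus differentiates
the integrated equation. Convergence of the integrals follows from the ω-moments. -/
theorem IsMild.isClassicalSolution {e g₀} (hE : IsEfficiency E) (he : e = extend E)
    (hΦ : IsDominated Φ ω C) (hs : IsSubkernel Φ Φ) (hg : IsMild e Φ T g)
    (hp : ∀ t ∈ Icc 0 T, IsProfile ω A fun z => g z t) (h0 : ∀ z, 0 ≤ z → g z 0 = g₀ z) :
    IsClassicalSolution Φ E binaryDistribution T g₀ g := by
  subst he
  have hec := hE.continuous_extend
  have hrhs : ∀ z t, 0 ≤ z → rhs Φ E binaryDistribution g z t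
      = collisionOp (extend E) (fun x y => collisionRate Φ g x y t) z := fun z t hz =>
    rhs_binary_eq_extend hz fun _ _ => rfl
  have hsec : ∀ f : ℝ → ℝ → ℝ, Continuous (uncurry f) → ∀ r : ℝ,
      Continuous fun y => f (r - y) y := fun f hf r =>
    hf.comp (f := fun y : ℝ => (r - y, y)) (by fun_prop)
  have hrate : ∀ t r, Continuous fun y => collisionRate Φ g (r - y) y t := fun t r =>
    hsec _ (hg.continuous_rate hs.continuous t) r
  have hinner : ∀ t r, 0 ≤ r → IntervalIntegrable
      (fun y => (1 - E (r - y) y) * collisionRate Φ g (r - y) y t) volume 0 r := by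
    intro t r hr
    have h1 : Continuous fun y => (1 - extend E (r - y) y) * collisionRate Φ g (r - y) y t :=
      (continuous_const.sub (hsec _ hec r)).mul (hrate t r)
    refine ContinuousOn.intervalIntegrable (h1.continuousOn.congr fun y hy => ?_)
    rw [uIcc_of_le hr] at hy
    simp only [extend_of_nonneg (sub_nonneg.2 hy.2) hy.1]
  have hopc := hg.continuousOn_op
  refine ⟨hg.continuous.continuousOn, ?_, ?_, ?_, ?_, ?_, ?_, h0⟩
  · rintro z t ⟨hz, ht⟩
    have h1 : Continuous fun y => extend E (z - y) y * collisionRate Φ g (z - y) y t :=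
      (hsec _ hec z).mul (hrate t z)
    refine ContinuousOn.intervalIntegrable (h1.continuousOn.congr fun y hy => ?_)
    rw [uIcc_of_le hz] at hy
    simp only [coagIntegrand, extend_of_nonneg (sub_nonneg.2 hy.2) hy.1]
  · rintro z t ⟨hz, ht⟩
    have h1 := (lossRate_integrable hΦ hs (hp t ht) hz).1.const_mul (g z t)
    exact h1.congr (ae_of_all _ fun y => by simp only [collisionRate]; ring)
  · rintro z t ⟨hz, ht⟩ r hr
    simp only [funext fun y => breakIntegrand_binary (Φ := Φ) (E := E) (g := g) (t := t) (y := y) hr]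
    exact (hinner t r (hz.out.trans hr.le)).const_mul _
  · rintro z t ⟨hz, ht⟩
    have h1 := breakOp_integrand_integrable hE.isProb_extend
      (continuous_pairRate hs.continuous (hp t ht).continuous).measurable
      (pairRate_inv_integrable hΦ hs (hp t ht))
    have h2 : IntegrableOn (fun r => r⁻¹ * ∫ y in (0 : ℝ)..r, (1 - extend E (r - y) y)
        * pairRate Φ (fun x => g x t) (r - y) y) (Ioi z) :=
      IntegrableOn.mono_set h1 (Ioi_subset_Ioi hz)
    refine IntegrableOn.congr_fun (h2.const_mul 2) (fun r hr => ?_) measurableSet_Ioi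
    have hr0 : 0 ≤ r := hz.out.trans (le_of_lt hr)
    rw [integral_breakIntegrand_binary hr]
    congr 2
    refine intervalIntegral.integral_congr fun y hy => ?_
    rw [uIcc_of_le hr0] at hy
    simp only [extend_of_nonneg (sub_nonneg.2 hy.2) hy.1]
    rfl
  · exact hopc.congr fun p hp => hrhs p.1 p.2 hp.1
  · rintro z t ⟨hz, ht⟩
    rw [hrhs z t hz]
    set q : ℝ → ℝ := fun s => collisionOp (extend E) (fun x y => collisionRate Φ g x y s) z with hq
    have hqc : ContinuousOn q (Icc 0 T) :=
      hopc.comp (f := fun s => (z, s)) (by fun_prop) fun s hs => ⟨hz, hs⟩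
    have hqi : IntervalIntegrable q volume 0 t := by
      refine (hqc.mono ?_).intervalIntegrable
      rw [uIcc_of_le ht.1]; exact Icc_subset_Icc_right ht.2
    -- Provides the filter instance for the one-sided fundamental theorem of calculus on `Icc 0 T`,
    -- which covers both endpoints.
    have : Fact (t ∈ Icc 0 T) := ⟨ht⟩
    have h1 : HasDerivWithinAt (fun t => g z 0 + ∫ s in (0 : ℝ)..t, q s) (q t) (Icc 0 T) t :=
      (intervalIntegral.integral_hasDerivWithinAt_right hqi
        (hqc.stronglyMeasurableAtFilter_nhdsWithin measurableSet_Icc t)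
        (hqc t ht)).const_add _
    exact h1.congr (fun s hs => hg.eq_add_integral z hz s hs) (hg.eq_add_integral z hz t ht)

/-- Integration in time gives the mild equation. The values off the strip are arbitrary, so the
solution is replaced by its constant extension from the strip, continuous and non-negative on the
plane. -/
theorem IsClassicalSolution.exists_isMild {g₀ : ℝ → ℝ} (hT : 0 ≤ T)
    (hg : IsClassicalSolution Φ E binaryDistribution T g₀ g)
    (hcls : g ∈ LambdaPos (-σ₁) σ₂ T) :
    ∃ (G : ℝ → ℝ → ℝ) (A : ℝ), IsMild (extend E) Φ T G ∧
      (∀ t ∈ Icc 0 T, IsProfile (classWeight σ₁ σ₂) A fun z => G z t) ∧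
      ∀ z t, 0 ≤ z → t ∈ Icc 0 T → G z t = g z t := by
  obtain ⟨hc, hn, A, hA⟩ := hcls
  have hcl : ∀ z t, (max 0 z, clamp T t) ∈ strip T := fun z t =>
    ⟨mem_Ici.2 (le_max_left _ _), clamp_nonneg T t, clamp_le hT t⟩
  set G : ℝ → ℝ → ℝ := fun z t => g (max 0 z) (clamp T t) with hG
  have hGg : ∀ z t, 0 ≤ z → t ∈ Icc 0 T → G z t = g z t := fun z t hz ht => by
    simp only [hG, max_eq_right hz, clamp_of_mem ht.1 ht.2]
  have hGc : Continuous (uncurry G) :=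
    hc.comp_continuous (f := fun p : ℝ × ℝ => (max 0 p.1, clamp T p.2))
      (by have := continuous_clamp T; fun_prop) fun p => hcl p.1 p.2
  have hG0 : ∀ z t, 0 ≤ G z t := fun z t => hn _ _ (hcl z t)
  have hrhs : ∀ z t, 0 ≤ z → t ∈ Icc 0 T → rhs Φ E binaryDistribution g z t
      = collisionOp (extend E) (fun x y => collisionRate Φ G x y t) z := fun z t hz ht =>
    rhs_binary_eq_extend hz fun x hx => hGg x t hx ht
  refine ⟨G, A, ⟨hGc, hG0, ?_, ?_⟩, ?_, hGg⟩
  · exact hg.deriv_continuousOn.congr fun p hp => (hrhs p.1 p.2 hp.1 hp.2).symm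
  · intro z hz t ht
    have h0T : (0 : ℝ) ∈ Icc 0 T := ⟨le_rfl, hT⟩
    have hsub : Icc 0 t ⊆ Icc 0 T := Icc_subset_Icc_right ht.2
    have hqc : ContinuousOn (fun s => rhs Φ E binaryDistribution g z s) (Icc 0 T) :=
      hg.deriv_continuousOn.comp (f := fun s => (z, s)) (by fun_prop) fun s hs => ⟨hz, hs⟩
    have hgc : ContinuousOn (fun s => g z s) (Icc 0 T) :=
      hc.comp (f := fun s => (z, s)) (by fun_prop) fun s hs => ⟨hz, hs⟩
    have h1 := intervalIntegral.integral_eq_sub_of_hasDerivAt_of_le ht.1 (hgc.mono hsub)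
      (fun s hs => (hg.hasDerivWithinAt z s ⟨hz, hsub ⟨hs.1.le, hs.2.le⟩⟩).hasDerivAt
        (Icc_mem_nhds hs.1 (hs.2.trans_le ht.2)))
      (ContinuousOn.intervalIntegrable (by rw [uIcc_of_le ht.1]; exact hqc.mono hsub))
    have h2 : ∫ s in (0 : ℝ)..t, rhs Φ E binaryDistribution g z s
        = ∫ s in (0 : ℝ)..t, collisionOp (extend E) (fun x y => collisionRate Φ G x y s) z := by
      refine intervalIntegral.integral_congr fun s hs => ?_
      rw [uIcc_of_le ht.1] at hs
      exact hrhs z s hz (hsub hs)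
    rw [hGg z t hz ht, hGg z 0 hz h0T, ← h2, h1]
    ring
  · intro t ht
    obtain ⟨h1, h2⟩ := hA t ht
    have h3 : ∀ z, 0 < z → (z ^ (-σ₁) + z ^ σ₂) * |g z t| = classWeight σ₁ σ₂ z * G z t := by
      intro z hz
      rw [hGg z t hz.le ht, abs_of_nonneg (hn z t ⟨hz.le, ht⟩), classWeight]
    refine ⟨hGc.comp (f := fun z => (z, t)) (by fun_prop), fun z => hG0 z t,
      Integrable.congr h1 (ae_posMeasure h3), ?_⟩
    rw [← integral_congr_ae (ae_posMeasure h3)]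
    exact h2

theorem mem_lambdaPos_of_isProfile {a b k : ℝ} (hgc : Continuous (uncurry g))
    (hg0 : ∀ z t, 0 ≤ g z t) (hk : ∀ z, 0 < z → z ^ a + z ^ b ≤ k * ω z) (hk0 : 0 ≤ k)
    (hp : ∀ t ∈ Icc 0 T, IsProfile ω A fun z => g z t) : g ∈ LambdaPos a b T := by
  refine ⟨hgc.continuousOn, fun z t _ => hg0 z t, k * A, fun t ht => ?_⟩
  have hsec : Continuous fun z => g z t := (hp t ht).continuous
  have hle : ∀ z, 0 < z → (z ^ a + z ^ b) * |g z t| ≤ k * (ω z * g z t) := fun z hz => by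
    rw [abs_of_nonneg (hg0 z t), ← mul_assoc]
    exact mul_le_mul_of_nonneg_right (hk z hz) (hg0 z t)
  have hn : ∀ z : ℝ, 0 < z → 0 ≤ (z ^ a + z ^ b) * |g z t| := fun z hz =>
    mul_nonneg (add_nonneg (Real.rpow_nonneg hz.le _) (Real.rpow_nonneg hz.le _)) (abs_nonneg _)
  have hm : Measurable fun z => (z ^ a + z ^ b) * |g z t| :=
    (by fun_prop : Measurable fun z : ℝ => z ^ a + z ^ b).mul hsec.abs.measurable
  have hi : Integrable (fun z => (z ^ a + z ^ b) * |g z t|) posMeasure :=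
    integrable_of_le_profile (hp t ht) hm.aestronglyMeasurable fun z hz => by
      rw [abs_of_nonneg (hn z hz)]; exact hle z hz
  refine ⟨hi, (integral_mono_ae hi ((hp t ht).integrable.const_mul k) (ae_posMeasure hle)).trans ?_⟩
  rw [integral_const_mul]
  exact mul_le_mul_of_nonneg_left (hp t ht).integral_le hk0

theorem IsProfile.mono {f : ℝ → ℝ} {B : ℝ} (hf : IsProfile ω A f) (h : A ≤ B) : IsProfile ω B f :=
  ⟨hf.continuous, hf.nonneg, hf.integrable, hf.integral_le.trans h⟩

theorem exists_profile_of_mem_lambdaPos {g₀ : ℝ → ℝ}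
    (hg₀ : (fun z _ => g₀ z) ∈ LambdaPos (-σ₁) σ₂ 0) :
    ∃ A, IsProfile (classWeight σ₁ σ₂) A fun z => g₀ (max 0 z) := by
  obtain ⟨hc, hn, A, hA⟩ := hg₀
  have hst : ∀ z : ℝ, (max 0 z, (0 : ℝ)) ∈ strip 0 := fun z =>
    ⟨mem_Ici.2 (le_max_left _ _), le_rfl, le_rfl⟩
  obtain ⟨h1, h2⟩ := hA 0 ⟨le_rfl, le_rfl⟩
  have h3 : ∀ z, 0 < z → (z ^ (-σ₁) + z ^ σ₂) * |g₀ z| = classWeight σ₁ σ₂ z * g₀ (max 0 z) := by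
    intro z hz
    rw [max_eq_right hz.le, abs_of_nonneg (hn z 0 ⟨hz.le, le_rfl, le_rfl⟩), classWeight]
  refine ⟨A, hc.comp_continuous (f := fun z : ℝ => (max 0 z, (0 : ℝ))) (by fun_prop) hst,
    fun z => hn _ 0 (hst z), Integrable.congr h1 (ae_posMeasure h3), ?_⟩
  rw [← integral_congr_ae (ae_posMeasure h3)]
  exact h2

/-- The limit of the approximations is the solution. A competitor is turned into a mild solution,
both ω-moment bounds are raised to their maximum, and the stability estimate identifies the two. -/
theorem exists_unique_solution {c α α' : ℝ} (h : IsExponents α α' σ₁ σ₂) (hc : 0 ≤ c) (hT : 0 ≤ T)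
    (hE : IsEfficiency E) {g₀ : ℝ → ℝ} (hg₀ : (fun z _ => g₀ z) ∈ LambdaPos (-σ₁) σ₂ 0) :
    ∃ g : ℝ → ℝ → ℝ, g ∈ solutionClass σ₁ σ₂ T ∧
      IsClassicalSolution (collisionKernel c α α') E binaryDistribution T g₀ g ∧
      IsMassConserving T g ∧ ∀ k : ℝ → ℝ → ℝ, k ∈ solutionClass σ₁ σ₂ T →
        IsClassicalSolution (collisionKernel c α α') E binaryDistribution T g₀ k →
        ∀ z t, (z, t) ∈ strip T → k z t = g z t := by
  have hd := h.isDominated hc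
  have hs := isSubkernel_collisionKernel hc h.pos h.pos'
  have hpos := h.pos
  have hl := h.le_left
  have hh := h.le_half
  have hr := h.le_right
  obtain ⟨A₀, hf⟩ := exists_profile_of_mem_lambdaPos hg₀
  obtain ⟨A, K, a, η, ε, ha⟩ :=
    h.exists_isApproximation hc hE.continuous_extend hE.isProb_extend hT hf
  obtain ⟨g, hg, hp, hg0⟩ := ha.exists_limit hT
  have hini : ∀ z, 0 ≤ z → g z 0 = g₀ z := fun z hz => by rw [hg0 z hz, max_eq_right hz]
  refine ⟨g, ⟨?_, Or.inr ?_⟩, hg.isClassicalSolution hE rfl hd hs hp hini, fun t ht => ⟨?_, ?_⟩,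
    fun k hk hks z t hzt => ?_⟩
  · exact mem_lambdaPos_of_isProfile (k := 1) hg.continuous hg.nonneg
      (fun z _ => by rw [one_mul, classWeight]) zero_le_one hp
  · refine mem_lambdaPos_of_isProfile (k := 2) hg.continuous hg.nonneg (fun z hz => ?_)
      zero_le_two hp
    have h1 : z ^ (1 : ℝ) ≤ classWeight σ₁ σ₂ z :=
      rpow_le_classWeight hz (by linarith) (by linarith)
    have h2 : z ^ σ₂ ≤ classWeight σ₁ σ₂ z := rpow_le_classWeight hz (by linarith) le_rfl
    linarith
  · simp only [Real.rpow_one]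
    exact (hp t ht).integrable_mul_self hd
  · simp only [moment, Real.rpow_one]
    exact hg.integral_mul_self_eq hE.isProb_extend hd hs hp ht
  · obtain ⟨G, B, hG, hGp, hGk⟩ := hks.exists_isMild hT hk.1
    rw [← hGk z t hzt.1 hzt.2]
    refine hG.eq_of_profile hE.isProb_extend hd hs hg
      (fun t ht => (hGp t ht).mono (le_max_right A B))
      (fun t ht => (hp t ht).mono (le_max_left A B)) (fun z hz => ?_) hzt.1 hzt.2
    rw [hGk z 0 hz.le ⟨le_rfl, hT⟩, hks.initial z hz.le, hini z hz.le]

end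

end

end CollisionalBreakage

theorem theorem2p1
    (c α α' σ₁ σ₂ T : ℝ) (hc : 0 ≤ c)
    (hα : 0 < α ∧ α ≤ 1 / 2) (hα' : 0 < α' ∧ α' ≤ 1 / 2)
    (hσ₁ : max (1 - α) (1 - α') ≤ σ₁ ∧ σ₁ < 1)
    (hσ₂ : max (1 + α) (1 + α') ≤ σ₂ ∧ σ₂ ≤ 2)
    (hT : 0 < T)
    (E : ℝ → ℝ → ℝ) (hE : CollisionalBreakage.IsEfficiency E)
    (g₀ : ℝ → ℝ) (hg₀ : (fun z _ => g₀ z) ∈ CollisionalBreakage.LambdaPos (-σ₁) σ₂ 0) :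
    ∃ g : ℝ → ℝ → ℝ,
      g ∈ CollisionalBreakage.solutionClass σ₁ σ₂ T ∧
      CollisionalBreakage.IsClassicalSolution (CollisionalBreakage.collisionKernel c α α') E
        CollisionalBreakage.binaryDistribution T g₀ g ∧
      CollisionalBreakage.IsMassConserving T g ∧
      ∀ h : ℝ → ℝ → ℝ,
        h ∈ CollisionalBreakage.solutionClass σ₁ σ₂ T →
        CollisionalBreakage.IsClassicalSolution (CollisionalBreakage.collisionKernel c α α') E
          CollisionalBreakage.binaryDistribution T g₀ h →
        ∀ z t, (z, t) ∈ CollisionalBreakage.strip T → h z t = g z t := by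
  refine CollisionalBreakage.exists_unique_solution ⟨hα.1, hα'.1, hα.2, hα'.2, ?_, ?_, hσ₁.2, ?_, ?_,
    hσ₂.2⟩ hc hT.le hE hg₀
  · exact (le_max_left _ _).trans hσ₁.1
  · exact (le_max_right _ _).trans hσ₁.1
  · exact (le_max_left _ _).trans hσ₂.1
  · exact (le_max_right _ _).trans hσ₂.1
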